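/- Let $F|k$ be an extension of algebraically closed fields of characteristic zero of transcendence degree $n$, where $1\le n\le\infty$ ($n=\infty$ meaning countably infinite), and let $G=\mathrm{Aut}(F|k)$. For a field $E\supseteq k$ and a valuation ring $\mathcal O_w\supseteq k$ of $E$ with residue field $\kappa(w)$, let $w:E^\times\to\Gamma_w=E^\times/\mathcal O_w^\times$ be the projection, where $\Gamma_w$ is ordered by $w(x)\ge w(y)\iff xy^{-1}\in\mathcal O_w$. Let $\mathcal P^r_E$ be the set of valuation rings $\mathcal O_w\supseteq k$ of $E$ which are discrete of rank $r$, i.e. * $\dim_{\mathbb Q}(\Gamma_w\otimes\mathbb Q)=r$; * the isolated (convex) subgroups of $\Gamma_w$ form a chain $0=\Gamma_0\subsetneq\Gamma_1\subsetneq\dots\subsetneq\Gamma_r=\Gamma_w$; * $E$ is algebraic over the subfield generated over $k$ by some lift to $\mathcal O_w$ of a transcendence basis of $\kappa(w)|k$ and some elements $t_1,\dots,t_r\in E^\times$ with $w(t_1),\dots,w(t_r)$ linearly independent. Let $v\in\mathcal P^r_F$ with isolated subgroups $\Gamma_0\subset\dots\subset\Gamma_r$, let $G_v=\{g\in G\mid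 g(\mathcal O_v)=\mathcal O_v\}$, and let $G_v^\dagger$ be the kernel of the action of $G_v$ on $\kappa(v)$. Let $L$ be a finitely generated field extension of $k$ of transcendence degree $d$, and let $\{L\hookrightarrow F\}$ be the set of embeddings over $k$, on which $G$ acts by composition. For $I\subseteq\{1,\dots,r\}$ and $p\in\mathcal P^{|I|}_L$ let $O_{p,v,I}$ be the set of embeddings $\sigma:L\hookrightarrow F$ over $k$ such that $\sigma^{-1}(\mathcal O_v)=\mathcal O_p$ and, for $1\le i\le r$, $v(\sigma(L^\times))\cap\Gamma_i\ne v(\sigma(L^\times))\cap\Gamma_{i-1}$ if and only if $i\in I$. Each $\sigma\in O_{p,v,I}$ induces an embedding $\bar\sigma:\kappa(p)\hookrightarrow\kappa(v)$ over $k$. Put $m=\max(0,r+d-n)$ (so $m=0$ if $n=\infty$) and $M=\min(d,r)$. 1. If $m\le|I|\le M$ and $p\in\mathcal P^{|I|}_L$, then $O_{p,v,I}$ is a non-empty $G_v$-orbit. 2. The set $\{L\hookrightarrow F\}$ is the disjoint union of the sets $O_{p,v,I}$ over all $I\subseteq\{1,\dots,r\}$ with $m\le|I|\le M$ and all $p\in\mathcal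 P^{|I|}_L$. 3. There is an isomorphism of $\mathbb Q$-vector spaces $$\mathbb Q[\{L\hookrightarrow F\}]_{G_v^\dagger}\;\cong\;\bigoplus_{s=m}^{M}\ \bigoplus_{p\in\mathcal P^s_L}\mathbb Q[\{\kappa(p)\hookrightarrow\kappa(v)\}]^{\binom rs},$$ where the left side is the space of coinvariants, $\{\kappa(p)\hookrightarrow\kappa(v)\}$ is the set of embeddings over $k$, the $\binom rs$ copies are indexed by the $s$-element subsets $I\subseteq\{1,\dots,r\}$, and the class of $\sigma\in O_{p,v,I}$ goes to $\bar\sigma$ in the copy indexed by $(s,p,I)$, $s=|I|$. 4. There is a bijection $$G_v\backslash\{L\hookrightarrow F\}\;\cong\;\coprod_{s=m}^{M}(\mathcal P^s_L)^{\coprod\binom rs},$$ where the $\binom rs$ copies are indexed by the $s$-element subsets $I\subseteq\{1,\dots,r\}$, and the orbit of $\sigma\in O_{p,v,I}$ goes to $p$ in the copy indexed by $I$. -/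

import Mathlib

open scoped Pointwise DirectSum

noncomputable section

/-- A valuation ring of the field `L` that contains the field of constants `k`. -/
structure KValuationRing (k L : Type*) [Field k] [Field L] [Algebra k L] extends
    ValuationSubring L where
  algebraMap_mem' : ∀ c : k, algebraMap k L c ∈ toValuationSubring

namespace KValuationRing

variable {k L F : Type*} [Field k] [Field L] [Field F] [Algebra k L] [Algebra k F]

/-- A valuation ring containing `k` is a `k`-algebra. -/
instance algebraRing (A : KValuationRing k L) : Algebra k A.toValuationSubring :=
  ((algebraMap k L).codRestrict A.toValuationSubring A.algebraMap_mem').toAlgebra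

/-- The residue field `κ(A)`, a `k`-algebra. -/
abbrev ResidueField (A : KValuationRing k L) : Type _ :=
  IsLocalRing.ResidueField A.toValuationSubring

/-- The value group `Γ = Lˣ / Aˣ`, written additively. -/
def ValueGroup (A : KValuationRing k L) : Type _ :=
  Additive (Lˣ ⧸ A.toValuationSubring.unitGroup)

instance (A : KValuationRing k L) : AddCommGroup A.ValueGroup :=
  inferInstanceAs (AddCommGroup (Additive (Lˣ ⧸ A.toValuationSubring.unitGroup)))

/-- The valuation `Lˣ → Γ`, the natural projection. It is ordered by
`val x ≤ val y` if and only if `y / x` lies in `A`. -/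
def val (A : KValuationRing k L) (x : Lˣ) : A.ValueGroup :=
  Additive.ofMul (QuotientGroup.mk x)

/-- A subgroup `H` of `Γ` is isolated (convex) if `0 ≤ val x ≤ val y` and `val y ∈ H` imply
`val x ∈ H`. -/
def IsIsolated (A : KValuationRing k L) (H : AddSubgroup A.ValueGroup) : Prop :=
  ∀ x y : Lˣ, (x : L) ∈ A.toValuationSubring → ((y / x : Lˣ) : L) ∈ A.toValuationSubring →
    A.val y ∈ H → A.val x ∈ H

/-- `A` is discrete of rank `r`. -/
structure IsDiscreteOfRank (A : KValuationRing k L) (r : ℕ) : Prop where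
  /-- `Γ ⊗ ℚ` has dimension `r`. -/
  rank_eq : Module.rank ℤ A.ValueGroup = (r : Cardinal)
  /-- The isolated subgroups of `Γ` form a chain `Γ_0 ⊂ Γ_1 ⊂ ⋯ ⊂ Γ_r`. -/
  flag : Nonempty (Fin (r + 1) ≃o {H : AddSubgroup A.ValueGroup // A.IsIsolated H})
  /-- `L` is algebraic over the subfield generated over `k` by some lift `Y` of a transcendence
  basis of the residue field and some lift `t` of a maximal independent system in `Γ`. -/
  algebraic : ∃ (Y : Set A.toValuationSubring) (t : Fin r → Lˣ),
    IsTranscendenceBasis k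
      (fun y : Y => (IsLocalRing.residue A.toValuationSubring (y : A.toValuationSubring) :
        A.ResidueField)) ∧
    LinearIndependent ℤ (fun j => A.val (t j)) ∧
    Algebra.IsAlgebraic
      (IntermediateField.adjoin k
        ((fun y : A.toValuationSubring => (y : L)) '' Y ∪ Set.range fun j => (t j : L))) L

end KValuationRing

/-- The set `𝒫^r_L` of discrete valuation rings of rank `r` in `L` containing `k`. -/
def DiscVal (k L : Type*) [Field k] [Field L] [Algebra k L] (r : ℕ) : Type _ :=
  {A : KValuationRing k L // A.IsDiscreteOfRank r}

section

variable {k L F : Type*} [Field k] [Field L] [Field F] [Algebra k L] [Algebra k F]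

/-- The isolated subgroups `Γ_0 ⊂ Γ_1 ⊂ ⋯ ⊂ Γ_r` of the value group, in increasing order. The
order isomorphism chosen here is the only one. -/
def DiscVal.isolated {r : ℕ} (v : DiscVal k F r) (i : Fin (r + 1)) :
    AddSubgroup v.1.ValueGroup :=
  (v.2.flag.some i).1

/-- The image of `σ(Lˣ)` in the value group of `v`. -/
def DiscVal.valueImage {r : ℕ} (v : DiscVal k F r) (σ : L →ₐ[k] F) : Set v.1.ValueGroup :=
  Set.range fun x : Lˣ => v.1.val (Units.map (σ : L →* F) x)

/-- The set `O_{p,v,I}` of `k`-embeddings `σ : L → F` with `σ⁻¹(O_v) = O_p` for which the value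
group of `σ(L)` jumps between consecutive isolated subgroups of `v` exactly at `I`. The element
`i : Fin r` stands for the step from `Γ_i` to `Γ_{i+1}`. -/
def embeddingsAt {r : ℕ} (p : KValuationRing k L) (v : DiscVal k F r) (I : Finset (Fin r)) :
    Set (L →ₐ[k] F) :=
  {σ | v.1.toValuationSubring.comap (σ : L →+* F) = p.toValuationSubring ∧
    ∀ i : Fin r, v.valueImage σ ∩ (v.isolated i.succ : Set v.1.ValueGroup) ≠
      v.valueImage σ ∩ (v.isolated i.castSucc : Set v.1.ValueGroup) ↔ i ∈ I}

/-- The restriction `O_p → O_v` of an embedding `σ` with `σ⁻¹(O_v) = O_p`. -/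
def ringRestrict (p : KValuationRing k L) (v : KValuationRing k F) (σ : L →ₐ[k] F)
    (h : v.toValuationSubring.comap (σ : L →+* F) = p.toValuationSubring) :
    p.toValuationSubring →ₐ[k] v.toValuationSubring where
  toFun x := ⟨σ x, (SetLike.ext_iff.mp h (x : L)).mpr x.2⟩
  map_one' := Subtype.ext (map_one σ)
  map_mul' x y := Subtype.ext (map_mul σ (x : L) y)
  map_zero' := Subtype.ext (map_zero σ)
  map_add' x y := Subtype.ext (map_add σ (x : L) y)
  commutes' c := Subtype.ext (σ.commutes c)

theorem ringRestrict_isLocalHom (p : KValuationRing k L) (v : KValuationRing k F) (σ : L →ₐ[k] F)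
    (h : v.toValuationSubring.comap (σ : L →+* F) = p.toValuationSubring) :
    IsLocalHom (ringRestrict p v σ h).toRingHom := by
  refine ⟨fun x hx => ?_⟩
  obtain ⟨y, hy⟩ := hx.exists_right_inv
  have hy' : σ (x : L) * (y : F) = 1 := congrArg Subtype.val hy
  have hx0 : (x : L) ≠ 0 := by
    intro h0
    rw [h0, map_zero, zero_mul] at hy'
    exact zero_ne_one hy'
  have hinv : σ (x : L)⁻¹ = (y : F) := by
    rw [map_inv₀]
    exact inv_eq_of_mul_eq_one_right hy'
  have hmem : (x : L)⁻¹ ∈ p.toValuationSubring := by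
    refine (SetLike.ext_iff.mp h (x : L)⁻¹).mp ?_
    change σ (x : L)⁻¹ ∈ v.toValuationSubring
    rw [hinv]
    exact y.2
  exact IsUnit.of_mul_eq_one ⟨(x : L)⁻¹, hmem⟩ (Subtype.ext (mul_inv_cancel₀ hx0))

/-- The `k`-embedding `κ(p) → κ(v)` of residue fields induced by an embedding `σ` with
`σ⁻¹(O_v) = O_p`. -/
def residueEmbedding (p : KValuationRing k L) (v : KValuationRing k F) (σ : L →ₐ[k] F)
    (h : v.toValuationSubring.comap (σ : L →+* F) = p.toValuationSubring) :
    p.ResidueField →ₐ[k] v.ResidueField :=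
  haveI := ringRestrict_isLocalHom p v σ h
  { IsLocalRing.ResidueField.map (ringRestrict p v σ h).toRingHom with
    commutes' := fun c => congrArg (IsLocalRing.residue v.toValuationSubring)
      ((ringRestrict p v σ h).commutes c) }

/-- The automorphism group `G` of `F | k` acts on the `k`-embeddings `L → F` by composition. -/
instance embeddingsMulAction : MulAction (F ≃ₐ[k] F) (L →ₐ[k] F) where
  smul g σ := (g : F →ₐ[k] F).comp σ
  one_smul _ := rfl
  mul_smul _ _ _ := rfl

/-- The decomposition group `G_v = {g ∈ G | g(O_v) = O_v}`. -/
abbrev DiscVal.decomp {r : ℕ} (v : DiscVal k F r) : Subgroup (F ≃ₐ[k] F) :=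
  v.1.toValuationSubring.decompositionSubgroup k

/-- The inertia group `G_v^†`, the kernel of the action of `G_v` on `κ(v)`. -/
abbrev DiscVal.inertia {r : ℕ} (v : DiscVal k F r) : Subgroup v.decomp :=
  v.1.toValuationSubring.inertiaSubgroup k

/-- The number `max(0, r + d - n)`; subtraction in `ℕ∞` is truncated at `0`, and
`r + d - ∞ = 0`. -/
def minJumps (n : ℕ∞) (r d : ℕ) : ℕ := (((r + d : ℕ) : ℕ∞) - n).toNat

/-- The subsets of `{1, …, r}` with `s` elements. -/
abbrev JumpSet (r s : ℕ) : Type := {I : Finset (Fin r) // I.card = s}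

/-- The direct sum over `m ≤ s ≤ M` and over `p ∈ 𝒫^s_L` of the powers of
`ℚ[{κ(p) → κ(v)}]` with exponents the `s`-element subsets of `{1, …, r}`. -/
abbrev ResidueSum (L : Type*) [Field L] [Algebra k L] {r : ℕ} (v : DiscVal k F r) (m M : ℕ) :
    Type _ :=
  ⨁ s : Finset.Icc m M, ⨁ p : DiscVal k L s,
    (JumpSet r s → ((p.1.ResidueField →ₐ[k] v.1.ResidueField) →₀ ℚ))

open Classical in
/-- The generator of `ResidueSum` given by the embedding `φ : κ(p) → κ(v)`, placed in the copy
indexed by `I` of the summand indexed by `s` and `p`. -/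
def residueGen {r : ℕ} {v : DiscVal k F r} {m M : ℕ} (s : Finset.Icc m M) (p : DiscVal k L s)
    (I : JumpSet r s) (φ : p.1.ResidueField →ₐ[k] v.1.ResidueField) : ResidueSum L v m M :=
  DirectSum.of (fun s : Finset.Icc m M => ⨁ p : DiscVal k L s,
      (JumpSet r s → ((p.1.ResidueField →ₐ[k] v.1.ResidueField) →₀ ℚ))) s
    (DirectSum.of (fun p : DiscVal k L s =>
        (JumpSet r s → ((p.1.ResidueField →ₐ[k] v.1.ResidueField) →₀ ℚ))) p
      (Pi.single I (Finsupp.single φ 1)))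

end

end

/-! Everything rests on extending embeddings of valued fields together with a prescribed map ψ of
residue fields. There are two kinds of extension.

Transcendental (`GaussCompat.exists_extension_adjoin`): let the elements x have residues
algebraically independent over the residues of K, and let the elements t have values independent
modulo those of K. A nonzero polynomial in x and t is then a monomial in t times a unit with nonzero
residue, as for the Gauss valuation. Hence x and t may be sent to any y and u with matching residues
and matching signs of the values of monomials.

Algebraic (`exists_extension_of_isAlgebraic`): extend arbitrarily to an algebraic closure, then
correct by a Galois element. Primes of the integral closure over a fixed prime are conjugate, and
the decomposition group maps onto the automorphisms of the residue ring (`exists_galois_conj`).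

Values are controlled by levels: the level of x is the index of the least isolated subgroup
containing its value. In a product of factors of distinct levels, the factor of greatest level
decides both level and sign. As successive quotients of the isolated subgroups have rational rank
one, a level function is determined by its valuation ring and its range (`IsLevel.eq_of_range_eq`).

With base k, these extensions show that every embedding κ(p) → κ(v) comes from some σ in O_{p,v,I}.
With base L, take σ₁ and σ₂ in O_{p,v,I}. Over each σᵢ(L), the field F has a transcendence basis
made of a lift of one of κ(v) over κ(p) and of elements at the levels outside I
(`isTranscendenceBasis_of_jumps`). Matching these bases gives g in G_v with gσ₁ = σ₂, over any
compatible ψ. If the residue embeddings agree, ψ can be the identity, so g lies in the inertia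
group. The inertia orbits are thus indexed by (p, I, σ̄) and the G_v-orbits by (p, I). The same
count of transcendence degrees shows that σ⁻¹(O_v) is discrete of rank |I| and bounds |I|. -/

/-! ### Galois conjugacy of homomorphisms on an integral closure -/

theorem isInvariant_integralClosure {K N : Type*} [Field K] [Field N] [Algebra K N]
    [IsGalois K N] (B : ValuationSubring K) :
    Algebra.IsInvariant B (integralClosure B N) (N ≃ₐ[K] N) := by
  refine ⟨fun s hs => ?_⟩
  have h1 : (s : N) ∈ Set.range (algebraMap K N) := by
    rw [InfiniteGalois.mem_range_algebraMap_iff_fixed]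
    intro g
    exact congrArg Subtype.val (hs g)
  obtain ⟨a, ha⟩ := h1
  have h2 : IsIntegral B a := by
    have h3 : IsIntegral B (s : N) := s.2
    rw [← ha] at h3
    exact (isIntegral_algebraMap_iff (algebraMap K N).injective).1 h3
  obtain ⟨b, hb⟩ := IsIntegrallyClosed.isIntegral_iff.1 h2
  refine ⟨b, Subtype.ext ?_⟩
  rw [← ha, ← hb]
  rfl

/-- A monic polynomial over a subring of an algebraically closed field splits in the integral
closure. -/
theorem exists_map_eq_prod_X_sub_C_integralClosure {B N : Type*} [CommRing B] [Field N]
    [IsAlgClosed N] [Algebra B N] (P : Polynomial B) (hP : P.Monic) :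
    ∃ m : Multiset (integralClosure B N),
      P.map (algebraMap B (integralClosure B N)) =
        (m.map fun s => Polynomial.X - Polynomial.C s).prod := by
  have hsplit := IsAlgClosed.splits (P.map (algebraMap B N))
  have hroots : ∀ x ∈ (P.map (algebraMap B N)).roots, x ∈ integralClosure B N := by
    intro x hx
    refine ⟨P, hP, ?_⟩
    have := (Polynomial.mem_roots'.1 hx).2
    rwa [Polynomial.IsRoot, Polynomial.eval_map] at this
  refine ⟨(P.map (algebraMap B N)).roots.pmap (fun x hx => ⟨x, hx⟩) hroots, ?_⟩
  apply Polynomial.map_injective (algebraMap (integralClosure B N) N) Subtype.val_injective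
  rw [Polynomial.map_map, ← IsScalarTower.algebraMap_eq]
  conv_lhs => rw [hsplit.eq_prod_roots_of_monic (hP.map _)]
  rw [← Polynomial.coe_mapRingHom (f := algebraMap (integralClosure B N) N), map_multiset_prod,
    Multiset.map_map, Multiset.map_pmap]
  simp only [Function.comp, Polynomial.coe_mapRingHom, Polynomial.map_sub, Polynomial.map_X,
    Polynomial.map_C]
  congr 1
  exact (Multiset.pmap_eq_map _ _ _ hroots).symm

/-- Two homomorphisms from an integral closure in an algebraically closed field, which agree on
the base, take the same values up to conjugation. -/
theorem exists_eq_of_integralClosure {B N Ω : Type*} [CommRing B] [Field N]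
    [IsAlgClosed N] [Algebra B N] [Field Ω] (f₁ f₂ : integralClosure B N →+* Ω)
    (h : ∀ b : B, f₁ (algebraMap B _ b) = f₂ (algebraMap B _ b)) (s : integralClosure B N) :
    ∃ s', f₁ s = f₂ s' := by
  obtain ⟨P, hP, hPs⟩ : IsIntegral B (s : N) := s.2
  obtain ⟨m, hm⟩ := exists_map_eq_prod_X_sub_C_integralClosure (N := N) P hP
  have h0 : Polynomial.eval s (P.map (algebraMap B (integralClosure B N))) = 0 := by
    apply Subtype.val_injective
    rw [Polynomial.eval_map]
    have := Polynomial.hom_eval₂ P (algebraMap B (integralClosure B N))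
      (algebraMap (integralClosure B N) N) s
    refine this.trans ?_
    rw [← IsScalarTower.algebraMap_eq]
    exact hPs
  have h1 : Polynomial.eval (f₁ s) (P.map (f₁.comp (algebraMap B _))) = 0 := by
    rw [← Polynomial.map_map, Polynomial.eval_map, Polynomial.eval₂_at_apply, h0, map_zero]
  have h2 : f₁.comp (algebraMap B (integralClosure B N)) = f₂.comp (algebraMap B _) :=
    RingHom.ext h
  rw [h2, ← Polynomial.map_map, hm, ← Polynomial.coe_mapRingHom, map_multiset_prod,
    Multiset.map_map, Polynomial.eval_multiset_prod, Multiset.map_map,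
    Multiset.prod_eq_zero_iff] at h1
  obtain ⟨s', -, hs'⟩ := Multiset.mem_map.1 h1
  refine ⟨s', ?_⟩
  simpa [sub_eq_zero] using hs'

/-- The kernels are primes over the same prime of B, so some g₀ moves one to the other. The two maps
then embed the same quotient in Ω with the same image, so they differ by an automorphism of that
quotient, which lifts to its stabilizer. -/
theorem exists_galois_conj {K N Ω : Type*} [Field K] [Field N] [Algebra K N] [IsAlgClosed N]
    [IsGalois K N] (B : ValuationSubring K) [Field Ω]
    (f₁ f₂ : integralClosure B N →+* Ω)
    (h : ∀ b : B, f₁ (algebraMap B _ b) = f₂ (algebraMap B _ b)) :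
    ∃ g : N ≃ₐ[K] N, ∀ s, f₁ s = f₂ (g • s) := by
  have hinv := isInvariant_integralClosure (N := N) B
  -- With the discrete topology the action is continuous, since elements algebraic over K have open
  -- stabilizers; this allows infinite Galois extensions.
  let _ : TopologicalSpace (integralClosure B N) := ⊥
  have : DiscreteTopology (integralClosure B N) := ⟨rfl⟩
  have : ContinuousSMul (N ≃ₐ[K] N) (integralClosure B N) := by
    rw [continuousSMul_iff_stabilizer_isOpen]
    intro s
    convert stabilizer_isOpen_of_isIntegral (K := K) (s : N) using 1
    ext g
    exact Subtype.ext_iff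
  have hu : (RingHom.ker f₁).under B = (RingHom.ker f₂).under B := by
    ext b
    simp [Ideal.under, RingHom.mem_ker, h b]
  have := RingHom.ker_isPrime f₁
  have := RingHom.ker_isPrime f₂
  obtain ⟨g₀, hg₀⟩ := Algebra.IsInvariant.exists_smul_of_under_eq_of_profinite (A := B)
    (G := N ≃ₐ[K] N) (RingHom.ker f₁) (RingHom.ker f₂) hu
  let f₃ : integralClosure B N →+* Ω := f₂.comp (MulSemiringAction.toRingHom (N ≃ₐ[K] N) _ g₀)
  have hf₃ : ∀ s, f₃ s = f₂ (g₀ • s) := fun _ => rfl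
  have hk : RingHom.ker f₁ = RingHom.ker f₃ := by
    ext s
    rw [RingHom.mem_ker (f := f₃), hf₃, ← RingHom.mem_ker, hg₀, Ideal.smul_mem_pointwise_smul_iff]
  have h3 : ∀ b : B, f₁ (algebraMap B _ b) = f₃ (algebraMap B _ b) := by
    intro b
    rw [hf₃, smul_algebraMap, h]
  set Q := RingHom.ker f₁ with hQ
  let P := Q.under B
  let F₁ : integralClosure B N ⧸ Q →+* Ω := RingHom.kerLift f₁
  have hF₁ : Function.Injective F₁ := RingHom.kerLift_injective f₁
  let F₃ : integralClosure B N ⧸ Q →+* Ω := Ideal.Quotient.lift Q f₃ (fun a ha => by rwa [hk] at ha)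
  have hF₃ : Function.Injective F₃ := by
    rw [injective_iff_map_eq_zero]
    intro a
    obtain ⟨a, rfl⟩ := Ideal.Quotient.mk_surjective a
    intro ha
    rw [Ideal.Quotient.eq_zero_iff_mem, hk]
    exact ha
  -- Equality of the images of F₁ and F₃ makes F₃⁻¹F₁ a well-defined automorphism.
  have hs13 : ∀ a, ∃ a', F₃ a' = F₁ a := by
    intro a
    obtain ⟨a, rfl⟩ := Ideal.Quotient.mk_surjective a
    obtain ⟨a', ha'⟩ := exists_eq_of_integralClosure f₁ f₃ h3 a
    exact ⟨Ideal.Quotient.mk Q a', ha'.symm⟩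
  have hs31 : ∀ a, ∃ a', F₁ a' = F₃ a := by
    intro a
    obtain ⟨a, rfl⟩ := Ideal.Quotient.mk_surjective a
    obtain ⟨a', ha'⟩ := exists_eq_of_integralClosure f₃ f₁ (fun b => (h3 b).symm) a
    exact ⟨Ideal.Quotient.mk Q a', ha'.symm⟩
  choose τ hτ using hs13
  choose τ' hτ' using hs31
  let σ : (integralClosure B N ⧸ Q) ≃ₐ[B ⧸ P] (integralClosure B N ⧸ Q) :=
    { toFun := τ
      invFun := τ'
      left_inv := fun a => hF₁ (by rw [hτ', hτ])
      right_inv := fun a => hF₃ (by rw [hτ, hτ'])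
      map_mul' := fun a b => hF₃ (by rw [map_mul, hτ, hτ, hτ, map_mul])
      map_add' := fun a b => hF₃ (by rw [map_add, hτ, hτ, hτ, map_add])
      commutes' := fun b => hF₃ (by
        obtain ⟨b, rfl⟩ := Ideal.Quotient.mk_surjective b
        rw [hτ]
        exact h3 b) }
  obtain ⟨g₁, hg₁⟩ := Ideal.Quotient.stabilizerHom_surjective_of_profinite (G := N ≃ₐ[K] N) P Q σ
  refine ⟨g₀ * g₁, fun s => ?_⟩
  have e1 : F₃ (σ (Ideal.Quotient.mk Q s)) = f₁ s := hτ _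
  rw [← hg₁, Ideal.Quotient.stabilizerHom_apply] at e1
  rw [← e1, mul_smul]
  rfl

/-- An algebraic element `x` of a valuation ring `A` is a fraction of two elements which are
integral over the trace of `A` on the base, with denominator a unit of `A`. -/
theorem ValuationSubring.exists_integral_mul {K E : Type*} [Field K] [Field E] [Algebra K E]
    (A : ValuationSubring E) (x : E) (hx : x ∈ A) (halg : IsAlgebraic K x) :
    ∃ u : E, IsIntegral (A.comap (algebraMap K E)) u ∧
      IsIntegral (A.comap (algebraMap K E)) (u * x) ∧ u ∈ A ∧ u⁻¹ ∈ A ∧ u ≠ 0 := by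
  set B := A.comap (algebraMap K E) with hB
  rcases eq_or_ne x 0 with rfl | hx0
  · exact ⟨1, isIntegral_one, by simpa using isIntegral_zero, A.one_mem, by simp,
      one_ne_zero⟩
  obtain ⟨p, hp0, hp⟩ := halg
  -- Dividing by a coefficient of greatest valuation puts all coefficients in B with at least one a
  -- unit.
  obtain ⟨i₀, hi₀, hmax⟩ := Finset.exists_max_image p.support (fun i => B.valuation (p.coeff i))
    (Polynomial.support_nonempty.2 hp0)
  have hc₀ : p.coeff i₀ ≠ 0 := Polynomial.mem_support_iff.1 hi₀
  let a : ℕ → K := fun i => p.coeff i / p.coeff i₀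
  have haB : ∀ i, B.valuation (a i) ≤ 1 := by
    intro i
    simp only [a, map_div₀]
    by_cases hi : i ∈ p.support
    · exact div_le_one_of_le₀ (hmax i hi) zero_le
    · simp [Polynomial.notMem_support_iff.1 hi]
  have hmem : ∀ i, a i ∈ B := fun i => (B.valuation_le_one_iff _).1 (haB i)
  have hsum : ∑ i ∈ Finset.range (p.natDegree + 1), algebraMap K E (a i) * x ^ i = 0 := by
    have h1 : ∑ i ∈ Finset.range (p.natDegree + 1), algebraMap K E (p.coeff i) * x ^ i = 0 := by
      rw [← hp, Polynomial.aeval_eq_sum_range]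
      simp [Algebra.smul_def]
    simp only [a, map_div₀, div_mul_eq_mul_div]
    rw [← Finset.sum_div, h1, zero_div]
  have hi₀' : i₀ ∈ (Finset.range (p.natDegree + 1)).filter fun i => B.valuation (a i) = 1 := by
    refine Finset.mem_filter.2 ⟨Finset.mem_range_succ_iff.2 (Polynomial.le_natDegree_of_mem_supp _ hi₀), ?_⟩
    simp [a, hc₀]
  -- Cut the equation at the last unit coefficient j. The upper part u, divided by x ^ j, is
  -- congruent to the unit a j, and the equation reads u * x = -w with w a polynomial in x⁻¹.
  obtain ⟨j, hj, hjmax⟩ := Finset.exists_max_image _ id ⟨i₀, hi₀'⟩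
  obtain ⟨hjr, hj1⟩ := Finset.mem_filter.1 hj
  set n := p.natDegree + 1
  have hjn : j < n := Finset.mem_range.1 hjr
  let u : E := ∑ i ∈ Finset.Ico j n, algebraMap K E (a i) * x ^ (i - j)
  let w : E := ∑ i ∈ Finset.range j, algebraMap K E (a i) * x⁻¹ ^ (j - 1 - i)
  have hu : x ^ j * u + ∑ i ∈ Finset.range j, algebraMap K E (a i) * x ^ i = 0 := by
    rw [← hsum, add_comm, ← Finset.sum_range_add_sum_Ico _ hjn.le, Finset.mul_sum]
    congr 1
    refine Finset.sum_congr rfl fun i hi => ?_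
    obtain ⟨k, rfl⟩ := Nat.exists_eq_add_of_le (Finset.mem_Ico.1 hi).1
    rw [Nat.add_sub_cancel_left, pow_add]
    ring
  have hlt : ∀ i, j < i → i < n → algebraMap K E (a i) ∈ A.nonunits := by
    intro i hji hin
    have h1 : B.valuation (a i) ≠ 1 := fun h =>
      absurd (hjmax i (Finset.mem_filter.2 ⟨Finset.mem_range.2 hin, h⟩)) (not_le.2 hji)
    have h2 : a i ∈ B.nonunits := B.mem_nonunits_iff.2 (lt_of_le_of_ne (haB i) h1)
    rw [mem_nonunits_iff_or] at h2 ⊢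
    rcases h2 with h2 | h2
    · exact Or.inl (by rw [h2, map_zero])
    · exact Or.inr (fun h => h2 (by rwa [hB, mem_comap, map_inv₀]))
  have hu1 : A.valuation u = 1 := by
    have h1 : A.valuation (algebraMap K E (a j)) = 1 := by
      have h0 : a j ≠ 0 := fun h => by simp [h] at hj1
      refine le_antisymm ((A.valuation_le_one_iff _).2 (hmem j)) ?_
      have : (a j)⁻¹ ∈ B := (B.valuation_le_one_iff _).1 (by simp [hj1])
      have : A.valuation (algebraMap K E (a j))⁻¹ ≤ 1 := (A.valuation_le_one_iff _).2
        (by rw [← map_inv₀]; exact this)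
      rw [map_inv₀] at this
      exact (inv_le_one₀ (zero_lt_iff.2 (by simpa using h0))).1 this
    have h2 : u = algebraMap K E (a j) +
        ∑ i ∈ Finset.Ioo j n, algebraMap K E (a i) * x ^ (i - j) := by
      simp only [u]
      rw [← Finset.Ioo_insert_left hjn, Finset.sum_insert (by simp)]
      simp
    rw [h2, ← h1]
    apply Valuation.map_add_eq_of_lt_left
    rw [h1]
    refine Valuation.map_sum_lt _ one_ne_zero fun i hi => ?_
    obtain ⟨h3, h4⟩ := Finset.mem_Ioo.1 hi
    rw [map_mul, map_pow]
    exact mul_lt_one_of_lt_of_le (A.mem_nonunits_iff.1 (hlt i h3 h4))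
      (pow_le_one₀ zero_le ((A.valuation_le_one_iff _).2 hx))
  have hu0 : u ≠ 0 := fun h => by simp [h] at hu1
  have hj0 : j ≠ 0 := by
    intro h
    simp [h, hu0] at hu
  have huw : u * x = -w := by
    have h1 : x ^ (j - 1) * w = ∑ i ∈ Finset.range j, algebraMap K E (a i) * x ^ i := by
      simp only [w]
      rw [Finset.mul_sum]
      refine Finset.sum_congr rfl fun i hi => ?_
      obtain ⟨k, hk⟩ := Nat.exists_eq_add_of_le (Nat.le_sub_one_of_lt (Finset.mem_range.1 hi))
      rw [hk, Nat.add_sub_cancel_left, pow_add, inv_pow]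
      field_simp
    rw [← h1] at hu
    have h2 : x ^ (j - 1) * (u * x + w) = 0 := by
      rw [← hu]
      obtain ⟨k, rfl⟩ := Nat.exists_eq_succ_of_ne_zero hj0
      simp only [Nat.succ_eq_add_one, Nat.add_sub_cancel]
      ring
    exact eq_neg_of_add_eq_zero_left ((mul_eq_zero.1 h2).resolve_left (pow_ne_zero _ hx0))
  -- A valuation ring over B contains x, and then u as a polynomial in x, or it contains x⁻¹, and
  -- then -w. Lying in all such rings means being integral over B.
  have key : ∀ W : ValuationSubring E, (∀ b : B, algebraMap K E b ∈ W) → u ∈ W ∧ u * x ∈ W := by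
    intro W hW
    have hWa : ∀ i, algebraMap K E (a i) ∈ W := fun i => hW ⟨a i, hmem i⟩
    rcases W.mem_or_inv_mem x with h | h
    · have h1 : u ∈ W := sum_mem fun i _ => W.mul_mem _ _ (hWa i) (pow_mem h _)
      exact ⟨h1, W.mul_mem _ _ h1 h⟩
    · have h1 : u * x ∈ W := by
        rw [huw]
        exact W.neg_mem _ (sum_mem fun i _ => W.mul_mem _ _ (hWa i) (pow_mem h _))
      refine ⟨?_, h1⟩
      have : u = u * x * x⁻¹ := by field_simp
      rw [this]
      exact W.mul_mem _ _ h1 h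
  have hint : ∀ y : E, (∀ W : ValuationSubring E, (∀ b : B, algebraMap K E b ∈ W) → y ∈ W) →
      IsIntegral B y := by
    intro y hy
    by_contra hny
    have : IsIntegrallyClosedIn (integralClosure B E).toSubring E :=
      inferInstanceAs (IsIntegrallyClosedIn (integralClosure B E) E)
    obtain ⟨W, hW, hyW⟩ := Subring.exists_le_valuationSubring_of_isIntegrallyClosedIn
      (R := (integralClosure B E).toSubring) (x := y) hny
    exact hyW (hy W fun b => hW (algebraMap B (integralClosure B E) b).2)
  refine ⟨u, hint _ fun W hW => (key W hW).1, hint _ fun W hW => (key W hW).2,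
    (A.valuation_le_one_iff _).1 hu1.le, (A.valuation_le_one_iff _).1 ?_, hu0⟩
  rw [map_inv₀, hu1, inv_one]

/-! ### Residues as a relation on the ambient field -/

namespace ValuationSubring

variable {E : Type*} [Field E] (A : ValuationSubring E)

/-- The element `x` lies in the valuation ring `A` and has residue `a`. -/
def IsRes (x : E) (a : IsLocalRing.ResidueField A) : Prop :=
  ∃ h : x ∈ A, IsLocalRing.residue A ⟨x, h⟩ = a

variable {A} {x y : E} {a b : IsLocalRing.ResidueField A}

theorem isRes_residue (x : A) : A.IsRes x (IsLocalRing.residue A x) := ⟨x.2, rfl⟩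

theorem exists_isRes (h : x ∈ A) : ∃ a, A.IsRes x a := ⟨_, h, rfl⟩

theorem isRes_surjective (a : IsLocalRing.ResidueField A) : ∃ x, A.IsRes x a := by
  obtain ⟨x, rfl⟩ := IsLocalRing.residue_surjective a
  exact ⟨x, isRes_residue x⟩

theorem IsRes.mem (h : A.IsRes x a) : x ∈ A := h.1

theorem IsRes.unique (h : A.IsRes x a) (h' : A.IsRes x b) : a = b := h.2.symm.trans h'.2

theorem IsRes.add (h : A.IsRes x a) (h' : A.IsRes y b) : A.IsRes (x + y) (a + b) := by
  obtain ⟨h, rfl⟩ := h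
  obtain ⟨h', rfl⟩ := h'
  exact ⟨A.add_mem _ _ h h', map_add (IsLocalRing.residue A) ⟨x, h⟩ ⟨y, h'⟩⟩

theorem IsRes.mul (h : A.IsRes x a) (h' : A.IsRes y b) : A.IsRes (x * y) (a * b) := by
  obtain ⟨h, rfl⟩ := h
  obtain ⟨h', rfl⟩ := h'
  exact ⟨A.mul_mem _ _ h h', map_mul (IsLocalRing.residue A) ⟨x, h⟩ ⟨y, h'⟩⟩

theorem isRes_zero : A.IsRes 0 0 := ⟨A.zero_mem, map_zero (IsLocalRing.residue A)⟩

theorem isRes_one : A.IsRes 1 1 := ⟨A.one_mem, map_one (IsLocalRing.residue A)⟩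

theorem IsRes.sum {ι : Type*} (s : Finset ι) {f : ι → E} {g : ι → IsLocalRing.ResidueField A}
    (h : ∀ i ∈ s, A.IsRes (f i) (g i)) : A.IsRes (∑ i ∈ s, f i) (∑ i ∈ s, g i) := by
  classical
  induction s using Finset.induction_on with
  | empty => exact isRes_zero
  | insert i s hi ih =>
    rw [Finset.sum_insert hi, Finset.sum_insert hi]
    exact (h i (Finset.mem_insert_self _ _)).add
      (ih fun j hj => h j (Finset.mem_insert_of_mem hj))

theorem IsRes.prod {ι : Type*} (s : Finset ι) {f : ι → E} {g : ι → IsLocalRing.ResidueField A}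
    (h : ∀ i ∈ s, A.IsRes (f i) (g i)) : A.IsRes (∏ i ∈ s, f i) (∏ i ∈ s, g i) := by
  classical
  induction s using Finset.induction_on with
  | empty => exact isRes_one
  | insert i s hi ih =>
    rw [Finset.prod_insert hi, Finset.prod_insert hi]
    exact (h i (Finset.mem_insert_self _ _)).mul
      (ih fun j hj => h j (Finset.mem_insert_of_mem hj))

theorem IsRes.pow (h : A.IsRes x a) (n : ℕ) : A.IsRes (x ^ n) (a ^ n) := by
  induction n with
  | zero => simpa using isRes_one
  | succ n ih => rw [pow_succ, pow_succ]; exact ih.mul h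

theorem isRes_zero_iff : A.IsRes x 0 ↔ x ∈ A.nonunits := by
  rw [mem_nonunits_iff_exists_mem_maximalIdeal]
  exact exists_congr fun h => IsLocalRing.residue_eq_zero_iff _

theorem isRes_zero_iff_or : A.IsRes x 0 ↔ x = 0 ∨ x⁻¹ ∉ A := by
  rw [isRes_zero_iff, mem_nonunits_iff_or]

theorem IsRes.ne_zero (h : A.IsRes x a) (ha : a ≠ 0) : x ≠ 0 := by
  rintro rfl
  exact ha (h.unique isRes_zero)

theorem IsRes.inv_mem (h : A.IsRes x a) (ha : a ≠ 0) : x⁻¹ ∈ A := by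
  by_contra hx
  exact ha (h.unique (isRes_zero_iff_or.2 (Or.inr hx)))

theorem IsRes.inv (h : A.IsRes x a) (ha : a ≠ 0) : A.IsRes x⁻¹ a⁻¹ := by
  obtain ⟨b, hb⟩ := exists_isRes (h.inv_mem ha)
  have h1 := h.mul hb
  rw [mul_inv_cancel₀ (h.ne_zero ha)] at h1
  rwa [← eq_inv_of_mul_eq_one_right (isRes_one.unique h1).symm]

theorem IsRes.div (h : A.IsRes x a) (h' : A.IsRes y b) (hb : b ≠ 0) :
    A.IsRes (x / y) (a / b) := by
  rw [div_eq_mul_inv, div_eq_mul_inv]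
  exact h.mul (h'.inv hb)

theorem IsRes.ne_zero_of_inv_mem (h : A.IsRes x a) (hx : x ≠ 0) (h' : x⁻¹ ∈ A) : a ≠ 0 := by
  rintro rfl
  exact (isRes_zero_iff_or.1 h).elim hx fun h => h h'

theorem mem_of_isIntegral {K : Type*} [Field K] {B : ValuationSubring K} {N : Type*} [Field N]
    [Algebra K N] (f : N →+* E) (h : ∀ b : B, f (algebraMap K N b) ∈ A) (z : N)
    (hz : IsIntegral B z) : f z ∈ A := by
  have : IsIntegral A (f z) := by
    refine hz.map_of_comp_eq
      ((f.comp (algebraMap B N)).codRestrict A.toSubring h : B →+* A) f ?_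
    rfl
  obtain ⟨y, hy⟩ := IsIntegrallyClosed.isIntegral_iff.1 this
  rw [← hy]
  exact y.2

/-- A monic lift of the polynomial has a root in E; the root is integral over A, hence lies in A,
and reduces to a root. -/
instance residueField_isAlgClosed [IsAlgClosed E] :
    IsAlgClosed (IsLocalRing.ResidueField A) := by
  refine IsAlgClosed.of_exists_root _ fun p hp hirr => ?_
  obtain ⟨P, hP, hdeg, hPm⟩ := Polynomial.lifts_and_degree_eq_and_monic
    (f := IsLocalRing.residue A)
    (Polynomial.map_surjective _ IsLocalRing.residue_surjective p) hp
  obtain ⟨z, hz⟩ := IsAlgClosed.exists_root (P.map (algebraMap A E)) (by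
    rw [Polynomial.degree_map_eq_of_injective Subtype.val_injective, hdeg]
    exact (Polynomial.degree_pos_of_irreducible hirr).ne')
  have hint : IsIntegral A z := ⟨P, hPm, by rwa [Polynomial.IsRoot, Polynomial.eval_map] at hz⟩
  obtain ⟨y, rfl⟩ := IsIntegrallyClosed.isIntegral_iff.1 hint
  refine ⟨IsLocalRing.residue A y, ?_⟩
  rw [Polynomial.IsRoot, Polynomial.eval_map, Polynomial.eval₂_at_apply] at hz
  have hz' : P.eval y = 0 := Subtype.val_injective hz
  rw [← hP, Polynomial.eval_map, Polynomial.eval₂_at_apply, hz', map_zero]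

end ValuationSubring

/-! ### Extending valued embeddings along algebraic extensions -/

/-- Lying over gives a prime Q above the kernel of f, and the induced embedding of the quotient
extends to the algebraic extension S ⧸ Q because Ω is algebraically closed. -/
theorem exists_ringHom_extension_of_isIntegral {R S Ω : Type*} [CommRing R] [CommRing S]
    [Algebra R S] [Algebra.IsIntegral R S] (hinj : Function.Injective (algebraMap R S))
    [Field Ω] [IsAlgClosed Ω] (f : R →+* Ω) :
    ∃ g : S →+* Ω, ∀ x, g (algebraMap R S x) = f x := by
  have := RingHom.ker_isPrime f
  obtain ⟨Q, -, hQ, hQP⟩ := Ideal.exists_ideal_over_prime_of_isIntegral (RingHom.ker f)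
    (⊥ : Ideal S) (by
      intro x hx
      rw [Ideal.mem_comap, Ideal.mem_bot] at hx
      rw [(injective_iff_map_eq_zero _).1 hinj x hx]
      exact zero_mem _)
  have hle : ∀ x ∈ Q.comap (algebraMap R S), f x = 0 := fun x hx => by
    rwa [hQP, RingHom.mem_ker] at hx
  let fbar : R ⧸ Q.comap (algebraMap R S) →+* Ω := Ideal.Quotient.lift _ f hle
  have hfbar : Function.Injective fbar := by
    rw [injective_iff_map_eq_zero]
    intro x hx
    obtain ⟨x, rfl⟩ := Ideal.Quotient.mk_surjective x
    rw [Ideal.Quotient.lift_mk, ← RingHom.mem_ker, ← hQP] at hx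
    rwa [Ideal.Quotient.eq_zero_iff_mem]
  let _ : Algebra (R ⧸ Q.comap (algebraMap R S)) Ω := fbar.toAlgebra
  have : Module.IsTorsionFree (R ⧸ Q.comap (algebraMap R S)) Ω :=
    Module.isTorsionFree_iff_algebraMap_injective.2 hfbar
  have : Module.IsTorsionFree (R ⧸ Q.comap (algebraMap R S)) (S ⧸ Q) :=
    Module.isTorsionFree_iff_algebraMap_injective.2 (Ideal.quotientMap_injective' le_rfl)
  let g : S ⧸ Q →ₐ[R ⧸ Q.comap (algebraMap R S)] Ω := IsAlgClosed.lift
  refine ⟨(g : S ⧸ Q →+* Ω).comp (Ideal.Quotient.mk Q), fun x => ?_⟩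
  exact g.commutes (Ideal.Quotient.mk _ x)

open ValuationSubring in
/-- Extension of an embedding of valued fields along an algebraic extension, with a prescribed
extension of the residue field embedding. -/
theorem exists_extension_of_isAlgebraic {K E F : Type*} [Field K] [CharZero K] [Field E]
    [Algebra K E] [Algebra.IsAlgebraic K E] [Field F] [IsAlgClosed F] (A : ValuationSubring E)
    (V : ValuationSubring F) (σ : K →+* F)
    (ψ : IsLocalRing.ResidueField A →+* IsLocalRing.ResidueField V)
    (h : ∀ x a, A.IsRes (algebraMap K E x) a → V.IsRes (σ x) (ψ a)) :
    ∃ σ' : E →+* F, (∀ x, σ' (algebraMap K E x) = σ x) ∧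
      ∀ x a, A.IsRes x a → V.IsRes (σ' x) (ψ a) := by
  let N := AlgebraicClosure E
  have : Algebra.IsAlgebraic K N := Algebra.IsAlgebraic.trans K E N
  have : IsAlgClosure K N := ⟨inferInstance, inferInstance⟩
  have : IsGalois K N := ⟨⟩
  let _ : Algebra K F := σ.toAlgebra
  let τ : N →ₐ[K] F := IsAlgClosed.lift
  let B := A.comap (algebraMap K E)
  have hBV : ∀ b : B, (τ : N →+* F) (algebraMap K N b) ∈ V := fun b => by
    obtain ⟨a, ha⟩ := exists_isRes (mem_comap.1 b.2)
    have := (h _ _ ha).mem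
    change τ _ ∈ V
    rw [τ.commutes]
    exact this
  have hSV : ∀ s : integralClosure B N, τ s ∈ V := fun s =>
    mem_of_isIntegral (τ : N →+* F) hBV s s.2
  have hSA : ∀ s : integralClosure B E, (s : E) ∈ A := fun s =>
    mem_of_isIntegral (B := B) (RingHom.id E) (fun b => b.2) s s.2
  -- f₂ is the residue map of the arbitrary extension τ. It is compared with f₁, an extension to N
  -- of the map f₀ that ψ prescribes on the integral elements of E.
  let f₂ : integralClosure B N →+* IsLocalRing.ResidueField V :=
    (IsLocalRing.residue V).comp
      (((τ : N →+* F).comp (algebraMap (integralClosure B N) N)).codRestrict V.toSubring hSV)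
  have hf₂ : ∀ s : integralClosure B N, V.IsRes (τ s) (f₂ s) := fun s => ⟨hSV s, rfl⟩
  let f₀ : integralClosure B E →+* IsLocalRing.ResidueField V :=
    ψ.comp ((IsLocalRing.residue A).comp
      ((algebraMap (integralClosure B E) E).codRestrict A.toSubring hSA))
  have hf₀ : ∀ (s : integralClosure B E) a, A.IsRes (s : E) a → f₀ s = ψ a := by
    rintro s _ ⟨h1, rfl⟩
    rfl
  let j : integralClosure B E →ₐ[B] integralClosure B N :=
    (IsScalarTower.toAlgHom B E N).mapIntegralClosure
  have hj : ∀ s, (j s : N) = algebraMap E N s := fun _ => rfl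
  let _ : Algebra (integralClosure B E) (integralClosure B N) := j.toRingHom.toAlgebra
  have : IsScalarTower B (integralClosure B E) (integralClosure B N) :=
    IsScalarTower.of_algebraMap_eq fun b => (j.commutes b).symm
  have : Algebra.IsIntegral (integralClosure B E) (integralClosure B N) :=
    ⟨fun s => IsIntegral.tower_top (R := B) (IsIntegralClosure.isIntegral B N s)⟩
  obtain ⟨f₁, hf₁⟩ := exists_ringHom_extension_of_isIntegral (R := integralClosure B E)
    (S := integralClosure B N) (by
      intro s t hst
      have := congrArg Subtype.val hst
      exact Subtype.val_injective ((algebraMap E N).injective this)) f₀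
  obtain ⟨g, hg⟩ := exists_galois_conj B f₁ f₂ (by
    intro b
    refine (congrArg f₁ (j.commutes b).symm).trans ((hf₁ _).trans ?_)
    obtain ⟨a, ha⟩ := exists_isRes (mem_comap.1 b.2)
    rw [hf₀ _ a ha]
    have h1 := hf₂ (algebraMap B (integralClosure B N) b)
    have h2 := h _ _ ha
    have h3 : τ ((algebraMap B (integralClosure B N) b : integralClosure B N) : N) = σ b :=
      τ.commutes (b : K)
    rw [h3] at h1
    exact h2.unique h1)
  let σ' : E →+* F := (τ : N →+* F).comp ((g : N →+* N).comp (algebraMap E N))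
  have hσ' : ∀ (s : integralClosure B E) a, A.IsRes (s : E) a → V.IsRes (σ' s) (ψ a) := by
    intro s a hs
    have h1 : ψ a = f₂ (g • j s) := (hf₀ s a hs).symm.trans ((hf₁ s).symm.trans (hg _))
    rw [h1]
    exact hf₂ (g • j s)
  refine ⟨σ', fun x => ?_, fun x a hx => ?_⟩
  · change τ (g (algebraMap E N (algebraMap K E x))) = σ x
    rw [← IsScalarTower.algebraMap_apply, g.commutes, τ.commutes]
    rfl
  -- A general x in A is the quotient of the integral elements u * x and u, where u has nonzero
  -- residue.
  · obtain ⟨u, hu, hux, huA, huA', hu0⟩ := A.exists_integral_mul (K := K) x hx.mem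
      (Algebra.IsAlgebraic.isAlgebraic x)
    obtain ⟨c, hc⟩ := exists_isRes huA
    have hc0 := hc.ne_zero_of_inv_mem hu0 huA'
    have h1 := hσ' ⟨u, hu⟩ c hc
    have h2 := hσ' ⟨u * x, hux⟩ (c * a) (hc.mul hx)
    have h3 := h2.div h1 (by simpa using hc0)
    have h4 : σ' u ≠ 0 := by simpa using hu0
    simp only [map_mul] at h3
    rwa [mul_div_cancel_left₀ _ h4, mul_div_cancel_left₀ _ (by simpa using hc0)] at h3
-- Gauss extensions by independent residues and values
open ValuationSubring

/-- The monomial `c * ∏ t_j ^ m_j`. -/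
noncomputable def unitMonomial {K E τ : Type*} [Field K] [Field E] [Fintype τ] (f : K →+* E)
    (t : τ → Eˣ) (c : Kˣ) (m : τ → ℤ) : Eˣ :=
  Units.map (f : K →* E) c * ∏ j, t j ^ m j

theorem unitMonomial_mul {K E τ : Type*} [Field K] [Field E] [Fintype τ] (f : K →+* E)
    (t : τ → Eˣ) (c c' : Kˣ) (m m' : τ → ℤ) :
    unitMonomial f t (c * c') (m + m') = unitMonomial f t c m * unitMonomial f t c' m' := by
  simp only [unitMonomial, map_mul, Pi.add_apply, zpow_add, Finset.prod_mul_distrib]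
  exact mul_mul_mul_comm _ _ _ _

theorem unitMonomial_inv {K E τ : Type*} [Field K] [Field E] [Fintype τ] (f : K →+* E)
    (t : τ → Eˣ) (c : Kˣ) (m : τ → ℤ) :
    unitMonomial f t c⁻¹ (-m) = (unitMonomial f t c m)⁻¹ := by
  simp only [unitMonomial, map_inv, Pi.neg_apply, zpow_neg, Finset.prod_inv_distrib, mul_inv]

theorem unitMonomial_div {K E τ : Type*} [Field K] [Field E] [Fintype τ] (f : K →+* E)
    (t : τ → Eˣ) (c c' : Kˣ) (m m' : τ → ℤ) :
    unitMonomial f t (c / c') (m - m') = unitMonomial f t c m / unitMonomial f t c' m' := by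
  rw [div_eq_mul_inv, sub_eq_add_neg, unitMonomial_mul, unitMonomial_inv, div_eq_mul_inv]

/-- A combination of distinct monomials in algebraically independent elements is nonzero. -/
theorem AlgebraicIndependent.sum_mul_prod_ne_zero {R S ι τ : Type*} [CommRing R] [CommRing S]
    [Algebra R S] {xr : ι → S} (h : AlgebraicIndependent R xr) (s : Finset (ι ⊕ τ →₀ ℕ))
    (b : (ι ⊕ τ →₀ ℕ) → R) (d₀ : ι ⊕ τ →₀ ℕ) (hd₀ : d₀ ∈ s) (hb : b d₀ ≠ 0)
    (hs : ∀ d ∈ s, ∀ j, d (Sum.inr j) = d₀ (Sum.inr j)) :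
    ∑ d ∈ s, algebraMap R S (b d) * ∏ i ∈ d.support.toLeft, xr i ^ d (Sum.inl i) ≠ 0 := by
  classical
  let dl : (ι ⊕ τ →₀ ℕ) → (ι →₀ ℕ) := fun d => (Finsupp.sumFinsuppEquivProdFinsupp d).1
  have hrm : ∀ d, (∏ i ∈ d.support.toLeft, xr i ^ d (Sum.inl i)) =
      (dl d).prod fun i n => xr i ^ n := by
    intro d
    refine Finset.prod_congr ?_ fun i _ => rfl
    ext i
    simp [dl]
  let q : MvPolynomial ι R := ∑ d ∈ s, MvPolynomial.monomial (dl d) (b d)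
  have hq : MvPolynomial.aeval xr q =
      ∑ d ∈ s, algebraMap R S (b d) * ∏ i ∈ d.support.toLeft, xr i ^ d (Sum.inl i) := by
    simp only [q, map_sum]
    refine Finset.sum_congr rfl fun d hd => ?_
    rw [MvPolynomial.aeval_monomial, hrm]
  have hq0 : q.coeff (dl d₀) = b d₀ := by
    simp only [q, MvPolynomial.coeff_sum, MvPolynomial.coeff_monomial]
    rw [Finset.sum_eq_single d₀]
    · simp
    · intro d hd hne
      rw [if_neg]
      intro h'
      refine hne (Finsupp.ext fun i => ?_)
      rcases i with i | j
      · exact DFunLike.congr_fun h' i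
      · exact hs d hd j
    · intro h'
      exact absurd hd₀ h'
  rw [← hq]
  intro h0
  rw [h.eq_zero_of_aeval_eq_zero q h0, MvPolynomial.coeff_zero] at hq0
  exact hb hq0.symm

theorem prod_support_sumElim {E ι τ : Type*} [Field E] [Fintype τ] (z : ι → E) (s : τ → Eˣ)
    (d : ι ⊕ τ →₀ ℕ) :
    ∏ i ∈ d.support, Sum.elim z (fun j => (s j : E)) i ^ d i =
      (∏ i ∈ d.support.toLeft, z i ^ d (Sum.inl i)) * ∏ j, (s j : E) ^ d (Sum.inr j) := by
  classical
  have hsub : d.support ⊆ d.support.toLeft.disjSum (Finset.univ : Finset τ) := by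
    intro i hi
    rcases i with i | j
    · simpa using hi
    · simp
  rw [Finset.prod_subset hsub, Finset.prod_disjSum]
  · rfl
  · intro i _ hi
    rw [Finsupp.notMem_support_iff.1 hi, pow_zero]

theorem eval₂_sumElim_eq {K E ι τ : Type*} [Field K] [Field E] [Fintype τ] (f : K →+* E)
    (z : ι → E) (s : τ → Eˣ) (p : MvPolynomial (ι ⊕ τ) K) (cu : (ι ⊕ τ →₀ ℕ) → Kˣ)
    (hcu : ∀ d ∈ p.support, p.coeff d = cu d) (e : Eˣ) :
    MvPolynomial.eval₂ f (Sum.elim z fun j => (s j : E)) p =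
      e * ∑ d ∈ p.support, (unitMonomial f s (cu d) fun j => d (Sum.inr j) : Eˣ) / (e : E) *
        ∏ i ∈ d.support.toLeft, z i ^ d (Sum.inl i) := by
  rw [MvPolynomial.eval₂_eq, Finset.mul_sum]
  refine Finset.sum_congr rfl fun d hd => ?_
  rw [prod_support_sumElim, ← mul_assoc (e : E), mul_div_cancel₀ _ (Units.ne_zero e), hcu d hd]
  simp only [unitMonomial, Units.val_mul, Units.coe_map, Units.coe_prod, zpow_natCast,
    Units.val_pow_eq_pow_val, MonoidHom.coe_coe]
  ring

/-- Elements `x` of the valuation ring `A` with residues algebraically independent over the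
residues of `K`, and elements `t` with values independent modulo the values of `K`, together with
corresponding elements `y` and `u` of another valued field. -/
structure GaussCompat {K E F R ι τ : Type*} [Field K] [Field E] [Field F] [Algebra K E]
    [Fintype τ] (A : ValuationSubring E) (V : ValuationSubring F) [CommRing R]
    [Algebra R (IsLocalRing.ResidueField A)] (σ : K →+* F)
    (ψ : IsLocalRing.ResidueField A →+* IsLocalRing.ResidueField V) (x : ι → E)
    (xr : ι → IsLocalRing.ResidueField A) (y : ι → F) (t : τ → Eˣ) (u : τ → Fˣ) : Prop where
  compat : ∀ c a, A.IsRes (algebraMap K E c) a → V.IsRes (σ c) (ψ a)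
  mem_range : ∀ c a, A.IsRes (algebraMap K E c) a → a ∈ Set.range (algebraMap R _)
  indep : AlgebraicIndependent R xr
  isRes_left : ∀ i, A.IsRes (x i) (xr i)
  isRes_right : ∀ i, V.IsRes (y i) (ψ (xr i))
  mem_iff : ∀ c m, (unitMonomial (algebraMap K E) t c m : E) ∈ A ↔
    (unitMonomial σ u c m : F) ∈ V
  eq_zero : ∀ c m, (unitMonomial (algebraMap K E) t c m : E) ∈ A →
    ((unitMonomial (algebraMap K E) t c m)⁻¹ : E) ∈ A → m = 0

namespace GaussCompat

variable {K E F R ι τ : Type*} [Field K] [Field E] [Field F] [Algebra K E]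
    [Fintype τ] {A : ValuationSubring E} {V : ValuationSubring F} [CommRing R]
    [Algebra R (IsLocalRing.ResidueField A)] {σ : K →+* F}
    {ψ : IsLocalRing.ResidueField A →+* IsLocalRing.ResidueField V} {x : ι → E}
    {xr : ι → IsLocalRing.ResidueField A} {y : ι → F} {t : τ → Eˣ} {u : τ → Fˣ}

theorem isRes_zero_of_ne (h : GaussCompat (R := R) A V σ ψ x xr y t u) {c : Kˣ} {m : τ → ℤ}
    {a : IsLocalRing.ResidueField A} (ha : A.IsRes (unitMonomial (algebraMap K E) t c m : E) a)
    (hm : m ≠ 0) : a = 0 := by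
  refine ha.unique (isRes_zero_iff_or.2 (Or.inr fun h' => hm (h.eq_zero c m ha.mem h')))

theorem isRes_monomial (h : GaussCompat (R := R) A V σ ψ x xr y t u) {c : Kˣ} {m : τ → ℤ}
    {a : IsLocalRing.ResidueField A} (ha : A.IsRes (unitMonomial (algebraMap K E) t c m : E) a) :
    V.IsRes (unitMonomial σ u c m : F) (ψ a) := by
  by_cases hm : m = 0
  · subst hm
    simp only [unitMonomial, Pi.zero_apply, zpow_zero, Finset.prod_const_one, mul_one] at ha ⊢
    exact h.compat _ _ ha
  · rw [h.isRes_zero_of_ne ha hm, map_zero, isRes_zero_iff_or]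
    refine Or.inr fun h' => hm (h.eq_zero c m ha.mem ?_)
    rw [← Units.val_inv_eq_inv_val, ← unitMonomial_inv] at h' ⊢
    exact (h.mem_iff _ _).2 h'

/-- Every nonzero polynomial in `x` and `t` is a monomial in `t` times a unit, compatibly on both
sides. -/
theorem exists_normal_form (h : GaussCompat (R := R) A V σ ψ x xr y t u)
    (f : MvPolynomial (ι ⊕ τ) K) (hf : f ≠ 0) :
    ∃ (c : Kˣ) (m : τ → ℤ) (g : E) (g' : F) (r : IsLocalRing.ResidueField A), r ≠ 0 ∧
      A.IsRes g r ∧ V.IsRes g' (ψ r) ∧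
      MvPolynomial.eval₂ (algebraMap K E) (Sum.elim x fun j => (t j : E)) f =
        unitMonomial (algebraMap K E) t c m * g ∧
      MvPolynomial.eval₂ σ (Sum.elim y fun j => (u j : F)) f = unitMonomial σ u c m * g' := by
  classical
  let cu : (ι ⊕ τ →₀ ℕ) → Kˣ := fun d => if hd : f.coeff d = 0 then 1 else Units.mk0 _ hd
  have hcu : ∀ d ∈ f.support, f.coeff d = cu d := by
    intro d hd
    simp [cu, MvPolynomial.mem_support_iff.1 hd]
  let tm : (ι ⊕ τ →₀ ℕ) → τ → ℤ := fun d j => d (Sum.inr j)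
  let M : (ι ⊕ τ →₀ ℕ) → Eˣ := fun d => unitMonomial (algebraMap K E) t (cu d) (tm d)
  let M' : (ι ⊕ τ →₀ ℕ) → Fˣ := fun d => unitMonomial σ u (cu d) (tm d)
  -- The coefficient-and-t part of a term of greatest valuation is factored out; all quotients by it
  -- then lie in A.
  obtain ⟨d₀, hd₀, hmax⟩ := Finset.exists_max_image f.support (fun d => A.valuation (M d : E))
    (MvPolynomial.support_nonempty.2 hf)
  have hρ : ∀ d, ∃ a, d ∈ f.support → A.IsRes (M d / M d₀ : E) a := by
    intro d
    by_cases hd : d ∈ f.support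
    · obtain ⟨a, ha⟩ := exists_isRes (A := A) (x := (M d / M d₀ : E)) (by
        rw [← valuation_le_one_iff, map_div₀]
        exact div_le_one_of_le₀ (hmax d hd) zero_le)
      exact ⟨a, fun _ => ha⟩
    · exact ⟨0, fun h => absurd h hd⟩
  choose a ha using hρ
  have ha' : ∀ d ∈ f.support, A.IsRes
      (unitMonomial (algebraMap K E) t (cu d / cu d₀) (tm d - tm d₀) : E) (a d) := by
    intro d hd
    rw [unitMonomial_div, Units.val_div_eq_div_val]
    exact ha d hd
  have haV : ∀ d ∈ f.support, V.IsRes (M' d / M' d₀ : F) (ψ (a d)) := by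
    intro d hd
    have := h.isRes_monomial (ha' d hd)
    rwa [unitMonomial_div, Units.val_div_eq_div_val] at this
  let xm : (ι ⊕ τ →₀ ℕ) → E := fun d => ∏ i ∈ d.support.toLeft, x i ^ d (Sum.inl i)
  let ym : (ι ⊕ τ →₀ ℕ) → F := fun d => ∏ i ∈ d.support.toLeft, y i ^ d (Sum.inl i)
  let rm : (ι ⊕ τ →₀ ℕ) → IsLocalRing.ResidueField A :=
    fun d => ∏ i ∈ d.support.toLeft, xr i ^ d (Sum.inl i)
  have hxm : ∀ d, A.IsRes (xm d) (rm d) := fun d => IsRes.prod _ fun i _ => (h.isRes_left i).pow _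
  have hym : ∀ d, V.IsRes (ym d) (ψ (rm d)) := by
    intro d
    have : ψ (rm d) = ∏ i ∈ d.support.toLeft, ψ (xr i) ^ d (Sum.inl i) := by simp [rm]
    rw [this]
    exact IsRes.prod _ fun i _ => (h.isRes_right i).pow _
  refine ⟨cu d₀, tm d₀, ∑ d ∈ f.support, M d / M d₀ * xm d, ∑ d ∈ f.support, M' d / M' d₀ * ym d,
    ∑ d ∈ f.support, a d * rm d, ?_, IsRes.sum _ fun d hd => (ha d hd).mul (hxm d), ?_, ?_, ?_⟩
  -- Only the terms with the same t-exponents as d₀ survive in the residue. Their coefficients come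
  -- from R and the one at d₀ maps to 1, so independence of `xr` prevents cancellation.
  · have hlift : ∀ d, ∃ b : R, d ∈ f.support → tm d = tm d₀ → algebraMap R _ b = a d := by
      intro d
      by_cases hd : d ∈ f.support ∧ tm d = tm d₀
      · obtain ⟨hd, hd'⟩ := hd
        have h1 := ha' d hd
        rw [hd', sub_self] at h1
        simp only [unitMonomial, Pi.zero_apply, zpow_zero, Finset.prod_const_one, mul_one] at h1
        obtain ⟨b, hb⟩ := h.mem_range _ _ h1
        exact ⟨b, fun _ _ => hb⟩
      · exact ⟨0, fun h1 h2 => absurd ⟨h1, h2⟩ hd⟩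
    choose b hb using hlift
    have hsum : ∑ d ∈ f.support, a d * rm d =
        ∑ d ∈ f.support with tm d = tm d₀, algebraMap R _ (b d) * rm d := by
      rw [Finset.sum_filter]
      refine Finset.sum_congr rfl fun d hd => ?_
      split_ifs with hdt
      · rw [hb d hd hdt]
      · rw [h.isRes_zero_of_ne (ha' d hd) (sub_ne_zero.2 hdt), zero_mul]
    rw [hsum]
    refine h.indep.sum_mul_prod_ne_zero _ b d₀ (Finset.mem_filter.2 ⟨hd₀, rfl⟩) ?_ ?_
    · intro hb0
      have h2 := hb d₀ hd₀ rfl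
      have h3 := ha d₀ hd₀
      rw [div_self (Units.ne_zero _), ← h2, hb0, map_zero] at h3
      exact one_ne_zero (isRes_one.unique h3)
    · intro d hd j
      exact Nat.cast_injective (R := ℤ) (congrFun (Finset.mem_filter.1 hd).2 j)
  · rw [map_sum]
    refine IsRes.sum _ fun d hd => ?_
    rw [map_mul]
    exact (haV d hd).mul (hym d)
  · exact eval₂_sumElim_eq _ x t f cu hcu (M d₀)
  · exact eval₂_sumElim_eq _ y u f cu hcu (M' d₀)

theorem algebraicIndependent (h : GaussCompat (R := R) A V σ ψ x xr y t u) :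
    AlgebraicIndependent K (Sum.elim x fun j => (t j : E)) := by
  rw [algebraicIndependent_iff]
  intro p hp
  by_contra hp0
  obtain ⟨c, m, g, g', r, hr, hg, -, h1, -⟩ := h.exists_normal_form p hp0
  rw [MvPolynomial.aeval_def, h1] at hp
  exact mul_ne_zero (Units.ne_zero _) (hg.ne_zero hr) hp

theorem eval₂_ne_zero (h : GaussCompat (R := R) A V σ ψ x xr y t u)
    (p : MvPolynomial (ι ⊕ τ) K) (hp : p ≠ 0) :
    MvPolynomial.eval₂ σ (Sum.elim y fun j => (u j : F)) p ≠ 0 := by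
  obtain ⟨c, m, g, g', r, hr, -, hg, -, h1⟩ := h.exists_normal_form p hp
  rw [h1]
  exact mul_ne_zero (Units.ne_zero _) (hg.ne_zero (by simpa using hr))

/-- The substitution is injective on polynomials by the normal form, so it extends to rational
functions. A quotient of two normal forms is a monomial times a unit with known residues on both
sides, which reduces compatibility with ψ to monomials. -/
theorem exists_extension_adjoin (h : GaussCompat (R := R) A V σ ψ x xr y t u) :
    ∃ σ' : IntermediateField.adjoin K (Set.range (Sum.elim x fun j => (t j : E))) →+* F,
      (∀ c, σ' (algebraMap K _ c) = σ c) ∧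
      (∀ (z : IntermediateField.adjoin K (Set.range (Sum.elim x fun j => (t j : E)))) a,
        A.IsRes (z : E) a → V.IsRes (σ' z) (ψ a)) ∧
      (∀ i (hi : x i ∈ _), σ' ⟨x i, hi⟩ = y i) ∧ ∀ j (hj : (t j : E) ∈ _), σ' ⟨t j, hj⟩ = u j := by
  have hw := h.algebraicIndependent
  let e := hw.aevalEquivField
  let φ : MvPolynomial (ι ⊕ τ) K →+* F :=
    MvPolynomial.eval₂Hom σ (Sum.elim y fun j => (u j : F))
  have hφ : Function.Injective φ := by
    rw [injective_iff_map_eq_zero]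
    intro p hp
    by_contra hp0
    exact h.eval₂_ne_zero p hp0 hp
  let φ' : FractionRing (MvPolynomial (ι ⊕ τ) K) →+* F := IsFractionRing.lift hφ
  let σ' := φ'.comp e.symm.toRingEquiv.toRingHom
  have hpol : ∀ (p : MvPolynomial (ι ⊕ τ) K)
      (z : IntermediateField.adjoin K (Set.range (Sum.elim x fun j => (t j : E)))),
      (z : E) = MvPolynomial.eval₂ (algebraMap K E) (Sum.elim x fun j => (t j : E)) p →
      σ' z = MvPolynomial.eval₂ σ (Sum.elim y fun j => (u j : F)) p := by
    intro p z hz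
    have : e.symm z = algebraMap _ _ p := by
      rw [AlgEquiv.symm_apply_eq]
      apply Subtype.val_injective
      rw [hz, AlgebraicIndependent.aevalEquivField_algebraMap_apply_coe, MvPolynomial.aeval_def]
    change φ' (e.symm z) = _
    rw [this]
    exact IsFractionRing.lift_algebraMap hφ p
  refine ⟨σ', fun c => ?_, fun z a hz => ?_, fun i hi => ?_, fun j hj => ?_⟩
  · rw [hpol (MvPolynomial.C c)]
    · simp
    · simp
  · obtain ⟨p, q, hq, hpq⟩ := IsFractionRing.div_surjective (A := MvPolynomial (ι ⊕ τ) K) (e.symm z)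
    have hq0 := nonZeroDivisors.ne_zero hq
    have hz' : z = e (algebraMap _ _ p) / e (algebraMap _ _ q) := by
      rw [← map_div₀, hpq, AlgEquiv.apply_symm_apply]
    have hep : ∀ p, ((e (algebraMap _ _ p) : _) : E) =
        MvPolynomial.eval₂ (algebraMap K E) (Sum.elim x fun j => (t j : E)) p := by
      intro p
      rw [AlgebraicIndependent.aevalEquivField_algebraMap_apply_coe, MvPolynomial.aeval_def]
    have hσz : σ' z = MvPolynomial.eval₂ σ (Sum.elim y fun j => (u j : F)) p /
        MvPolynomial.eval₂ σ (Sum.elim y fun j => (u j : F)) q := by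
      rw [← hpol p _ (hep p), ← hpol q _ (hep q), ← map_div₀, ← hz']
    have hzE : (z : E) = MvPolynomial.eval₂ (algebraMap K E) (Sum.elim x fun j => (t j : E)) p /
        MvPolynomial.eval₂ (algebraMap K E) (Sum.elim x fun j => (t j : E)) q := by
      rw [hz', ← hep, ← hep]
      rfl
    rcases eq_or_ne p 0 with rfl | hp0
    · have : z = 0 := by rw [hz', map_zero, map_zero, zero_div]
      subst this
      rw [hz.unique isRes_zero, map_zero, map_zero]
      exact isRes_zero
    obtain ⟨c₁, m₁, g₁, g₁', r₁, hr₁, hg₁, hg₁', e₁, e₁'⟩ := h.exists_normal_form p hp0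
    obtain ⟨c₂, m₂, g₂, g₂', r₂, hr₂, hg₂, hg₂', e₂, e₂'⟩ := h.exists_normal_form q hq0
    have hr₁' : ψ r₁ ≠ 0 := by simpa using hr₁
    have hr₂' : ψ r₂ ≠ 0 := by simpa using hr₂
    rw [e₁, e₂] at hzE
    rw [e₁', e₂'] at hσz
    have h1 : (unitMonomial (algebraMap K E) t (c₁ / c₂) (m₁ - m₂) : E) = z * (g₂ / g₁) := by
      have := hg₁.ne_zero hr₁
      have := hg₂.ne_zero hr₂
      rw [unitMonomial_div, Units.val_div_eq_div_val, hzE]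
      field_simp
    have h2 : σ' z = (unitMonomial σ u (c₁ / c₂) (m₁ - m₂) : F) * (g₁' / g₂') := by
      rw [unitMonomial_div, Units.val_div_eq_div_val, hσz]
      exact (div_mul_div_comm _ _ _ _).symm
    have h3 := hz.mul (hg₂.div hg₁ hr₁)
    rw [← h1] at h3
    have h4 := (h.isRes_monomial h3).mul (hg₁'.div hg₂' hr₂')
    rw [← h2] at h4
    convert h4 using 1
    rw [map_mul, map_div₀]
    field_simp
  · rw [hpol (MvPolynomial.X (Sum.inl i))]
    · simp
    · simp
  · rw [hpol (MvPolynomial.X (Sum.inr j))]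
    · simp
    · simp

/-- An embedding of valued fields extends along `x ↦ y` and `t ↦ u`, followed by an algebraic
extension. -/
theorem exists_extension [CharZero K] [IsAlgClosed F]
    (h : GaussCompat (R := R) A V σ ψ x xr y t u)
    [Algebra.IsAlgebraic
      (IntermediateField.adjoin K (Set.range (Sum.elim x fun j => (t j : E)))) E] :
    ∃ σ' : E →+* F, (∀ c, σ' (algebraMap K E c) = σ c) ∧
      (∀ z a, A.IsRes z a → V.IsRes (σ' z) (ψ a)) ∧ (∀ i, σ' (x i) = y i) ∧
      ∀ j, σ' (t j) = u j := by
  obtain ⟨σ₁, h1, h2, h3, h4⟩ := h.exists_extension_adjoin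
  have : CharZero (IntermediateField.adjoin K (Set.range (Sum.elim x fun j => (t j : E)))) :=
    charZero_of_injective_algebraMap (algebraMap K _).injective
  obtain ⟨σ', h5, h6⟩ := exists_extension_of_isAlgebraic A V σ₁ ψ h2
  have hx : ∀ i, x i ∈ IntermediateField.adjoin K (Set.range (Sum.elim x fun j => (t j : E))) :=
    fun i => IntermediateField.subset_adjoin _ _ ⟨Sum.inl i, rfl⟩
  have ht : ∀ j, (t j : E) ∈
      IntermediateField.adjoin K (Set.range (Sum.elim x fun j => (t j : E))) :=
    fun j => IntermediateField.subset_adjoin _ _ ⟨Sum.inr j, rfl⟩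
  refine ⟨σ', fun c => ?_, h6, fun i => ?_, fun j => ?_⟩
  · rw [← h1 c, ← h5]
    rfl
  · rw [← h3 i (hx i), ← h5]
    rfl
  · rw [← h4 j (ht j), ← h5]
    rfl

end GaussCompat

/-! ### Level functions and their uniqueness -/

theorem ValuationSubring.mem_unitGroup_iff_mem_and_inv_mem {E : Type*} [Field E]
    (W : ValuationSubring E) (x : Eˣ) :
    x ∈ W.unitGroup ↔ (x : E) ∈ W ∧ ((x⁻¹ : Eˣ) : E) ∈ W := by
  rw [mem_unitGroup_iff, ← valuation_le_one_iff, ← valuation_le_one_iff,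
    Units.val_inv_eq_inv_val, map_inv₀, inv_le_one₀ (zero_lt_iff.2 (by simp))]
  exact le_antisymm_iff

/-- A function `lev` on `Fˣ` whose sublevel sets are convex subgroups for the valuation ring `V`,
with the units of `V` as level `0`. -/
structure IsLevel {F : Type*} [Field F] (V : ValuationSubring F) (lev : Fˣ → ℕ) : Prop where
  mul_le : ∀ x y, lev (x * y) ≤ max (lev x) (lev y)
  inv_eq : ∀ x, lev x⁻¹ = lev x
  eq_zero_iff : ∀ x, lev x = 0 ↔ x ∈ V.unitGroup
  le_of_mem : ∀ x y : Fˣ, (x : F) ∈ V → ((y / x : Fˣ) : F) ∈ V → lev x ≤ lev y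

/-- Successive quotients of the convex subgroups given by `lev` have rational rank at most one. -/
def HasRankOneSteps {F : Type*} [Field F] (lev : Fˣ → ℕ) : Prop :=
  ∀ x y, lev x = lev y → 0 < lev x → ∃ N M : ℤ, N ≠ 0 ∧ lev (x ^ N * y ^ M) < lev x

namespace IsLevel

variable {F : Type*} [Field F] {V : ValuationSubring F} {lev : Fˣ → ℕ}

theorem comap {L : Type*} [Field L] (h : IsLevel V lev) (σ : L →+* F) :
    IsLevel (V.comap σ) fun x => lev (Units.map (σ : L →* F) x) where
  mul_le x y := by rw [map_mul]; exact h.mul_le _ _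
  inv_eq x := by rw [map_inv]; exact h.inv_eq _
  eq_zero_iff x := by
    rw [h.eq_zero_iff, mem_unitGroup_iff_mem_and_inv_mem, mem_unitGroup_iff_mem_and_inv_mem,
      mem_comap, mem_comap, ← map_inv]
    rfl
  le_of_mem x y hx hy := by
    refine h.le_of_mem _ _ hx ?_
    rw [← map_div]
    exact hy

theorem one (h : IsLevel V lev) : lev 1 = 0 := (h.eq_zero_iff 1).2 (one_mem _)

theorem mul_eq_left (h : IsLevel V lev) {x y : Fˣ} (hxy : lev y < lev x) :
    lev (x * y) = lev x := by
  refine le_antisymm ((h.mul_le x y).trans (max_le le_rfl hxy.le)) ?_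
  have h1 := h.mul_le (x * y) y⁻¹
  rw [mul_inv_cancel_right, h.inv_eq] at h1
  rcases le_max_iff.1 h1 with h1 | h1
  · exact h1
  · omega

theorem mul_eq_right (h : IsLevel V lev) {x y : Fˣ} (hxy : lev x < lev y) :
    lev (x * y) = lev y := by
  rw [mul_comm, h.mul_eq_left hxy]

theorem mul_eq_of_zero (h : IsLevel V lev) {x y : Fˣ} (hy : lev y = 0) :
    lev (x * y) = lev x := by
  rcases Nat.eq_zero_or_pos (lev x) with hx | hx
  · have := h.mul_le x y
    rw [hx, hy] at this
    rw [hx]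
    simpa using this
  · exact h.mul_eq_left (by omega)

theorem pow_le (h : IsLevel V lev) (x : Fˣ) (n : ℕ) : lev (x ^ n) ≤ lev x := by
  induction n with
  | zero => simp [h.one]
  | succ n ih =>
    rw [pow_succ]
    exact (h.mul_le _ _).trans (max_le ih le_rfl)

theorem pow_eq (h : IsLevel V lev) (x : Fˣ) (n : ℕ) (hn : n ≠ 0) : lev (x ^ n) = lev x := by
  refine le_antisymm (h.pow_le x n) ?_
  obtain ⟨n, rfl⟩ := Nat.exists_eq_succ_of_ne_zero hn
  have key : ∀ y : Fˣ, (y : F) ∈ V → lev y ≤ lev (y ^ (n + 1)) := by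
    intro y hy
    refine h.le_of_mem _ _ hy ?_
    rw [pow_succ, mul_div_cancel_right, Units.val_pow_eq_pow_val]
    exact pow_mem hy n
  rcases V.mem_or_inv_mem x with hx | hx
  · exact key x hx
  · have := key x⁻¹ (by rwa [Units.val_inv_eq_inv_val])
    rwa [inv_pow, h.inv_eq, h.inv_eq] at this

theorem zpow_eq (h : IsLevel V lev) (x : Fˣ) (n : ℤ) (hn : n ≠ 0) : lev (x ^ n) = lev x := by
  obtain ⟨m, rfl | rfl⟩ := Int.eq_nat_or_neg n
  · rw [zpow_natCast]
    exact h.pow_eq x m (by simpa using hn)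
  · rw [zpow_neg, h.inv_eq, zpow_natCast]
    exact h.pow_eq x m (by simpa using hn)

theorem zpow_le (h : IsLevel V lev) (x : Fˣ) (n : ℤ) : lev (x ^ n) ≤ lev x := by
  rcases eq_or_ne n 0 with rfl | hn
  · simp [h.one]
  · exact (h.zpow_eq x n hn).le

theorem prod_lt (h : IsLevel V lev) {ι : Type*} (s : Finset ι) (f : ι → Fˣ) {c : ℕ}
    (hc : 0 < c) (hf : ∀ i ∈ s, lev (f i) < c) : lev (∏ i ∈ s, f i) < c := by
  classical
  induction s using Finset.induction_on with
  | empty => simpa [h.one]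
  | insert i s hi ih =>
    rw [Finset.prod_insert hi]
    exact (h.mul_le _ _).trans_lt (max_lt (hf i (Finset.mem_insert_self _ _))
      (ih fun j hj => hf j (Finset.mem_insert_of_mem hj)))

/-- Multiplication by an element of smaller level does not change the sign of the value. -/
theorem mul_mem_iff (h : IsLevel V lev) {x y : Fˣ} (hxy : lev y < lev x) :
    ((x * y : Fˣ) : F) ∈ V ↔ (x : F) ∈ V := by
  have key : ∀ x y : Fˣ, lev y < lev x → (x : F) ∈ V → ((x * y : Fˣ) : F) ∈ V := by
    intro x y hxy hx
    by_contra hn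
    have h1 : (((x * y)⁻¹ : Fˣ) : F) ∈ V := by
      rw [Units.val_inv_eq_inv_val]
      exact (V.mem_or_inv_mem _).resolve_left hn
    have h2 := h.le_of_mem x y⁻¹ hx (by
      rwa [mul_inv, mul_comm, ← div_eq_mul_inv] at h1)
    rw [h.inv_eq] at h2
    omega
  refine ⟨fun h1 => ?_, key x y hxy⟩
  have h2 := key (x * y) y⁻¹ (by rwa [h.inv_eq, h.mul_eq_left hxy]) h1
  rwa [mul_inv_cancel_right] at h2

theorem mul_mem_iff_right (h : IsLevel V lev) {x y : Fˣ} (hxy : lev x < lev y) :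
    ((x * y : Fˣ) : F) ∈ V ↔ (y : F) ∈ V := by
  rw [mul_comm, h.mul_mem_iff hxy]

/-- Of two elements, the one with the smaller level is dominated by the other one. -/
theorem le_of_lt (h : IsLevel V lev) {lev' : Fˣ → ℕ} (h' : IsLevel V lev') {x y : Fˣ}
    (hxy : lev x < lev y) : lev' x ≤ lev' y := by
  have key : ∀ x y : Fˣ, lev x < lev y → (x : F) ∈ V → (y : F) ∈ V → lev' x ≤ lev' y := by
    intro x y hxy hx hy
    refine h'.le_of_mem x y hx ?_
    rw [div_eq_mul_inv, h.mul_mem_iff (by rwa [h.inv_eq])]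
    exact hy
  rcases V.mem_or_inv_mem x with hx | hx <;> rcases V.mem_or_inv_mem y with hy | hy
  · exact key x y hxy hx hy
  · rw [← h'.inv_eq y]
    exact key x y⁻¹ (by rwa [h.inv_eq]) hx (by rwa [Units.val_inv_eq_inv_val])
  · rw [← h'.inv_eq x]
    exact key x⁻¹ y (by rwa [h.inv_eq]) (by rwa [Units.val_inv_eq_inv_val]) hy
  · rw [← h'.inv_eq x, ← h'.inv_eq y]
    exact key x⁻¹ y⁻¹ (by rwa [h.inv_eq, h.inv_eq]) (by rwa [Units.val_inv_eq_inv_val])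
      (by rwa [Units.val_inv_eq_inv_val])

theorem zpow_mem_iff (h : IsLevel V lev) {x : Fˣ} (hx : (x : F) ∈ V) (hx0 : 0 < lev x) {n : ℤ}
    (hn : n ≠ 0) : ((x ^ n : Fˣ) : F) ∈ V ↔ 0 < n := by
  have key : ∀ m : ℕ, ((x ^ m : Fˣ) : F) ∈ V := fun m => by
    rw [Units.val_pow_eq_pow_val]
    exact pow_mem hx m
  obtain ⟨m, rfl | rfl⟩ := Int.eq_nat_or_neg n
  · rw [zpow_natCast]
    simp only [key m, true_iff]
    omega
  · have hm : m ≠ 0 := by simpa using hn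
    simp only [Left.neg_pos_iff, zpow_neg, zpow_natCast]
    refine iff_of_false (fun h1 => ?_) (by omega)
    have h2 := h.le_of_mem (x ^ m) 1 (key m) (by rwa [one_div])
    rw [h.pow_eq x m hm, h.one] at h2
    omega

theorem exists_max_of_ne_zero {τ : Type*} [LinearOrder τ] [Finite τ] {m : τ → ℤ} (hm : m ≠ 0) :
    ∃ j, m j ≠ 0 ∧ ∀ i, m i ≠ 0 → i ≤ j := by
  classical
  have := Fintype.ofFinite τ
  obtain ⟨i, hi⟩ := Function.ne_iff.1 hm
  obtain ⟨j, hj, hmax⟩ := Finset.exists_max_image (Finset.univ.filter fun i => m i ≠ 0) id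
    ⟨i, by simpa using hi⟩
  exact ⟨j, (Finset.mem_filter.1 hj).2, fun i hi => hmax i (by simpa using hi)⟩

section prod

variable {τ : Type*} [Fintype τ] [LinearOrder τ] {t : τ → Fˣ}

/-- All factors but the j-th have smaller level, hence so does their product; it affects neither
level nor sign. -/
theorem prod_zpow (h : IsLevel V lev) (ht : StrictMono fun j => lev (t j))
    (ht0 : ∀ j, 0 < lev (t j)) (m : τ → ℤ) {j : τ} (hj : m j ≠ 0) (hmax : ∀ i, m i ≠ 0 → i ≤ j) :
    lev (∏ i, t i ^ m i) = lev (t j) ∧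
      (((∏ i, t i ^ m i : Fˣ) : F) ∈ V ↔ ((t j ^ m j : Fˣ) : F) ∈ V) := by
  rw [← Finset.mul_prod_erase _ _ (Finset.mem_univ j)]
  have hlt : lev (∏ i ∈ Finset.univ.erase j, t i ^ m i) < lev (t j ^ m j) := by
    rw [h.zpow_eq _ _ hj]
    refine h.prod_lt _ _ (ht0 j) fun i hi => ?_
    rcases eq_or_ne (m i) 0 with hm | hm
    · rw [hm, zpow_zero, h.one]
      exact ht0 j
    · rw [h.zpow_eq _ _ hm]
      exact ht (lt_of_le_of_ne (hmax i hm) (Finset.ne_of_mem_erase hi))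
  exact ⟨by rw [h.mul_eq_left hlt, h.zpow_eq _ _ hj], h.mul_mem_iff hlt⟩

end prod

/-- Two level functions for the same valuation ring induce the same ordering. -/
theorem le_of_le (h : IsLevel V lev) (hs : HasRankOneSteps lev) {lev' : Fˣ → ℕ}
    (h' : IsLevel V lev') {x y : Fˣ} (hxy : lev x ≤ lev y) : lev' x ≤ lev' y := by
  by_contra! hlt
  have h1 : lev y ≤ lev x := h'.le_of_lt h hlt
  have h2 : lev x = lev y := le_antisymm hxy h1
  have h3 : 0 < lev x := by
    by_contra! h3
    have := (h'.eq_zero_iff x).2 ((h.eq_zero_iff x).1 (by omega))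
    omega
  -- The rank-one relation lowers `lev`, whereas `lev'` of the product stays equal to lev' x, above
  -- lev' y. This contradicts `le_of_lt`.
  obtain ⟨N, M, hN, hNM⟩ := hs x y h2 h3
  have h4 : lev' y < lev' (x ^ N * y ^ M) := by
    rw [h'.mul_eq_left, h'.zpow_eq _ _ hN]
    · exact hlt
    · rw [h'.zpow_eq _ _ hN]
      exact (h'.zpow_le _ _).trans_lt hlt
  have := h'.le_of_lt h h4
  omega

/-- By `le_of_le` both functions order the units alike, and order-equivalent functions to ℕ with the
same range coincide by induction. -/
theorem eq_of_range_eq (h : IsLevel V lev) (hs : HasRankOneSteps lev) {lev' : Fˣ → ℕ}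
    (h' : IsLevel V lev') (hs' : HasRankOneSteps lev') (hr : Set.range lev = Set.range lev') :
    lev = lev' := by
  have hlt : ∀ x y, lev x < lev y ↔ lev' x < lev' y := fun x y => by
    rw [← not_le, ← not_le, not_iff_not]
    exact ⟨h.le_of_le hs h', h'.le_of_le hs' h⟩
  have heq : ∀ x y, lev' x = lev' y → lev x = lev y := fun x y hxy =>
    le_antisymm (h'.le_of_le hs' h hxy.le) (h'.le_of_le hs' h hxy.ge)
  have key : ∀ n x, lev x = n → lev' x = n := by
    intro n
    induction n using Nat.strong_induction_on with
    | _ n ih =>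
      intro x hx
      obtain ⟨z, hz⟩ : lev' x ∈ Set.range lev := hr ▸ ⟨x, rfl⟩
      obtain ⟨w, hw⟩ : n ∈ Set.range lev' := hr ▸ ⟨x, hx⟩
      rcases lt_trichotomy (lev z) n with hzn | hzn | hzn
      · have h1 := ih _ hzn z rfl
        have h2 := heq z x (by omega)
        omega
      · omega
      · have h1 : lev w < lev x := (hlt w x).2 (by omega)
        have h2 := ih (lev w) (by omega) w rfl
        omega
  funext x
  exact (key _ x rfl).symm

end IsLevel

/-! ### Finite rank of abelian groups -/

theorem Cardinal.mk_range_fin {M : Type*} {r : ℕ} {b : Fin r → M} (hb : Function.Injective b) :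
    Cardinal.mk (Set.range b) = r := by
  have := Cardinal.mk_range_eq_of_injective hb
  simpa using this

/-- By additivity of rank the quotient by the span has rank 0, that is, it is torsion. -/
theorem Module.exists_zsmul_mem_span_of_rank_eq {M : Type*} [AddCommGroup M] {r : ℕ}
    (hr : Module.rank ℤ M = r) {b : Fin r → M} (hb : LinearIndependent ℤ b) (x : M) :
    ∃ N : ℤ, N ≠ 0 ∧ N • x ∈ Submodule.span ℤ (Set.range b) := by
  have h1 := rank_quotient_add_rank_of_isDomain (Submodule.span ℤ (Set.range b))
  rw [rank_span hb, Cardinal.mk_range_fin hb.injective, hr] at h1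
  have h2 : Module.rank ℤ (M ⧸ Submodule.span ℤ (Set.range b)) = 0 := by
    refine Cardinal.eq_of_add_eq_add_right (b := (r : Cardinal)) ?_ (Cardinal.natCast_lt_aleph0)
    rw [h1, zero_add]
  obtain ⟨N, hN, hNx⟩ := rank_eq_zero_iff.1 h2 (Submodule.Quotient.mk x)
  refine ⟨N, hN, ?_⟩
  rwa [← Submodule.Quotient.mk_smul, Submodule.Quotient.mk_eq_zero] at hNx

theorem Module.rank_eq_of_exists_zsmul_mem_span {M : Type*} [AddCommGroup M] {r : ℕ}
    {b : Fin r → M} (hb : LinearIndependent ℤ b)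
    (h : ∀ x : M, ∃ N : ℤ, N ≠ 0 ∧ N • x ∈ Submodule.span ℤ (Set.range b)) :
    Module.rank ℤ M = r := by
  have h1 := rank_quotient_add_rank_of_isDomain (Submodule.span ℤ (Set.range b))
  rw [rank_span hb, Cardinal.mk_range_fin hb.injective] at h1
  have h2 : Module.rank ℤ (M ⧸ Submodule.span ℤ (Set.range b)) = 0 := by
    refine rank_eq_zero_iff.2 fun x => ?_
    obtain ⟨x, rfl⟩ := Submodule.Quotient.mk_surjective _ x
    obtain ⟨N, hN, hNx⟩ := h x
    refine ⟨N, hN, ?_⟩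
    rwa [← Submodule.Quotient.mk_smul, Submodule.Quotient.mk_eq_zero]
  rw [← h1, h2, zero_add]

/-! ### Rank and isolated subgroups read off from levels -/

namespace KValuationRing

variable {k L : Type*} [Field k] [Field L] [Algebra k L] (A : KValuationRing k L)

theorem val_mul (x y : Lˣ) : A.val (x * y) = A.val x + A.val y := rfl

theorem val_one : A.val 1 = 0 := rfl

theorem val_inv (x : Lˣ) : A.val x⁻¹ = -A.val x := rfl

theorem val_zpow (x : Lˣ) (n : ℤ) : A.val (x ^ n) = n • A.val x := rfl

theorem val_prod {ι : Type*} (s : Finset ι) (f : ι → Lˣ) :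
    A.val (∏ i ∈ s, f i) = ∑ i ∈ s, A.val (f i) := by
  classical
  induction s using Finset.induction_on with
  | empty => rfl
  | insert i s hi ih => rw [Finset.prod_insert hi, Finset.sum_insert hi, val_mul, ih]

theorem val_surjective (a : A.ValueGroup) : ∃ x, A.val x = a := by
  obtain ⟨x, hx⟩ := QuotientGroup.mk_surjective (Additive.toMul a)
  exact ⟨x, congrArg Additive.ofMul hx⟩

theorem val_eq_zero_iff (x : Lˣ) : A.val x = 0 ↔ x ∈ A.toValuationSubring.unitGroup :=
  QuotientGroup.eq_one_iff x

variable {A} {lev : Lˣ → ℕ}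

theorem lev_eq_zero_iff (h : IsLevel A.toValuationSubring lev) (x : Lˣ) :
    lev x = 0 ↔ A.val x = 0 := by
  rw [h.eq_zero_iff, val_eq_zero_iff]

theorem lev_eq_of_val_eq (h : IsLevel A.toValuationSubring lev) {x y : Lˣ}
    (hxy : A.val x = A.val y) : lev x = lev y := by
  have h1 : lev (y⁻¹ * x) = 0 := by
    rw [lev_eq_zero_iff h, val_mul, val_inv, hxy, neg_add_cancel]
  rw [← h.mul_eq_of_zero (x := y) h1, mul_inv_cancel_left]

/-- A relation would make the product of powers a unit, of level 0, against `IsLevel.prod_zpow`. -/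
theorem linearIndependent_val (h : IsLevel A.toValuationSubring lev) {τ : Type*} [Fintype τ]
    [LinearOrder τ] {t : τ → Lˣ} (ht : StrictMono fun j => lev (t j)) (ht0 : ∀ j, 0 < lev (t j)) :
    LinearIndependent ℤ fun j => A.val (t j) := by
  rw [Fintype.linearIndependent_iff]
  intro m hm
  by_contra! hne
  obtain ⟨j, hj, hmax⟩ := IsLevel.exists_max_of_ne_zero (Function.ne_iff.2 hne)
  have h1 := (h.prod_zpow ht ht0 m hj hmax).1
  have h2 : lev (∏ i, t i ^ m i) = 0 := by
    rw [lev_eq_zero_iff h, val_prod, ← hm]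
    rfl
  have := ht0 j
  omega

/-- The isolated subgroup of elements of level at most `i`. -/
def levelSubgroup (h : IsLevel A.toValuationSubring lev) (i : ℕ) : AddSubgroup A.ValueGroup where
  carrier := {a | ∃ x, A.val x = a ∧ lev x ≤ i}
  zero_mem' := ⟨1, rfl, by simp [h.one]⟩
  add_mem' := by
    rintro _ _ ⟨x, rfl, hx⟩ ⟨y, rfl, hy⟩
    exact ⟨x * y, rfl, (h.mul_le x y).trans (max_le hx hy)⟩
  neg_mem' := by
    rintro _ ⟨x, rfl, hx⟩
    exact ⟨x⁻¹, rfl, by rwa [h.inv_eq]⟩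

theorem val_mem_levelSubgroup (h : IsLevel A.toValuationSubring lev) {i : ℕ} {x : Lˣ} :
    A.val x ∈ levelSubgroup h i ↔ lev x ≤ i := by
  refine ⟨?_, fun hx => ⟨x, rfl, hx⟩⟩
  rintro ⟨y, hy, hyi⟩
  rwa [← lev_eq_of_val_eq h hy]

theorem isIsolated_levelSubgroup (h : IsLevel A.toValuationSubring lev) (i : ℕ) :
    A.IsIsolated (levelSubgroup h i) := by
  intro x y hx hyx hy
  rw [val_mem_levelSubgroup] at hy ⊢
  exact (h.le_of_mem x y hx hyx).trans hy

/-- After inverting so that both values are nonnegative, the value of y dominates that of x, and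
convexity applies. -/
theorem IsIsolated.val_mem_of_lev_lt {H : AddSubgroup A.ValueGroup} (hH : A.IsIsolated H)
    (h : IsLevel A.toValuationSubring lev) {x y : Lˣ} (hy : A.val y ∈ H) (hxy : lev x < lev y) :
    A.val x ∈ H := by
  have key : ∀ x y : Lˣ, lev x < lev y → A.val y ∈ H → (x : L) ∈ A.toValuationSubring →
      (y : L) ∈ A.toValuationSubring → A.val x ∈ H := by
    intro x y hxy hy hxA hyA
    refine hH x y hxA ?_ hy
    rw [div_eq_mul_inv, h.mul_mem_iff (by rwa [h.inv_eq])]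
    exact hyA
  have key2 : ∀ x y : Lˣ, lev x < lev y → A.val y ∈ H → (x : L) ∈ A.toValuationSubring →
      A.val x ∈ H := by
    intro x y hxy hy hxA
    rcases A.mem_or_inv_mem y with hyA | hyA
    · exact key x y hxy hy hxA hyA
    · refine key x y⁻¹ (by rwa [h.inv_eq]) ?_ hxA (by rwa [Units.val_inv_eq_inv_val])
      rw [val_inv]
      exact neg_mem hy
  rcases A.mem_or_inv_mem x with hxA | hxA
  · exact key2 x y hxy hy hxA
  · have := key2 x⁻¹ y (by rwa [h.inv_eq]) hy (by rwa [Units.val_inv_eq_inv_val])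
    rw [val_inv] at this
    simpa using neg_mem this

theorem IsIsolated.val_mem_of_zsmul_mem {H : AddSubgroup A.ValueGroup} (hH : A.IsIsolated H)
    {x : Lˣ} {n : ℤ} (hn : n ≠ 0) (hx : n • A.val x ∈ H) : A.val x ∈ H := by
  have key : ∀ (x : Lˣ) (n : ℕ), (x : L) ∈ A.toValuationSubring → A.val (x ^ (n + 1)) ∈ H →
      A.val x ∈ H := by
    intro x n hxA hx
    refine hH x (x ^ (n + 1)) hxA ?_ hx
    rw [pow_succ, mul_div_cancel_right, Units.val_pow_eq_pow_val]
    exact pow_mem hxA n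
  have key2 : ∀ (x : Lˣ) (n : ℕ), A.val (x ^ (n + 1)) ∈ H → A.val x ∈ H := by
    intro x n hx
    rcases A.mem_or_inv_mem x with hxA | hxA
    · exact key x n hxA hx
    · have := key x⁻¹ n (by rwa [Units.val_inv_eq_inv_val]) (by
        rw [inv_pow, val_inv]; exact neg_mem hx)
      rw [val_inv] at this
      simpa using neg_mem this
  obtain ⟨m, hm⟩ := Int.eq_nat_or_neg n
  have hm0 : m ≠ 0 := by
    rintro rfl
    rcases hm with rfl | rfl <;> simp at hn
  obtain ⟨m, rfl⟩ := Nat.exists_eq_succ_of_ne_zero hm0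
  refine key2 x m ?_
  rw [← zpow_natCast, val_zpow]
  rcases hm with rfl | rfl
  · exact hx
  · rw [neg_smul] at hx
    simpa using neg_mem hx

/-- A level function with finitely many levels determines the rank and the isolated subgroups. -/
theorem rank_eq_and_flag (h : IsLevel A.toValuationSubring lev) (hs : HasRankOneSteps lev)
    {s : ℕ} (e : Fin (s + 1) → ℕ) (he : StrictMono e) (he0 : e 0 = 0)
    (hr : Set.range lev = Set.range e) :
    Module.rank ℤ A.ValueGroup = s ∧
      Nonempty (Fin (s + 1) ≃o {H : AddSubgroup A.ValueGroup // A.IsIsolated H}) := by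
  have hex : ∀ j, ∃ x, lev x = e j := fun j => by
    have : e j ∈ Set.range lev := hr ▸ ⟨j, rfl⟩
    exact this
  have hex' : ∀ x, ∃ j, e j = lev x := fun x => by
    have : lev x ∈ Set.range e := hr ▸ ⟨x, rfl⟩
    exact this
  choose t ht using hex
  constructor
  · have hmono : StrictMono fun j : Fin s => lev (t j.succ) := by
      intro i j hij
      simp only [ht]
      exact he (Fin.succ_lt_succ_iff.2 hij)
    have hpos : ∀ j : Fin s, 0 < lev (t j.succ) := by
      intro j
      rw [ht, ← he0]
      exact he (Fin.succ_pos j)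
    refine Module.rank_eq_of_exists_zsmul_mem_span (linearIndependent_val h hmono hpos) ?_
    -- Induction on the level: the rank-one step removes the top component of x by means of the
    -- chosen element at that level.
    have key : ∀ n x, lev x = n → ∃ N : ℤ, N ≠ 0 ∧
        N • A.val x ∈ Submodule.span ℤ (Set.range fun j : Fin s => A.val (t j.succ)) := by
      intro n
      induction n using Nat.strong_induction_on with
      | _ n ih =>
        intro x hx
        rcases Nat.eq_zero_or_pos n with hn | hn
        · refine ⟨1, one_ne_zero, ?_⟩
          rw [(lev_eq_zero_iff h x).1 (hx.trans hn), smul_zero]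
          exact zero_mem _
        · obtain ⟨j, hj⟩ := hex' x
          have hj0 : j ≠ 0 := by
            rintro rfl
            omega
          obtain ⟨i, rfl⟩ := Fin.exists_succ_eq.2 hj0
          obtain ⟨N, M, hN, hNM⟩ := hs x (t i.succ) (by rw [ht, hj]) (by omega)
          obtain ⟨N', hN', h1⟩ := ih _ (hx ▸ hNM) _ rfl
          refine ⟨N' * N, mul_ne_zero hN' hN, ?_⟩
          rw [val_mul, val_zpow, val_zpow, smul_add, smul_smul, smul_smul] at h1
          have h2 := Submodule.smul_mem (Submodule.span ℤ (Set.range fun j : Fin s =>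
            A.val (t j.succ))) (N' * M) (Submodule.subset_span ⟨i, rfl⟩)
          exact (Submodule.add_mem_iff_left _ h2).1 h1
    intro a
    obtain ⟨x, rfl⟩ := A.val_surjective a
    exact key _ x rfl
  · let f : Fin (s + 1) → {H : AddSubgroup A.ValueGroup // A.IsIsolated H} :=
      fun j => ⟨levelSubgroup h (e j), isIsolated_levelSubgroup h _⟩
    have hf : StrictMono f := by
      intro i j hij
      refine lt_of_le_of_ne ?_ ?_
      · rintro _ ⟨x, rfl, hx⟩
        exact ⟨x, rfl, hx.trans (he hij).le⟩
      · intro hne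
        have h1 : A.val (t j) ∈ levelSubgroup h (e i) := by
          have : levelSubgroup h (e i) = levelSubgroup h (e j) := congrArg Subtype.val hne
          rw [this, val_mem_levelSubgroup, ht]
        rw [val_mem_levelSubgroup, ht] at h1
        exact absurd h1 (not_le.2 (he hij))
    refine ⟨StrictMono.orderIsoOfSurjective f hf ?_⟩
    rintro ⟨H, hH⟩
    classical
    -- Let e j be the greatest level met by H. Convexity puts all smaller levels in H; at level e j,
    -- a rank-one relation puts a nonzero multiple in H, and H is closed under division by integers.
    obtain ⟨j, hj, hmax⟩ := Finset.exists_max_image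
      (Finset.univ.filter fun j => ∃ x, A.val x ∈ H ∧ lev x = e j) id
      ⟨0, by simpa using ⟨1, by rw [val_one]; exact zero_mem H, by rw [he0, h.one]⟩⟩
    obtain ⟨-, x, hxH, hxj⟩ := Finset.mem_filter.1 hj
    refine ⟨j, Subtype.ext (le_antisymm ?_ ?_)⟩
    · rintro _ ⟨y, rfl, hy⟩
      rcases hy.lt_or_eq with hy | hy
      · exact hH.val_mem_of_lev_lt h hxH (by omega)
      · rcases Nat.eq_zero_or_pos (lev y) with h0 | h0
        · rw [(lev_eq_zero_iff h y).1 h0]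
          exact zero_mem H
        obtain ⟨N, M, hN, hNM⟩ := hs y x (by omega) h0
        have h1 := hH.val_mem_of_lev_lt h hxH (hNM.trans_eq (hy.trans hxj.symm))
        rw [val_mul, val_zpow, val_zpow] at h1
        have h2 := (add_mem_cancel_right (zsmul_mem hxH M)).1 h1
        exact hH.val_mem_of_zsmul_mem hN h2
    · intro a ha
      obtain ⟨y, rfl⟩ := A.val_surjective a
      obtain ⟨i, hi⟩ := hex' y
      refine ⟨y, rfl, ?_⟩
      rw [← hi]
      exact he.monotone (hmax i (Finset.mem_filter.2 ⟨Finset.mem_univ _, y, ha, hi.symm⟩))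

end KValuationRing

/-- The level of `x` is the least `i` for which the value of `x` lies in the isolated subgroup
`Γ_i`. -/
noncomputable def DiscVal.lev {k F : Type*} [Field k] [Field F] [Algebra k F] {r : ℕ}
    (v : DiscVal k F r) (x : Fˣ) : ℕ :=
  open Classical in
  Nat.find (p := fun n => ∀ i : Fin (r + 1), n ≤ i → v.1.val x ∈ v.isolated i)
    -- The condition is vacuous at r + 1; actual levels are at most r by `DiscVal.lev_le`.
    ⟨r + 1, fun i hi => absurd i.2 (by omega)⟩

/-! ### The level function of a discrete valuation -/

namespace DiscVal

variable {k F : Type*} [Field k] [Field F] [Algebra k F] {r : ℕ} (v : DiscVal k F r)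

theorem isolated_mono {i j : Fin (r + 1)} (hij : i ≤ j) : v.isolated i ≤ v.isolated j :=
  v.2.flag.some.monotone hij

theorem isolated_lt {i j : Fin (r + 1)} (hij : i < j) : v.isolated i < v.isolated j :=
  v.2.flag.some.strictMono hij

theorem isIsolated_isolated (i : Fin (r + 1)) : v.1.IsIsolated (v.isolated i) :=
  (v.2.flag.some i).2

theorem exists_isolated_eq (H : AddSubgroup v.1.ValueGroup) (hH : v.1.IsIsolated H) :
    ∃ i, v.isolated i = H := by
  obtain ⟨i, hi⟩ := v.2.flag.some.surjective ⟨H, hH⟩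
  exact ⟨i, congrArg Subtype.val hi⟩

theorem lev_le_iff (x : Fˣ) (i : Fin (r + 1)) : v.lev x ≤ i ↔ v.1.val x ∈ v.isolated i := by
  classical
  constructor
  · intro h
    exact Nat.find_spec (p := fun n => ∀ i : Fin (r + 1), n ≤ i → v.1.val x ∈ v.isolated i)
      ⟨r + 1, fun i hi => absurd i.2 (by omega)⟩ i h
  · intro h
    exact Nat.find_min' _ fun j hj => v.isolated_mono (Fin.le_def.2 hj) h

theorem isolated_last : v.isolated (Fin.last r) = ⊤ := by
  obtain ⟨i, hi⟩ := v.exists_isolated_eq ⊤ fun _ _ _ _ _ => AddSubgroup.mem_top _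
  exact top_le_iff.1 (hi.ge.trans (v.isolated_mono (Fin.le_last i)))

theorem isolated_zero : v.isolated 0 = ⊥ := by
  obtain ⟨i, hi⟩ := v.exists_isolated_eq ⊥ (by
    intro x y hx hyx hy
    rw [AddSubgroup.mem_bot, KValuationRing.val_eq_zero_iff,
      mem_unitGroup_iff_mem_and_inv_mem] at hy ⊢
    refine ⟨hx, ?_⟩
    have : (x⁻¹ : Fˣ) = y / x * y⁻¹ := by
      rw [div_mul_eq_mul_div, mul_inv_cancel, one_div]
    rw [this, Units.val_mul]
    exact v.1.toValuationSubring.mul_mem _ _ hyx hy.2)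
  exact le_bot_iff.1 ((v.isolated_mono (Fin.zero_le i)).trans hi.le)

theorem lev_le (x : Fˣ) : v.lev x ≤ r := by
  have := (v.lev_le_iff x (Fin.last r)).2 (by rw [isolated_last]; exact AddSubgroup.mem_top _)
  simpa using this

theorem lev_le_iff_of_le (x : Fˣ) {n : ℕ} (hn : n ≤ r) :
    v.lev x ≤ n ↔ v.1.val x ∈ v.isolated ⟨n, by omega⟩ :=
  v.lev_le_iff x ⟨n, by omega⟩

theorem isLevel : IsLevel v.1.toValuationSubring v.lev where
  mul_le x y := by
    rw [v.lev_le_iff_of_le _ (max_le (v.lev_le x) (v.lev_le y)), KValuationRing.val_mul]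
    have hm := max_le (v.lev_le x) (v.lev_le y)
    exact add_mem ((v.lev_le_iff_of_le x hm).1 (le_max_left _ _))
      ((v.lev_le_iff_of_le y hm).1 (le_max_right _ _))
  inv_eq x := by
    have key : ∀ x, v.lev x⁻¹ ≤ v.lev x := by
      intro x
      rw [v.lev_le_iff_of_le _ (v.lev_le x), KValuationRing.val_inv]
      exact neg_mem ((v.lev_le_iff_of_le x (v.lev_le x)).1 le_rfl)
    refine le_antisymm (key x) ?_
    have := key x⁻¹
    rwa [inv_inv] at this
  eq_zero_iff x := by
    rw [← Nat.le_zero, v.lev_le_iff_of_le _ (Nat.zero_le r), ← KValuationRing.val_eq_zero_iff]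
    change _ ∈ v.isolated 0 ↔ _
    rw [isolated_zero, AddSubgroup.mem_bot]
  le_of_mem x y hx hyx := by
    rw [v.lev_le_iff_of_le _ (v.lev_le y)]
    exact v.isIsolated_isolated _ x y hx hyx ((v.lev_le_iff_of_le y (v.lev_le y)).1 le_rfl)

theorem exists_lev_eq {n : ℕ} (hn : n ≤ r) :
    ∃ x, v.lev x = n ∧ (x : F) ∈ v.1.toValuationSubring := by
  rcases Nat.eq_zero_or_pos n with rfl | hn0
  · exact ⟨1, v.isLevel.one, v.1.toValuationSubring.one_mem⟩
  have h1 : v.isolated ⟨n - 1, by omega⟩ < v.isolated ⟨n, by omega⟩ :=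
    v.isolated_lt (Fin.lt_def.2 (by simp; omega))
  obtain ⟨a, ha, ha'⟩ := SetLike.exists_of_lt h1
  obtain ⟨x, rfl⟩ := v.1.val_surjective a
  have hx : v.lev x = n := by
    have h2 := (v.lev_le_iff_of_le x hn).2 ha
    have h3 := mt (v.lev_le_iff_of_le x (by omega : n - 1 ≤ r)).1 ha'
    omega
  rcases v.1.mem_or_inv_mem x with hxA | hxA
  · exact ⟨x, hx, hxA⟩
  · exact ⟨x⁻¹, by rw [v.isLevel.inv_eq, hx], by rwa [Units.val_inv_eq_inv_val]⟩

/-- In a family with one element per positive level, put x at its own level. Its r values are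
independent, hence maximal, so a multiple of the value of y is a combination of them. The top term
must be x, and removing it lowers the level. -/
theorem hasRankOneSteps : HasRankOneSteps v.lev := by
  classical
  intro y x hxy hy
  have hyr := v.lev_le y
  choose t ht htm using fun j : Fin r => v.exists_lev_eq (n := j + 1) (by omega)
  let i : Fin r := ⟨v.lev y - 1, by omega⟩
  let t' := Function.update t i x
  have ht' : ∀ j, v.lev (t' j) = j + 1 := by
    intro j
    rcases eq_or_ne j i with rfl | hj
    · simp only [t', Function.update_self, i]
      omega
    · simp only [t', Function.update_of_ne hj, ht]
  have hmono : StrictMono fun j => v.lev (t' j) := by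
    intro a b hab
    simp only [ht']
    have := Fin.lt_def.1 hab
    omega
  have hpos : ∀ j, 0 < v.lev (t' j) := fun j => by rw [ht']; omega
  obtain ⟨N, hN, hspan⟩ := Module.exists_zsmul_mem_span_of_rank_eq v.2.rank_eq
    (KValuationRing.linearIndependent_val v.isLevel hmono hpos) (v.1.val y)
  obtain ⟨m, hm⟩ := (Submodule.mem_span_range_iff_exists_fun ℤ).1 hspan
  have hval : v.1.val (∏ j, t' j ^ m j) = v.1.val (y ^ N) := by
    rw [KValuationRing.val_prod, KValuationRing.val_zpow, ← hm]
    rfl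
  have hlev := KValuationRing.lev_eq_of_val_eq v.isLevel hval
  rw [v.isLevel.zpow_eq _ _ hN] at hlev
  have hm0 : m ≠ 0 := by
    rintro rfl
    simp only [Pi.zero_apply, zpow_zero, Finset.prod_const_one, v.isLevel.one] at hlev
    omega
  obtain ⟨j, hj, hmax⟩ := IsLevel.exists_max_of_ne_zero hm0
  rw [(v.isLevel.prod_zpow hmono hpos m hj hmax).1, ht'] at hlev
  obtain rfl : j = i := Fin.ext (by simp only [i]; omega)
  refine ⟨N, -m i, hN, ?_⟩
  have h1 : v.1.val (y ^ N * x ^ (-m i)) = v.1.val (∏ j ∈ Finset.univ.erase i, t' j ^ m j) := by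
    rw [KValuationRing.val_mul, ← hval, ← Finset.mul_prod_erase _ _ (Finset.mem_univ i),
      KValuationRing.val_mul]
    simp only [t', Function.update_self, KValuationRing.val_zpow, neg_smul]
    abel
  rw [KValuationRing.lev_eq_of_val_eq v.isLevel h1]
  refine v.isLevel.prod_lt _ _ hy fun j hji => ?_
  rcases eq_or_ne (m j) 0 with hmj | hmj
  · rw [hmj, zpow_zero, v.isLevel.one]
    exact hy
  · rw [v.isLevel.zpow_eq _ _ hmj, ht']
    have h2 := lt_of_le_of_ne (hmax j hmj) (Finset.ne_of_mem_erase hji)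
    have h3 := Fin.lt_def.1 h2
    simp only [i] at h3
    omega

end DiscVal

/-! ### Exchange of transcendence bases over a common part -/

section TranscendenceBasis

variable {R A α β γ : Type*} [Field R] [Field A] [Algebra R A] {x : α → A} {y : β → A} {z : γ → A}

theorem Algebra.IsAlgebraic.adjoin_of_subset {R S A : Type*} [CommRing R] [CommRing S] [Field A]
    [Algebra R S] [Algebra R A] [Algebra S A] [IsScalarTower R S A] {s t : Set A}
    [h : Algebra.IsAlgebraic (Algebra.adjoin R s) A] (hst : s ⊆ Algebra.adjoin S t) :
    Algebra.IsAlgebraic (Algebra.adjoin S t) A := by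
  have hle : Algebra.adjoin R s ≤ (Algebra.adjoin S t).restrictScalars R :=
    Algebra.adjoin_le hst
  have hf : Function.Injective (Subalgebra.inclusion hle) := Subalgebra.inclusion_injective hle
  refine ⟨fun a => ?_⟩
  obtain ⟨q, hq, hqa⟩ := h.isAlgebraic a
  refine ⟨q.map (Subalgebra.inclusion hle).toRingHom, (Polynomial.map_ne_zero_iff hf).2 hq, ?_⟩
  rw [Polynomial.aeval_def] at hqa ⊢
  erw [Polynomial.eval₂_map]
  exact hqa

/-- Moving x into the base ring is how a common part is cancelled later, even when it is infinite.
-/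
theorem IsTranscendenceBasis.of_sumElim_adjoin (h : IsTranscendenceBasis R (Sum.elim y x)) :
    IsTranscendenceBasis (Algebra.adjoin R (Set.range x)) y := by
  have h1 := (AlgebraicIndependent.sumElim_iff.1 h.1).2
  rw [h1.isTranscendenceBasis_iff_isAlgebraic]
  have := h.isAlgebraic
  refine Algebra.IsAlgebraic.adjoin_of_subset (R := R) (s := Set.range (Sum.elim y x)) ?_
  rintro _ ⟨i | i, rfl⟩
  · exact Algebra.subset_adjoin ⟨i, rfl⟩
  · exact Subalgebra.algebraMap_mem _
      (⟨x i, Algebra.subset_adjoin ⟨i, rfl⟩⟩ : Algebra.adjoin R (Set.range x))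

theorem IsTranscendenceBasis.sumElim_swap (h : IsTranscendenceBasis R (Sum.elim y x)) :
    IsTranscendenceBasis R (Sum.elim x y) := by
  rw [← isTranscendenceBasis_equiv (Equiv.sumComm α β)] at *
  convert h using 1
  ext (i | i) <;> rfl

theorem AlgebraicIndependent.sumElim_swap (h : AlgebraicIndependent R (Sum.elim y x)) :
    AlgebraicIndependent R (Sum.elim x y) := by
  rw [← algebraicIndependent_equiv (Equiv.sumComm β α)]
  convert h using 1
  ext (i | i) <;> rfl

theorem IsTranscendenceBasis.nonempty_equiv (hz : IsTranscendenceBasis R (Sum.elim z x))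
    (hy : IsTranscendenceBasis R (Sum.elim y x)) : Nonempty (γ ≃ β) := by
  rw [← Cardinal.lift_mk_eq']
  exact hz.of_sumElim_adjoin.lift_cardinalMk_eq hy.of_sumElim_adjoin

/-- Extend z to a transcendence basis and compare cardinals with y; surjectivity says that nothing
was added to z. This clause settles the equality case of the counts. -/
theorem AlgebraicIndependent.exists_embedding {R : Type*} [CommRing R] [Nontrivial R] [Algebra R A]
    (hz : AlgebraicIndependent R z) (hy : IsTranscendenceBasis R y) :
    ∃ f : γ ↪ β, Function.Surjective f → IsTranscendenceBasis R z := by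
  obtain ⟨B, hzB, hB⟩ := exists_isTranscendenceBasis_superset hz.to_subtype_range
  obtain ⟨g⟩ := Cardinal.lift_mk_eq'.1 (hB.lift_cardinalMk_eq hy)
  refine ⟨⟨fun i => g ⟨z i, hzB ⟨i, rfl⟩⟩, fun i j hij => hz.injective
    (congrArg Subtype.val (g.injective hij))⟩, fun hsurj => ?_⟩
  have h3 : Set.range z = B := by
    refine hzB.antisymm fun b hb => ?_
    obtain ⟨i, hi⟩ := hsurj (g ⟨b, hb⟩)
    exact ⟨i, congrArg Subtype.val (g.injective hi)⟩
  have h4 := hB.isAlgebraic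
  rwa [Subtype.range_coe, ← h3, ← hz.isTranscendenceBasis_iff_isAlgebraic] at h4

/-- The exchange property relative to a common part `x` of two algebraically independent
families. -/
theorem AlgebraicIndependent.exists_embedding_sumElim
    (hz : AlgebraicIndependent R (Sum.elim z x))
    (hy : IsTranscendenceBasis R (Sum.elim y x)) :
    ∃ f : γ ↪ β, Function.Surjective f → IsTranscendenceBasis R (Sum.elim z x) := by
  obtain ⟨f, hf⟩ := (AlgebraicIndependent.sumElim_iff.1 hz).2.exists_embedding
    hy.of_sumElim_adjoin
  refine ⟨f, fun h => ?_⟩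
  have h4 := (hf h).isAlgebraic
  rw [hz.isTranscendenceBasis_iff_isAlgebraic]
  rw [Set.Sum.elim_range, Set.union_comm, Algebra.adjoin_union_eq_adjoin_adjoin]
  exact h4

end TranscendenceBasis

/-- A family which is algebraically independent over a larger ring is a transcendence basis as soon
as it generates a transcendence basis. -/
theorem AlgebraicIndependent.isTranscendenceBasis_of_range_subset {R S A ι ι' : Type*} [CommRing R]
    [Field S] [Field A] [Nontrivial R]
    [Algebra R S] [Algebra R A] [Algebra S A] [IsScalarTower R S A] {x : ι → A} {y : ι' → A}
    (hx : AlgebraicIndependent S x) (hy : IsTranscendenceBasis R y)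
    (h : Set.range y ⊆ Algebra.adjoin S (Set.range x)) : IsTranscendenceBasis S x := by
  have := hy.isAlgebraic
  rw [hx.isTranscendenceBasis_iff_isAlgebraic]
  exact Algebra.IsAlgebraic.adjoin_of_subset (R := R) h

/-! ### Signs and independence of monomials through levels -/

section Gauss

/-- Elements with algebraically independent residues and elements with independent values
are jointly algebraically independent. -/
theorem algebraicIndependent_of_isRes {K E R ι τ : Type*} [Field K] [Field E] [Algebra K E]
    [Fintype τ] (A : ValuationSubring E) [CommRing R]
    [Algebra R (IsLocalRing.ResidueField A)] {x : ι → E}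
    {xr : ι → IsLocalRing.ResidueField A} {t : τ → Eˣ}
    (hrange : ∀ c a, A.IsRes (algebraMap K E c) a → a ∈ Set.range (algebraMap R _))
    (hxr : AlgebraicIndependent R xr) (hx : ∀ i, A.IsRes (x i) (xr i))
    (h0 : ∀ c m, unitMonomial (algebraMap K E) t c m ∈ A.unitGroup → m = 0) :
    AlgebraicIndependent K (Sum.elim x fun j => (t j : E)) := by
  have h : GaussCompat (R := R) A A (algebraMap K E) (RingHom.id _) x xr x t t :=
    { compat := fun c a h => h
      mem_range := hrange
      indep := hxr
      isRes_left := hx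
      isRes_right := hx
      mem_iff := fun c m => Iff.rfl
      eq_zero := fun c m h h' => h0 c m
        ((mem_unitGroup_iff_mem_and_inv_mem A _).2 ⟨h, by rwa [Units.val_inv_eq_inv_val]⟩) }
  exact h.algebraicIndependent

variable {K F τ : Type*} [Field K] [Field F] [Fintype τ] [LinearOrder τ] {V : ValuationSubring F}
  {lev : Fˣ → ℕ} {σ : K →+* F} {u : τ → Fˣ}

theorem IsLevel.unitMonomial_eq_max (h : IsLevel V lev) (hu : StrictMono fun j => lev (u j))
    (hu0 : ∀ j, 0 < lev (u j)) (hne : ∀ (c : Kˣ) j, lev (Units.map (σ : K →* F) c) ≠ lev (u j))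
    (c : Kˣ) {m : τ → ℤ} {j : τ} (hj : m j ≠ 0) (hmax : ∀ i, m i ≠ 0 → i ≤ j) :
    lev (unitMonomial σ u c m) = max (lev (Units.map (σ : K →* F) c)) (lev (u j)) := by
  have h1 := (h.prod_zpow hu hu0 m hj hmax).1
  rw [unitMonomial]
  rcases lt_or_gt_of_ne (hne c j) with h2 | h2
  · rw [h.mul_eq_right (by rwa [h1]), h1, max_eq_right h2.le]
  · rw [h.mul_eq_left (by rwa [h1]), max_eq_left h2.le]

/-- The constant and the top power have different levels, so the one of greater level alone decides
the sign. The criterion mentions only levels and signs, so it transfers between fields. -/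
theorem IsLevel.unitMonomial_mem_iff (h : IsLevel V lev) (hu : StrictMono fun j => lev (u j))
    (hu0 : ∀ j, 0 < lev (u j)) (huV : ∀ j, (u j : F) ∈ V)
    (hne : ∀ (c : Kˣ) j, lev (Units.map (σ : K →* F) c) ≠ lev (u j))
    (c : Kˣ) {m : τ → ℤ} {j : τ} (hj : m j ≠ 0) (hmax : ∀ i, m i ≠ 0 → i ≤ j) :
    (unitMonomial σ u c m : F) ∈ V ↔
      (lev (Units.map (σ : K →* F) c) < lev (u j) ∧ 0 < m j) ∨
      (lev (u j) < lev (Units.map (σ : K →* F) c) ∧ σ c ∈ V) := by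
  obtain ⟨h1, h3⟩ := h.prod_zpow hu hu0 m hj hmax
  rw [unitMonomial]
  rcases lt_or_gt_of_ne (hne c j) with h2 | h2
  · rw [h.mul_mem_iff_right (by rwa [h1]), h3, h.zpow_mem_iff (huV j) (hu0 j) hj]
    simp [h2, h2.le]
  · rw [h.mul_mem_iff (by rwa [h1])]
    simp [h2, h2.le]

theorem IsLevel.eq_zero_of_unitMonomial (h : IsLevel V lev)
    (hu : StrictMono fun j => lev (u j)) (hu0 : ∀ j, 0 < lev (u j))
    (hne : ∀ (c : Kˣ) j, lev (Units.map (σ : K →* F) c) ≠ lev (u j))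
    (c : Kˣ) (m : τ → ℤ) (hm : unitMonomial σ u c m ∈ V.unitGroup) : m = 0 := by
  by_contra hm0
  obtain ⟨j, hj, hmax⟩ := IsLevel.exists_max_of_ne_zero hm0
  rw [← h.eq_zero_iff, h.unitMonomial_eq_max hu hu0 hne c hj hmax] at hm
  have := hu0 j
  omega

/-- Comparison of monomials on both sides of a pair of valued fields with the same levels. -/
theorem IsLevel.unitMonomial_mem_iff_of_lev_eq {E : Type*} [Field E] {A : ValuationSubring E}
    {lev' : Eˣ → ℕ} {ρ : K →+* E} {t : τ → Eˣ} (h : IsLevel V lev) (h' : IsLevel A lev')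
    (hu : StrictMono fun j => lev (u j)) (ht : StrictMono fun j => lev' (t j))
    (hu0 : ∀ j, 0 < lev (u j)) (ht0 : ∀ j, 0 < lev' (t j))
    (huV : ∀ j, (u j : F) ∈ V) (htA : ∀ j, (t j : E) ∈ A)
    (hne : ∀ (c : Kˣ) j, lev (Units.map (σ : K →* F) c) ≠ lev (u j))
    (hne' : ∀ (c : Kˣ) j, lev' (Units.map (ρ : K →* E) c) ≠ lev' (t j))
    (hlt : ∀ (c : Kˣ) j, lev' (Units.map (ρ : K →* E) c) < lev' (t j) ↔
      lev (Units.map (σ : K →* F) c) < lev (u j))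
    (hmem : ∀ c, ρ c ∈ A ↔ σ c ∈ V) (c : Kˣ) (m : τ → ℤ) :
    (unitMonomial ρ t c m : E) ∈ A ↔ (unitMonomial σ u c m : F) ∈ V := by
  rcases eq_or_ne m 0 with rfl | hm0
  · simpa [unitMonomial] using hmem c
  obtain ⟨j, hj, hmax⟩ := IsLevel.exists_max_of_ne_zero hm0
  have hgt : ∀ (c : Kˣ) j, lev' (t j) < lev' (Units.map (ρ : K →* E) c) ↔
      lev (u j) < lev (Units.map (σ : K →* F) c) := fun c j => by
    have h1 := hlt c j
    have h2 := hne c j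
    have h3 := hne' c j
    omega
  rw [h.unitMonomial_mem_iff hu hu0 huV hne c hj hmax,
    h'.unitMonomial_mem_iff ht ht0 htA hne' c hj hmax, hlt, hgt, hmem]

end Gauss

/-! ### Independence over the constants -/

section Const

variable {k L F : Type*} [Field k] [Field L] [Field F] [Algebra k L] [Algebra k F]

theorem KValuationRing.lev_algebraMap (A : KValuationRing k L) {lev : Lˣ → ℕ}
    (h : IsLevel A.toValuationSubring lev) (c : kˣ) :
    lev (Units.map (algebraMap k L : k →* L) c) = 0 := by
  rw [h.eq_zero_iff, mem_unitGroup_iff_mem_and_inv_mem]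
  refine ⟨A.algebraMap_mem' c, ?_⟩
  rw [← map_inv]
  exact A.algebraMap_mem' _

theorem KValuationRing.algebraMap_isRes (A : KValuationRing k L) (c : k) :
    A.IsRes (algebraMap k L c) (algebraMap k A.ResidueField c) :=
  ⟨A.algebraMap_mem' c, rfl⟩

theorem KValuationRing.algebraicIndependent_of_lev (A : KValuationRing k L) {lev : Lˣ → ℕ}
    (h : IsLevel A.toValuationSubring lev) {ι τ : Type*} [Fintype τ] [LinearOrder τ]
    {x : ι → L} {xr : ι → A.ResidueField} {t : τ → Lˣ} (hxr : AlgebraicIndependent k xr)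
    (hx : ∀ i, A.IsRes (x i) (xr i)) (ht : StrictMono fun j => lev (t j))
    (ht0 : ∀ j, 0 < lev (t j)) : AlgebraicIndependent k (Sum.elim x fun j => (t j : L)) := by
  refine algebraicIndependent_of_isRes (R := k) A.toValuationSubring (fun c a hc => ⟨c, ?_⟩) hxr hx
    (h.eq_zero_of_unitMonomial ht ht0 fun c j => ?_)
  · exact (A.algebraMap_isRes c).unique hc
  · rw [A.lev_algebraMap h]
    exact (ht0 j).ne

theorem KValuationRing.algebraicIndependent_of_val (A : KValuationRing k L) {ι τ : Type*}
    [Fintype τ]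
    {x : ι → L} {xr : ι → A.ResidueField} {t : τ → Lˣ} (hxr : AlgebraicIndependent k xr)
    (hx : ∀ i, A.IsRes (x i) (xr i)) (ht : LinearIndependent ℤ fun j => A.val (t j)) :
    AlgebraicIndependent k (Sum.elim x fun j => (t j : L)) := by
  refine algebraicIndependent_of_isRes (R := k) A.toValuationSubring (fun c a hc => ⟨c, ?_⟩) hxr hx
    fun c m hm => ?_
  · exact (A.algebraMap_isRes c).unique hc
  · rw [← A.val_eq_zero_iff, unitMonomial, A.val_mul, A.val_prod, (A.val_eq_zero_iff _).2,
      zero_add] at hm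
    · simp only [A.val_zpow] at hm
      exact funext (Fintype.linearIndependent_iff.1 ht m hm)
    · rw [mem_unitGroup_iff_mem_and_inv_mem]
      refine ⟨A.algebraMap_mem' c, ?_⟩
      rw [← map_inv]
      exact A.algebraMap_mem' _

/-- A lift of a transcendence basis of the residue field and elements of all levels form a
transcendence basis. -/
theorem DiscVal.exists_isTranscendenceBasis {r : ℕ} (v : DiscVal k F r) :
    ∃ Y : Set v.1.toValuationSubring,
      IsTranscendenceBasis k
        (fun y : Y => (IsLocalRing.residue v.1.toValuationSubring y : v.1.ResidueField)) ∧
      ∀ t : Fin r → Fˣ, (∀ j, v.lev (t j) = j + 1) →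
        IsTranscendenceBasis k (Sum.elim (fun y : Y => ((y : v.1.toValuationSubring) : F))
          fun j => (t j : F)) := by
  obtain ⟨Y, t, hY, ht, halg⟩ := v.2.algebraic
  refine ⟨Y, hY, fun t' ht' => ?_⟩
  have h1 : AlgebraicIndependent k (Sum.elim (fun y : Y => ((y : v.1.toValuationSubring) : F))
      fun j => (t j : F)) :=
    v.1.algebraicIndependent_of_val hY.1 (fun i => isRes_residue _) ht
  have h2 : AlgebraicIndependent k (Sum.elim (fun y : Y => ((y : v.1.toValuationSubring) : F))
      fun j => (t' j : F)) :=
    v.1.algebraicIndependent_of_lev v.isLevel hY.1 (fun i => isRes_residue _)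
      (fun i j hij => by simpa [ht'] using hij) (fun j => by simp [ht'])
  have h3 : IsTranscendenceBasis k (Sum.elim (fun y : Y => ((y : v.1.toValuationSubring) : F))
      fun j => (t j : F)) := by
    rw [h1.isTranscendenceBasis_iff_isAlgebraic, ← IntermediateField.isAlgebraic_adjoin_iff_top,
      Set.Sum.elim_range]
    rw [Set.image_eq_range] at halg
    exact halg
  -- Relative to the common part Y, both families have r members, so the injection is onto.
  obtain ⟨f, hf⟩ := h2.sumElim_swap.exists_embedding_sumElim h3.sumElim_swap
  exact (hf (Finite.surjective_of_injective f.injective)).sumElim_swap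

end Const

/-- The levels `0 < i₁ + 1 < i₂ + 1 < …` attached to a set of jumps `I`. -/
noncomputable def jumpLevel {r : ℕ} (I : Finset (Fin r)) (j : Fin (I.card + 1)) : ℕ :=
  Fin.cases 0 (fun j => ((I.orderEmbOfFin rfl j : Fin r) : ℕ) + 1) j

/-! ### Jump sets -/

section jumpLevel

variable {r : ℕ} (I : Finset (Fin r))

theorem jumpLevel_strictMono : StrictMono (jumpLevel I) := by
  intro i j hij
  cases j using Fin.cases with
  | zero => exact absurd hij (Fin.not_lt_zero i)
  | succ j =>
    cases i using Fin.cases with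
    | zero => exact Nat.succ_pos _
    | succ i =>
      refine Nat.succ_lt_succ ?_
      rw [Fin.val_fin_lt, OrderEmbedding.lt_iff_lt]
      exact Fin.succ_lt_succ_iff.1 hij

theorem range_jumpLevel : Set.range (jumpLevel I) = insert 0 ((fun i : Fin r => (i : ℕ) + 1) '' I) := by
  ext n
  constructor
  · rintro ⟨j, rfl⟩
    cases j using Fin.cases with
    | zero => exact Or.inl rfl
    | succ j => exact Or.inr ⟨_, I.orderEmbOfFin_mem rfl j, rfl⟩
  · rintro (rfl | ⟨i, hi, rfl⟩)
    · exact ⟨0, rfl⟩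
    · have : i ∈ Set.range (I.orderEmbOfFin rfl) := by simpa using hi
      obtain ⟨j, rfl⟩ := this
      exact ⟨j.succ, rfl⟩

end jumpLevel

/-- The levels of `F` which are attained on `L` are `0` and `i + 1` for `i ∈ I`. -/
def HasJumps {L F : Type*} [Field L] [Field F] (lev : Fˣ → ℕ) (σ : L →+* F) {r : ℕ}
    (I : Finset (Fin r)) : Prop :=
  ∀ i : Fin r, (∃ x : Lˣ, lev (Units.map (σ : L →* F) x) = i + 1) ↔ i ∈ I

theorem HasJumps.range_eq {k L F : Type*} [Field k] [Field L] [Field F] [Algebra k F] {r : ℕ}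
    {v : DiscVal k F r} {σ : L →+* F} {I : Finset (Fin r)} (h : HasJumps v.lev σ I) :
    (Set.range fun x : Lˣ => v.lev (Units.map (σ : L →* F) x)) = Set.range (jumpLevel I) := by
  rw [range_jumpLevel]
  ext n
  constructor
  · rintro ⟨x, rfl⟩
    rcases Nat.eq_zero_or_pos (v.lev (Units.map (σ : L →* F) x)) with h0 | h0
    · exact Or.inl h0
    · have h1 := v.lev_le (Units.map (σ : L →* F) x)
      refine Or.inr ⟨⟨v.lev (Units.map (σ : L →* F) x) - 1, by omega⟩, ?_, ?_⟩
      · refine (h _).1 ⟨x, ?_⟩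
        simp only
        omega
      · simp only
        omega
  · rintro (rfl | ⟨i, hi, rfl⟩)
    · exact ⟨1, by simp [v.isLevel.one]⟩
    · exact (h i).2 hi

/-! ### Counting transcendence degrees in an extension -/

section Extension

variable {k L F : Type*} [Field k] [Field L] [Field F] [Algebra k L] [Algebra k F]
  [Algebra L F] {r : ℕ} (p : KValuationRing k L) (v : DiscVal k F r)
  [Algebra p.ResidueField v.1.ResidueField]

/-- Elements at levels never attained on L have values independent modulo those of L, so the Gauss
argument runs with base L. -/
theorem algebraicIndependent_of_jumps (I : Finset (Fin r))
    (hcomap : v.1.toValuationSubring.comap (algebraMap L F) = p.toValuationSubring)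
    (hres : ∀ x a, p.IsRes x a →
      v.1.IsRes (algebraMap L F x) (algebraMap p.ResidueField v.1.ResidueField a))
    (hI : HasJumps v.lev (algebraMap L F) I) {β : Type*} {y : β → F} {yr : β → v.1.ResidueField}
    (hyr : AlgebraicIndependent p.ResidueField yr) (hy : ∀ i, v.1.IsRes (y i) (yr i))
    {t : {i // i ∉ I} → Fˣ} (ht : ∀ j, v.lev (t j) = j.1 + 1) :
    AlgebraicIndependent L (Sum.elim y fun j => (t j : F)) := by
  refine algebraicIndependent_of_isRes (R := p.ResidueField) v.1.toValuationSubring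
    (fun c a hc => ?_) hyr hy (v.isLevel.eq_zero_of_unitMonomial (fun i j hij => ?_)
      (fun j => by simp [ht]) fun c j h => j.2 ?_)
  · have : c ∈ p.toValuationSubring := by
      rw [← hcomap]
      exact hc.mem
    obtain ⟨b, hb⟩ := exists_isRes this
    exact ⟨b, (hres c b hb).unique hc⟩
  · simpa [ht] using hij
  · exact (hI j.1).1 ⟨c, by rw [h, ht]⟩

/-- The numerical data of an extension of a valued field by a field with a discrete valuation of
finite rank. -/
theorem isTranscendenceBasis_of_jumps [IsScalarTower k L F]
    [IsScalarTower k p.ResidueField v.1.ResidueField] (I : Finset (Fin r))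
    (hcomap : v.1.toValuationSubring.comap (algebraMap L F) = p.toValuationSubring)
    (hres : ∀ x a, p.IsRes x a →
      v.1.IsRes (algebraMap L F x) (algebraMap p.ResidueField v.1.ResidueField a))
    (hI : HasJumps v.lev (algebraMap L F) I)
    {d : ℕ} (hd : Algebra.trdeg k L = d)
    {α β : Type*} {b : α → L} {br : α → p.ResidueField} (hbr : IsTranscendenceBasis k br)
    (hb : ∀ i, p.IsRes (b i) (br i))
    {y : β → F} {yr : β → v.1.ResidueField} {X : Set β}
    (hyr : IsTranscendenceBasis k yr) (hy : ∀ i, v.1.IsRes (y i) (yr i))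
    (hX : IsTranscendenceBasis p.ResidueField fun i : X => yr i)
    {T : Fin r → Fˣ} (hT : ∀ j, v.lev (T j) = j + 1)
    (hyT : IsTranscendenceBasis k (Sum.elim y fun j => (T j : F)))
    {t : Fin I.card → Lˣ}
    (ht : ∀ j, v.lev (Units.map (algebraMap L F : L →* F) (t j)) = jumpLevel I j.succ) :
    IsTranscendenceBasis k (Sum.elim b fun j => (t j : L)) ∧
    IsTranscendenceBasis L
      (Sum.elim (fun i : X => y i) fun j : {i // i ∉ I} => (T j.1 : F)) ∧
    Finite α ∧ Nat.card α + I.card = d ∧ Nonempty (α ≃ (Xᶜ : Set β)) ∧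
    ((d + (r - I.card) : ℕ) : Cardinal) ≤ Algebra.trdeg k F := by
  classical
  have hlev : IsLevel p.toValuationSubring fun x => v.lev (Units.map (algebraMap L F : L →* F) x) :=
    hcomap ▸ v.isLevel.comap (algebraMap L F)
  have hbt : AlgebraicIndependent k (Sum.elim b fun j => (t j : L)) :=
    p.algebraicIndependent_of_lev hlev hbr.1 hb
      (fun i j hij => by
        simp only [ht]
        exact jumpLevel_strictMono I (Fin.succ_lt_succ_iff.2 hij))
      (fun j => by simp only [ht]; exact Nat.succ_pos _)
  obtain ⟨ι, w, hw⟩ := exists_isTranscendenceBasis' k L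
  have hιd : Cardinal.mk ι = d := by rw [← hd, hw.cardinalMk_eq_trdeg]
  have : Finite ι := by
    rw [← Cardinal.lt_aleph0_iff_finite, hιd]
    exact Cardinal.natCast_lt_aleph0
  have hιd' : Nat.card ι = d := by simp [Nat.card, hιd]
  -- Independence of b and t inside L gives |α| + |I| ≤ d.
  obtain ⟨f, hf⟩ := hbt.exists_embedding hw
  have hfin : Finite (α ⊕ Fin I.card) := Finite.of_injective f f.injective
  have hα : Finite α := Finite.of_injective (Sum.inl : α → α ⊕ Fin I.card) Sum.inl_injective
  have hle : Nat.card α + I.card ≤ d := by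
    have := Nat.card_le_card_of_injective f f.injective
    rwa [Nat.card_sum, Nat.card_fin, hιd'] at this
  have hAI : AlgebraicIndependent L
      (Sum.elim (fun i : X => y i) fun j : {i // i ∉ I} => (T j.1 : F)) :=
    algebraicIndependent_of_jumps p v I hcomap hres hI hX.1 (fun i => hy i) fun j => hT j.1
  have hαX : Nonempty (α ≃ (Xᶜ : Set β)) := by
    have h1 := (hbr.sumElim_comp hX).sumElim_swap
    have h2 : IsTranscendenceBasis k (Sum.elim (fun i : (Xᶜ : Set β) => yr i) fun i : X => yr i) :=
      (isTranscendenceBasis_equiv' ((Equiv.sumComm _ _).trans (Equiv.Set.sumCompl X))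
        (by ext (i | i) <;> rfl)).2 hyr
    exact h1.nonempty_equiv h2
  obtain ⟨g⟩ := hαX
  have hXf : Finite (Xᶜ : Set β) := Finite.of_equiv _ g
  have h1 : AlgebraicIndependent k (Sum.elim (Sum.elim (fun j : {i // i ∉ I} => (T j.1 : F))
      (algebraMap L F ∘ w)) fun i : X => y i) := by
    have h3 := hw.1.sumElim_comp hAI
    exact (algebraicIndependent_equiv' ((Equiv.sumAssoc _ _ _).trans
      (Equiv.sumComm _ _)) (by ext ((i | i) | i) <;> rfl)).1 h3
  have h2 : IsTranscendenceBasis k (Sum.elim (Sum.elim (fun i : (Xᶜ : Set β) => y i)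
      (fun j : Fin r => (T j : F))) fun i : X => y i) := by
    let e : ((Xᶜ : Set β) ⊕ Fin r) ⊕ X ≃ β ⊕ Fin r :=
      (((Equiv.sumAssoc _ _ _).trans (Equiv.sumCongr (Equiv.refl _) (Equiv.sumComm _ _))).trans
        (Equiv.sumAssoc _ _ _).symm).trans
        (Equiv.sumCongr ((Equiv.sumComm _ _).trans (Equiv.Set.sumCompl X)) (Equiv.refl _))
    refine (isTranscendenceBasis_equiv' e ?_).2 hyT
    ext ((i | i) | i) <;> rfl
  -- Relative to the part of y on X, the r - |I| + d independent elements T outside I and w are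
  -- compared with the |α| + r elements y off X and T. This gives d ≤ |α| + |I|; equality makes both
  -- injections onto.
  obtain ⟨f', hf'⟩ := h1.exists_embedding_sumElim h2
  have hc1 : Nat.card ({i // i ∉ I} ⊕ ι) = r - I.card + d := by
    simp [Nat.card_sum, hιd']
  have hc2 : Nat.card ((Xᶜ : Set β) ⊕ Fin r) = Nat.card α + r := by
    rw [Nat.card_sum, Nat.card_fin, Nat.card_congr g]
  have hIr : I.card ≤ r := by simpa using I.card_le_univ
  have hle' := Nat.card_le_card_of_injective f' f'.injective
  rw [hc1, hc2] at hle'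
  refine ⟨hf (f.injective.bijective_of_nat_card_le ?_).2, ?_, hα, by omega, ⟨g⟩, ?_⟩
  · rw [Nat.card_sum, Nat.card_fin, hιd']
    omega
  · have h3 := hf' (f'.injective.bijective_of_nat_card_le (by omega)).2
    refine hAI.isTranscendenceBasis_of_range_subset h3 ?_
    rintro _ ⟨(i | i) | i, rfl⟩
    · exact Algebra.subset_adjoin ⟨Sum.inr i, rfl⟩
    · exact Subalgebra.algebraMap_mem _ (w i)
    · exact Algebra.subset_adjoin ⟨Sum.inl i, rfl⟩
  -- The elements T outside I and w are d + (r - |I|) independent elements of F over k.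
  · have h3 := (h1.comp Sum.inl Sum.inl_injective).lift_cardinalMk_le_trdeg
    have h4 : Cardinal.mk ({i // i ∉ I} ⊕ ι) = (d + (r - I.card) : ℕ) := by
      rw [Cardinal.mk_sum, Cardinal.lift_id', hιd]
      simp [add_comm]
    rw [h4, Cardinal.lift_natCast] at h3
    rwa [Cardinal.nat_le_lift_iff] at h3

end Extension

theorem IsTranscendenceBasis.exists_subset_of_tower {R S A β : Type*} [Field R] [Field S] [Field A]
    [Algebra R S] [Algebra S A] [Algebra R A] [IsScalarTower R S A] {y : β → A}
    (hy : IsTranscendenceBasis R y) : ∃ X : Set β, IsTranscendenceBasis S fun i : X => y i := by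
  have h := hy.isAlgebraic
  have := Algebra.IsAlgebraic.adjoin_of_subset (S := S) (h := h) Algebra.subset_adjoin
  obtain ⟨Z, hZ, hZb⟩ := exists_isTranscendenceBasis_subset (R := S) (Set.range y)
  choose f hf using fun z : Z => hZ z.2
  have hfi : Function.Injective f := fun i j hij => Subtype.ext (by rw [← hf, ← hf, hij])
  exact ⟨Set.range f, (isTranscendenceBasis_equiv' (f := fun i : Set.range f => y i)
    (Equiv.ofInjective f hfi) (funext hf)).1 hZb⟩

theorem HasRankOneSteps.comp {k L F : Type*} [Field k] [Field L] [Field F] [Algebra k F] {r : ℕ}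
    {v : DiscVal k F r} (σ : L →+* F) :
    HasRankOneSteps fun x : Lˣ => v.lev (Units.map (σ : L →* F) x) := by
  intro x y h1 h2
  obtain ⟨N, M, hN, h3⟩ := v.hasRankOneSteps _ _ h1 h2
  refine ⟨N, M, hN, ?_⟩
  simp only [map_mul, map_zpow]
  exact h3

theorem HasJumps.exists_lev_eq_jumpLevel {k L F : Type*} [Field k] [Field L] [Field F] [Algebra k F]
    {r : ℕ} {v : DiscVal k F r} {σ : L →+* F} {I : Finset (Fin r)} (h : HasJumps v.lev σ I) :
    ∃ t : Fin I.card → Lˣ, ∀ j, v.lev (Units.map (σ : L →* F) (t j)) = jumpLevel I j.succ :=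
  Classical.axiom_of_choice fun j : Fin I.card => h.range_eq.ge ⟨j.succ, rfl⟩

/-! ### The valuation and the jumps attached to an embedding -/

section EmbeddingsAt

variable {k L F : Type*} [Field k] [Field L] [Field F] [Algebra k L] [Algebra k F] {r : ℕ}

/-- A jump from Γ_i to Γ_{i+1} is the presence of an element of level exactly i + 1. -/
theorem mem_embeddingsAt_iff {p : KValuationRing k L} {v : DiscVal k F r} {I : Finset (Fin r)}
    {σ : L →ₐ[k] F} : σ ∈ embeddingsAt p v I ↔
      v.1.toValuationSubring.comap (σ : L →+* F) = p.toValuationSubring ∧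
        HasJumps v.lev (σ : L →+* F) I := by
  refine and_congr_right fun _ => forall_congr' fun i => ?_
  refine iff_congr ?_ Iff.rfl
  rw [← not_iff_not, ne_eq, not_not]
  have hmem : ∀ x (j : Fin (r + 1)), v.lev (Units.map (σ : L →* F) x) ≤ j ↔
      v.1.val (Units.map (σ : L →* F) x) ∈ (v.isolated j : Set v.1.ValueGroup) :=
    fun x j => v.lev_le_iff _ j
  constructor
  · rintro h ⟨x, hx⟩
    have hx' : v.lev (Units.map (σ : L →* F) x) = i + 1 := hx
    have h1 := (hmem x i.succ).1 (by rw [hx']; rfl)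
    have h2 := h.subset ⟨⟨x, rfl⟩, h1⟩
    have h3 := (hmem x i.castSucc).2 h2.2
    rw [hx', Fin.val_castSucc] at h3
    omega
  · intro h
    refine Set.Subset.antisymm ?_ fun a ha => ⟨ha.1, v.isolated_mono i.castSucc_lt_succ.le ha.2⟩
    rintro _ ⟨⟨x, rfl⟩, hx⟩
    refine ⟨⟨x, rfl⟩, ?_⟩
    have h1 := (hmem x i.succ).2 hx
    refine (hmem x i.castSucc).1 ?_
    have h2 : v.lev (Units.map (σ : L →* F) x) ≠ i + 1 := fun h2 => h ⟨x, h2⟩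
    rw [Fin.val_succ] at h1
    rw [Fin.val_castSucc]
    omega

theorem residueEmbedding_isRes {p : KValuationRing k L} {v : KValuationRing k F} {σ : L →ₐ[k] F}
    (h : v.toValuationSubring.comap (σ : L →+* F) = p.toValuationSubring) {x : L}
    {a : p.ResidueField} (ha : p.IsRes x a) : v.IsRes (σ x) (residueEmbedding p v σ h a) := by
  obtain ⟨hx, rfl⟩ := ha
  exact ⟨_, rfl⟩

theorem residueEmbedding_eq_iff {p : KValuationRing k L} {v : KValuationRing k F} {σ : L →ₐ[k] F}
    (h : v.toValuationSubring.comap (σ : L →+* F) = p.toValuationSubring)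
    (ψ : p.ResidueField →ₐ[k] v.ResidueField) :
    residueEmbedding p v σ h = ψ ↔ ∀ x a, p.IsRes x a → v.IsRes (σ x) (ψ a) := by
  constructor
  · rintro rfl x a ha
    exact residueEmbedding_isRes h ha
  · intro h'
    ext a
    obtain ⟨x, hx⟩ := isRes_surjective (A := p.toValuationSubring) a
    exact (residueEmbedding_isRes h hx).unique (h' x a hx)

/-- The restriction of a valuation ring along an embedding. -/
def KValuationRing.comap (v : KValuationRing k F) (σ : L →ₐ[k] F) : KValuationRing k L where
  toValuationSubring := v.toValuationSubring.comap (σ : L →+* F)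
  algebraMap_mem' c := by
    change σ (algebraMap k L c) ∈ v.toValuationSubring
    rw [σ.commutes]
    exact v.algebraMap_mem' c

/-- The numerical data of the extension `σ(L) ⊂ F` of valued fields. Here `y` lifts a transcendence
basis of `κ(v)`, a part `X` of which is a transcendence basis over `κ(p)`. -/
theorem isTranscendenceBasis_of_mem_embeddingsAt {d : ℕ} (hd : Algebra.trdeg k L = d)
    {v : DiscVal k F r} {p : KValuationRing k L} {I : Finset (Fin r)} {σ : L →ₐ[k] F}
    (hσ : σ ∈ embeddingsAt p v I)
    {α β : Type*} {b : α → L} {br : α → p.ResidueField} (hbr : IsTranscendenceBasis k br)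
    (hb : ∀ i, p.IsRes (b i) (br i))
    {y : β → F} {yr : β → v.1.ResidueField} {X : Set β}
    (hyr : IsTranscendenceBasis k yr) (hy : ∀ i, v.1.IsRes (y i) (yr i))
    (hX : letI := (residueEmbedding p v.1 σ hσ.1).toRingHom.toAlgebra
      IsTranscendenceBasis p.ResidueField fun i : X => yr i)
    {T : Fin r → Fˣ} (hT : ∀ j, v.lev (T j) = j + 1)
    (hyT : IsTranscendenceBasis k (Sum.elim y fun j => (T j : F)))
    {t : Fin I.card → Lˣ}
    (ht : ∀ j, v.lev (Units.map ((σ : L →+* F) : L →* F) (t j)) = jumpLevel I j.succ) :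
    IsTranscendenceBasis k (Sum.elim b fun j => (t j : L)) ∧
    (letI := σ.toRingHom.toAlgebra;
      IsTranscendenceBasis L
        (Sum.elim (fun i : X => y i) fun j : {i // i ∉ I} => (T j.1 : F))) ∧
    Finite α ∧ Nat.card α + I.card = d ∧ Nonempty (α ≃ (Xᶜ : Set β)) ∧
    ((d + (r - I.card) : ℕ) : Cardinal) ≤ Algebra.trdeg k F := by
  let _ : Algebra L F := σ.toRingHom.toAlgebra
  have _ : IsScalarTower k L F := IsScalarTower.of_algebraMap_eq fun c => (σ.commutes c).symm
  let _ : Algebra p.ResidueField v.1.ResidueField :=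
    (residueEmbedding p v.1 σ hσ.1).toRingHom.toAlgebra
  have _ : IsScalarTower k p.ResidueField v.1.ResidueField :=
    IsScalarTower.of_algebraMap_eq fun c => ((residueEmbedding p v.1 σ hσ.1).commutes c).symm
  exact isTranscendenceBasis_of_jumps p v I hσ.1 (fun x a h => residueEmbedding_isRes hσ.1 h)
    (mem_embeddingsAt_iff.1 hσ).2 hd hbr hb hyr hy hX hT hyT ht

theorem exists_isTranscendenceBasis_of_residueEmbedding (p : KValuationRing k L)
    (v : KValuationRing k F)
    (ρ : p.ResidueField →ₐ[k] v.ResidueField) {β : Type*}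
    {yr : β → v.ResidueField} (hyr : IsTranscendenceBasis k yr) :
    ∃ X : Set β, letI := ρ.toRingHom.toAlgebra
      IsTranscendenceBasis p.ResidueField fun i : X => yr i := by
  let _ : Algebra p.ResidueField v.ResidueField := ρ.toRingHom.toAlgebra
  have _ : IsScalarTower k p.ResidueField v.ResidueField :=
    IsScalarTower.of_algebraMap_eq fun c => (ρ.commutes c).symm
  exact hyr.exists_subset_of_tower

/-- The restricted valuation inherits the levels of v, which yield its rank and isolated subgroups;
its algebraicity condition is the equality case of the transcendence count. -/
theorem exists_mem_embeddingsAt {d : ℕ} (hd : Algebra.trdeg k L = d) (v : DiscVal k F r)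
    (σ : L →ₐ[k] F) : ∃ (I : Finset (Fin r)) (p : DiscVal k L I.card), σ ∈ embeddingsAt p.1 v I ∧
      I.card ≤ d ∧ ((d + (r - I.card) : ℕ) : Cardinal) ≤ Algebra.trdeg k F := by
  classical
  let I : Finset (Fin r) := Finset.univ.filter fun i =>
    ∃ x : Lˣ, v.lev (Units.map ((σ : L →+* F) : L →* F) x) = i + 1
  let p := v.1.comap σ
  have hI : HasJumps v.lev (σ : L →+* F) I := fun i => by
    simp only [I, Finset.mem_filter_univ]
  have hσ : σ ∈ embeddingsAt p v I := mem_embeddingsAt_iff.2 ⟨rfl, hI⟩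
  obtain ⟨t, ht⟩ := hI.exists_lev_eq_jumpLevel
  obtain ⟨Y, hY, hYT⟩ := v.exists_isTranscendenceBasis
  choose T hT hTv using fun j : Fin r => v.exists_lev_eq (n := j + 1) (by omega)
  obtain ⟨B, hB⟩ := exists_isTranscendenceBasis k p.ResidueField
  choose b hb using fun i : B => isRes_surjective (A := p.toValuationSubring) i
  obtain ⟨X, hX⟩ := exists_isTranscendenceBasis_of_residueEmbedding p v.1
    (residueEmbedding p v.1 σ hσ.1) hY
  obtain ⟨h1, -, -, h2, -, h3⟩ := isTranscendenceBasis_of_mem_embeddingsAt hd hσ hB hb hY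
    (fun i => isRes_residue _) hX hT (hYT T hT) ht
  have hlev : IsLevel p.toValuationSubring
      fun x => v.lev (Units.map ((σ : L →+* F) : L →* F) x) := v.isLevel.comap (σ : L →+* F)
  obtain ⟨h4, h5⟩ := KValuationRing.rank_eq_and_flag hlev (HasRankOneSteps.comp _) (jumpLevel I)
    (jumpLevel_strictMono I) rfl hI.range_eq
  refine ⟨I, ⟨p, ⟨h4, h5, ?_⟩⟩, hσ, by omega, h3⟩
  have hbm : ∀ i, b i ∈ p.toValuationSubring := fun i => (hb i).mem
  have hbi : Function.Injective fun i => (⟨b i, hbm i⟩ : p.toValuationSubring) := fun i j hij =>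
    Subtype.ext ((hb i).unique (by
      have h7 : b i = b j := congrArg Subtype.val hij
      rw [h7]
      exact hb j))
  refine ⟨Set.range fun i => (⟨b i, hbm i⟩ : p.toValuationSubring), t, ?_, ?_, ?_⟩
  · refine (isTranscendenceBasis_equiv' (Equiv.ofInjective _ hbi) ?_).1 hB
    ext i
    exact (hb i).2
  · exact KValuationRing.linearIndependent_val hlev
      (fun i j hij => by
        simp only [ht]
        exact jumpLevel_strictMono I (Fin.succ_lt_succ_iff.2 hij))
      (fun j => by simp only [ht]; exact Nat.succ_pos _)
  · have h6 := h1.isAlgebraic_field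
    rw [Set.Sum.elim_range] at h6
    rw [← Set.range_comp]
    exact h6

end EmbeddingsAt

/-! ### Maps determined on transcendence bases -/

theorem IsTranscendenceBasis.exists_algHom {K E F ι : Type*} [Field K] [Field E] [Field F]
    [Algebra K E] [Algebra K F] [IsAlgClosed F] {x : ι → E} {y : ι → F}
    (hx : IsTranscendenceBasis K x) (hy : AlgebraicIndependent K y) :
    ∃ ψ : E →ₐ[K] F, ∀ i, ψ (x i) = y i := by
  have := hx.isAlgebraic_field
  let f : IntermediateField.adjoin K (Set.range x) →ₐ[K] F :=
    ((IntermediateField.adjoin K (Set.range y)).val.comp hy.aevalEquivField.toAlgHom).comp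
      hx.1.aevalEquivField.symm.toAlgHom
  have hf : ∀ i (hi : x i ∈ IntermediateField.adjoin K (Set.range x)), f ⟨x i, hi⟩ = y i := by
    intro i hi
    have h1 : hx.1.aevalEquivField.symm ⟨x i, hi⟩ =
        algebraMap (MvPolynomial ι K) _ (MvPolynomial.X i) := by
      rw [AlgEquiv.symm_apply_eq]
      apply Subtype.val_injective
      rw [AlgebraicIndependent.aevalEquivField_algebraMap_apply_coe, MvPolynomial.aeval_X]
    change ((hy.aevalEquivField (hx.1.aevalEquivField.symm ⟨x i, hi⟩) : _) : F) = y i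
    rw [h1, AlgebraicIndependent.aevalEquivField_algebraMap_apply_coe, MvPolynomial.aeval_X]
  let _ : Algebra (IntermediateField.adjoin K (Set.range x)) F := f.toRingHom.toAlgebra
  let g : E →ₐ[IntermediateField.adjoin K (Set.range x)] F := IsAlgClosed.lift
  have hg : ∀ z : IntermediateField.adjoin K (Set.range x), g z = f z := g.commutes
  refine ⟨{ g.toRingHom with commutes' := fun c => ?_ }, fun i => ?_⟩
  · exact (hg (algebraMap K _ c)).trans (f.commutes c)
  · have hi : x i ∈ IntermediateField.adjoin K (Set.range x) :=
      IntermediateField.subset_adjoin _ _ ⟨i, rfl⟩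
    exact (hg ⟨x i, hi⟩).trans (hf i hi)

/-- F is algebraic over the image of f, which is algebraically closed. -/
theorem IsTranscendenceBasis.surjective_of_mem_range {R E F ι : Type*} [CommRing R] [Nontrivial R]
    [Field E] [Field F] [IsAlgClosed E] [Algebra R F] {y : ι → F} (hy : IsTranscendenceBasis R y)
    (f : E →+* F) (h1 : ∀ c, algebraMap R F c ∈ f.range) (h2 : ∀ i, y i ∈ f.range) :
    Function.Surjective f := by
  have hmem : ∀ z : Algebra.adjoin R (Set.range y), (z : F) ∈ f.range := fun z =>
    Algebra.adjoin_induction (p := fun z _ => z ∈ f.range) (by rintro _ ⟨i, rfl⟩; exact h2 i)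
      h1 (fun _ _ _ _ => add_mem) (fun _ _ _ _ => mul_mem) z.2
  let e := RingEquiv.ofLeftInverse (Function.leftInverse_invFun f.injective)
  let g : Algebra.adjoin R (Set.range y) →+* E :=
    e.symm.toRingHom.comp ((Algebra.adjoin R (Set.range y)).val.toRingHom.codRestrict f.range hmem)
  have hg : ∀ z, f (g z) = z := fun z => congrArg Subtype.val (e.apply_symm_apply ⟨z, hmem z⟩)
  have hgi : Function.Injective g := fun z w h => Subtype.ext (by rw [← hg z, h, hg w])
  let _ : Algebra E F := f.toAlgebra
  have halg : Algebra.IsAlgebraic E F := by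
    refine ⟨fun a => ?_⟩
    obtain ⟨q, hq, hqa⟩ := hy.isAlgebraic.isAlgebraic a
    refine ⟨q.map g, (Polynomial.map_ne_zero_iff hgi).2 hq, ?_⟩
    rw [Polynomial.aeval_def, Polynomial.eval₂_map]
    rw [Polynomial.aeval_def] at hqa
    have hcomp : f.comp g = algebraMap (Algebra.adjoin R (Set.range y)) F := RingHom.ext hg
    change Polynomial.eval₂ (f.comp g) a q = 0
    rw [hcomp]
    exact hqa
  exact IsAlgClosed.algebraMap_bijective_of_isIntegral.2

/-- Outside A the inverse has residue 0, and this is preserved; so compatibility with residues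
already controls the whole ring. -/
theorem ValuationSubring.comap_eq_of_isRes {E F : Type*} [Field E] [Field F]
    {A : ValuationSubring E} {V : ValuationSubring F} {σ : E →+* F}
    {ψ : IsLocalRing.ResidueField A →+* IsLocalRing.ResidueField V}
    (h : ∀ x a, A.IsRes x a → V.IsRes (σ x) (ψ a)) : V.comap σ = A := by
  ext x
  constructor
  · intro hx
    by_contra hxA
    have h1 : A.IsRes x⁻¹ 0 := by
      refine isRes_zero_iff_or.2 (Or.inr ?_)
      rwa [inv_inv]
    have h2 := h _ _ h1
    rw [map_zero, isRes_zero_iff_or, map_inv₀, inv_inv, inv_eq_zero] at h2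
    rcases h2 with h2 | h2
    · rw [map_eq_zero] at h2
      rw [h2] at hxA
      exact hxA A.zero_mem
    · exact h2 hx
  · intro hx
    obtain ⟨a, ha⟩ := exists_isRes hx
    exact (h x a ha).mem

/-! ### Decomposition and inertia groups -/

section Decomposition

variable {k L F : Type*} [Field k] [Field L] [Field F] [Algebra k L] [Algebra k F] {r : ℕ}

theorem mem_decomp_iff {v : DiscVal k F r} {g : F ≃ₐ[k] F} :
    g ∈ v.decomp ↔ v.1.toValuationSubring.comap ((g : F →ₐ[k] F) : F →+* F) =
      v.1.toValuationSubring := by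
  rw [MulAction.mem_stabilizer_iff]
  constructor
  · intro h
    ext x
    change g x ∈ v.1.toValuationSubring ↔ _
    conv_lhs => rw [← h]
    exact smul_mem_pointwise_smul_iff
  · intro h
    ext x
    rw [mem_pointwise_smul_iff_inv_smul_mem]
    conv_lhs => rw [← h]
    change g (g⁻¹ x) ∈ v.1.toValuationSubring ↔ _
    rw [← AlgEquiv.mul_apply, mul_inv_cancel, AlgEquiv.one_apply]

/-- Transporting the levels by g gives a level function of the same ring with the same range, so
uniqueness applies. -/
theorem lev_map_of_mem_decomp {v : DiscVal k F r} {g : F ≃ₐ[k] F} (hg : g ∈ v.decomp) (x : Fˣ) :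
    v.lev (Units.map (((g : F →ₐ[k] F) : F →+* F) : F →* F) x) = v.lev x := by
  have h1 := v.isLevel.comap ((g : F →ₐ[k] F) : F →+* F)
  rw [mem_decomp_iff.1 hg] at h1
  refine congrFun (h1.eq_of_range_eq (HasRankOneSteps.comp _) v.isLevel v.hasRankOneSteps ?_) x
  ext n
  constructor
  · rintro ⟨x, rfl⟩
    exact ⟨_, rfl⟩
  · rintro ⟨x, rfl⟩
    refine ⟨Units.map (((g.symm : F →ₐ[k] F) : F →+* F) : F →* F) x, ?_⟩
    simp only
    congr 1
    ext
    exact g.apply_symm_apply x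

theorem smul_mem_embeddingsAt {v : DiscVal k F r} {p : KValuationRing k L} {I : Finset (Fin r)}
    {σ : L →ₐ[k] F} (hσ : σ ∈ embeddingsAt p v I) {g : F ≃ₐ[k] F} (hg : g ∈ v.decomp) :
    g • σ ∈ embeddingsAt p v I := by
  obtain ⟨h1, h2⟩ := mem_embeddingsAt_iff.1 hσ
  refine mem_embeddingsAt_iff.2 ⟨?_, fun i => ?_⟩
  · rw [← h1]
    conv_rhs => rw [← mem_decomp_iff.1 hg]
    rfl
  · rw [← h2 i]
    refine exists_congr fun x => ?_
    rw [← lev_map_of_mem_decomp hg (Units.map ((σ : L →+* F) : L →* F) x)]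
    rfl

theorem mem_inertia_iff {v : DiscVal k F r} {g : v.decomp} :
    g ∈ v.inertia ↔ ∀ x a, v.1.IsRes x a → v.1.IsRes ((g : F ≃ₐ[k] F) x) a := by
  have h0 : g ∈ v.inertia ↔ ∀ a : v.1.ResidueField, g • a = a := by
    change MulSemiringAction.toRingAut _ _ g = 1 ↔ _
    rw [RingEquiv.ext_iff]
    rfl
  rw [h0]
  have h1 : ∀ x a, v.1.IsRes x a → v.1.IsRes ((g : F ≃ₐ[k] F) x) (g • a) := by
    rintro x a ⟨hx, rfl⟩
    rw [← IsLocalRing.ResidueField.residue_smul]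
    exact isRes_residue (g • (⟨x, hx⟩ : v.1.toValuationSubring))
  constructor
  · intro h x a hx
    rw [← h a]
    exact h1 x a hx
  · intro h a
    obtain ⟨x, hx⟩ := isRes_surjective (A := v.1.toValuationSubring) a
    exact (h1 x a hx).unique (h x a hx)

theorem residueEmbedding_smul {v : DiscVal k F r} {p : KValuationRing k L} {I : Finset (Fin r)}
    {σ τ : L →ₐ[k] F} (hσ : σ ∈ embeddingsAt p v I) (hτ : τ ∈ embeddingsAt p v I) {g : v.decomp}
    (hg : g ∈ v.inertia) (h : g • σ = τ) :
    residueEmbedding p v.1 τ hτ.1 = residueEmbedding p v.1 σ hσ.1 := by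
  rw [residueEmbedding_eq_iff]
  rintro x a ha
  rw [← h]
  exact mem_inertia_iff.1 hg _ _ (residueEmbedding_isRes hσ.1 ha)

end Decomposition

/-! ### Constructing embeddings and automorphisms -/

section Realization

variable {k L F : Type*} [Field k] [Field L] [Field F] [Algebra k L] [Algebra k F] {r : ℕ}

/-- Elements of all positive levels and a lift of a transcendence basis of the residue field. -/
theorem DiscVal.exists_levels (v : DiscVal k F r) :
    ∃ t : Fin r → Fˣ, (∀ j, v.lev (t j) = j + 1) ∧ ∀ j, (t j : F) ∈ v.1.toValuationSubring := by
  choose T hT hTv using fun j : Fin r => v.exists_lev_eq (n := j + 1) (by omega)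
  exact ⟨T, hT, hTv⟩

/-- Since p has rank s, a power of any x has the value of a monomial in t, and the level of that
monomial is the level of one t j. -/
theorem hasJumps_of_lev_eq {s : ℕ} (p : DiscVal k L s) {v : DiscVal k F r} {σ : L →+* F}
    (hσ : v.1.toValuationSubring.comap σ = p.1.toValuationSubring) {I : Finset (Fin r)}
    (hs : I.card = s) {t : Fin s → Lˣ} (ht : ∀ j, p.lev (t j) = j + 1)
    (hu : ∀ j, v.lev (Units.map (σ : L →* F) (t j)) = jumpLevel I (Fin.cast (by rw [hs]) j.succ)) :
    HasJumps v.lev σ I := by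
  subst hs
  have hlev : IsLevel p.1.toValuationSubring fun x => v.lev (Units.map (σ : L →* F) x) :=
    hσ ▸ v.isLevel.comap σ
  intro i
  constructor
  · rintro ⟨x, hx⟩
    have hli := KValuationRing.linearIndependent_val p.isLevel (t := t)
      (fun i j hij => by simpa [ht] using hij) (fun j => by simp [ht])
    obtain ⟨N, hN, hNx⟩ := Module.exists_zsmul_mem_span_of_rank_eq p.2.rank_eq hli (p.1.val x)
    rw [Submodule.mem_span_range_iff_exists_fun] at hNx
    obtain ⟨m, hm⟩ := hNx
    have h1 : p.1.val (∏ j, t j ^ m j) = p.1.val (x ^ N) := by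
      rw [KValuationRing.val_prod, KValuationRing.val_zpow, ← hm]
      rfl
    have h2 := KValuationRing.lev_eq_of_val_eq hlev h1
    rw [hlev.zpow_eq x N hN, hx] at h2
    have hm0 : m ≠ 0 := by
      rintro rfl
      simp [v.isLevel.one] at h2
    obtain ⟨j, hj, hmax⟩ := IsLevel.exists_max_of_ne_zero hm0
    have h3 := (hlev.prod_zpow (t := t) (fun i j hij => by
        simp only [hu]
        exact jumpLevel_strictMono I (Fin.succ_lt_succ_iff.2 hij))
      (fun j => by simp only [hu]; exact Nat.succ_pos _) m hj hmax).1
    rw [h3, hu] at h2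
    have h4 : (I.orderEmbOfFin rfl j : Fin r) = i := Fin.ext (Nat.succ_injective h2)
    rw [← h4]
    exact I.orderEmbOfFin_mem rfl j
  · intro hi
    have : i ∈ Set.range (I.orderEmbOfFin rfl) := by simpa using hi
    obtain ⟨j, rfl⟩ := this
    exact ⟨t j, hu j⟩

/-- Every embedding of residue fields is induced by some element of `O_{p,v,I}`. -/
theorem exists_residueEmbedding_eq [CharZero k] [IsAlgClosed F] (v : DiscVal k F r)
    (I : Finset (Fin r)) (p : DiscVal k L I.card) (ψ : p.1.ResidueField →ₐ[k] v.1.ResidueField) :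
    ∃ (σ : L →ₐ[k] F) (h : σ ∈ embeddingsAt p.1 v I), residueEmbedding p.1 v.1 σ h.1 = ψ := by
  obtain ⟨Y, hY, hYT⟩ := p.exists_isTranscendenceBasis
  obtain ⟨t, ht, htp⟩ := p.exists_levels
  choose u hu huv using fun j : Fin I.card =>
    v.exists_lev_eq (n := jumpLevel I j.succ) (Nat.succ_le_of_lt (Fin.is_lt _))
  choose y hy using fun i : Y => isRes_surjective (A := v.1.toValuationSubring)
    (ψ (IsLocalRing.residue p.1.toValuationSubring i))
  have hum : StrictMono fun j => v.lev (u j) := fun i j hij => by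
    simp only [hu]
    exact jumpLevel_strictMono I (Fin.succ_lt_succ_iff.2 hij)
  have hu0 : ∀ j, 0 < v.lev (u j) := fun j => by simp only [hu]; exact Nat.succ_pos _
  have htm : StrictMono fun j => p.lev (t j) := fun i j hij => by simpa [ht] using hij
  have ht0 : ∀ j, 0 < p.lev (t j) := fun j => by simp [ht]
  have hne : ∀ (c : kˣ) j, v.lev (Units.map (algebraMap k F : k →* F) c) ≠ v.lev (u j) :=
    fun c j => by
      rw [v.1.lev_algebraMap v.isLevel]
      exact (hu0 j).ne
  have hne' : ∀ (c : kˣ) j, p.lev (Units.map (algebraMap k L : k →* L) c) ≠ p.lev (t j) :=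
    fun c j => by
      rw [p.1.lev_algebraMap p.isLevel]
      exact (ht0 j).ne
  have hres : ∀ (c : k) a, p.1.IsRes (algebraMap k L c) a → algebraMap k _ c = a :=
    fun c a h => (p.1.algebraMap_isRes c).unique h
  -- Gauss data over k: basis residues go to their images under ψ, and the j-th level of p goes to
  -- the j-th jump in I.
  have hG : GaussCompat (R := k) p.1.toValuationSubring v.1.toValuationSubring (algebraMap k F)
      (ψ : p.1.ResidueField →+* v.1.ResidueField) (fun i : Y => ((i : p.1.toValuationSubring) : L))
      (fun i : Y => (IsLocalRing.residue p.1.toValuationSubring i : p.1.ResidueField)) y t u :=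
    { compat := fun c a h => by
        rw [← hres c a h]
        change v.1.IsRes _ (ψ _)
        rw [ψ.commutes]
        exact v.1.algebraMap_isRes c
      mem_range := fun c a h => ⟨c, hres c a h⟩
      indep := hY.1
      isRes_left := fun i => isRes_residue _
      isRes_right := hy
      mem_iff := v.isLevel.unitMonomial_mem_iff_of_lev_eq p.isLevel hum htm hu0 ht0 huv htp hne hne'
        (fun c j => by
          rw [v.1.lev_algebraMap v.isLevel, p.1.lev_algebraMap p.isLevel]
          exact iff_of_true (ht0 j) (hu0 j))
        (fun c => iff_of_true (p.1.algebraMap_mem' c) (v.1.algebraMap_mem' c))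
      eq_zero := fun c m h h' => p.isLevel.eq_zero_of_unitMonomial htm ht0 hne' c m
        ((mem_unitGroup_iff_mem_and_inv_mem _ _).2 ⟨h, by rwa [Units.val_inv_eq_inv_val]⟩) }
  have := (hYT t ht).isAlgebraic_field
  obtain ⟨σ', h1, h2, -, h4⟩ := hG.exists_extension
  let σ : L →ₐ[k] F := { σ' with commutes' := h1 }
  have hcomap : v.1.toValuationSubring.comap (σ : L →+* F) = p.1.toValuationSubring :=
    comap_eq_of_isRes h2
  have hσ : σ ∈ embeddingsAt p.1 v I := by
    refine mem_embeddingsAt_iff.2 ⟨hcomap, hasJumps_of_lev_eq p hcomap rfl ht fun j => ?_⟩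
    have : Units.map ((σ : L →+* F) : L →* F) (t j) = u j := Units.ext (h4 j)
    rw [this, hu]
    rfl
  exact ⟨σ, hσ, (residueEmbedding_eq_iff _ _).2 h2⟩

/-- An element of `G_v` that carries `σ₁` to `σ₂` and induces a prescribed map on `κ(v)`. -/
theorem exists_mem_decomp [CharZero L] [IsAlgClosed F] {v : DiscVal k F r}
    {p : KValuationRing k L} {I : Finset (Fin r)} {σ₁ σ₂ : L →ₐ[k] F}
    (h₁ : σ₁ ∈ embeddingsAt p v I) (h₂ : σ₂ ∈ embeddingsAt p v I)
    {β : Type*} {y : β → F} {yr : β → v.1.ResidueField} (hy : ∀ i, v.1.IsRes (y i) (yr i))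
    {T : Fin r → Fˣ} (hT : ∀ j, v.lev (T j) = j + 1) (hTv : ∀ j, (T j : F) ∈ v.1.toValuationSubring)
    {X₁ X₂ : Set β}
    (hX₁ : letI := (residueEmbedding p v.1 σ₁ h₁.1).toRingHom.toAlgebra
      AlgebraicIndependent p.ResidueField fun i : X₁ => yr i)
    (hL₁ : letI := σ₁.toRingHom.toAlgebra
      IsTranscendenceBasis L
        (Sum.elim (fun i : X₁ => y i) fun j : {i // i ∉ I} => (T j.1 : F)))
    (hL₂ : letI := σ₂.toRingHom.toAlgebra
      IsTranscendenceBasis L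
        (Sum.elim (fun i : X₂ => y i) fun j : {i // i ∉ I} => (T j.1 : F)))
    (e : X₁ ≃ X₂) (ψ : v.1.ResidueField →+* v.1.ResidueField)
    (hψ : ∀ a, ψ (residueEmbedding p v.1 σ₁ h₁.1 a) = residueEmbedding p v.1 σ₂ h₂.1 a)
    (hψy : ∀ i : X₁, ψ (yr i) = yr (e i)) :
    ∃ g : v.decomp, g • σ₁ = σ₂ ∧
      ∀ x a, v.1.IsRes x a → v.1.IsRes ((g : F ≃ₐ[k] F) x) (ψ a) := by
  obtain ⟨hc₁, hI₁⟩ := mem_embeddingsAt_iff.1 h₁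
  obtain ⟨hc₂, hI₂⟩ := mem_embeddingsAt_iff.1 h₂
  have hlev₁ : IsLevel p.toValuationSubring
      fun x => v.lev (Units.map ((σ₁ : L →+* F) : L →* F) x) := hc₁ ▸ v.isLevel.comap (σ₁ : L →+* F)
  have hlev₂ : IsLevel p.toValuationSubring
      fun x => v.lev (Units.map ((σ₂ : L →+* F) : L →* F) x) := hc₂ ▸ v.isLevel.comap (σ₂ : L →+* F)
  have hlev : ∀ x, v.lev (Units.map ((σ₁ : L →+* F) : L →* F) x) =
      v.lev (Units.map ((σ₂ : L →+* F) : L →* F) x) :=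
    congrFun (hlev₁.eq_of_range_eq (HasRankOneSteps.comp _) hlev₂ (HasRankOneSteps.comp _)
      (hI₁.range_eq.trans hI₂.range_eq.symm))
  have hmem₁ : ∀ c, σ₁ c ∈ v.1.toValuationSubring ↔ c ∈ p.toValuationSubring := fun c => by
    rw [← hc₁]
    rfl
  have hmem₂ : ∀ c, σ₂ c ∈ v.1.toValuationSubring ↔ c ∈ p.toValuationSubring := fun c => by
    rw [← hc₂]
    rfl
  have hres : ∀ c a, v.1.IsRes (σ₁ c) a →
      ∃ b, residueEmbedding p v.1 σ₁ h₁.1 b = a ∧ p.IsRes c b := fun c a h => by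
    obtain ⟨b, hb⟩ := exists_isRes ((hmem₁ c).1 h.mem)
    exact ⟨b, (residueEmbedding_isRes h₁.1 hb).unique h, hb⟩
  let u : {i // i ∉ I} → Fˣ := fun j => T j.1
  have hum : StrictMono fun j => v.lev (u j) := fun i j hij => by simpa [u, hT] using hij
  have hu0 : ∀ j, 0 < v.lev (u j) := fun j => by simp [u, hT]
  have hne₁ : ∀ (c : Lˣ) j, v.lev (Units.map ((σ₁ : L →+* F) : L →* F) c) ≠ v.lev (u j) :=
    fun c j h => j.2 ((hI₁ j.1).1 ⟨c, by rw [h, hT]⟩)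
  have hne₂ : ∀ (c : Lˣ) j, v.lev (Units.map ((σ₂ : L →+* F) : L →* F) c) ≠ v.lev (u j) :=
    fun c j => by
      rw [← hlev]
      exact hne₁ c j
  -- Gauss data over L, embedded by σ₁ in the source and by σ₂ in the target, with the elements T
  -- outside I kept fixed.
  obtain ⟨g', hg1, hg2, hg3, hg4⟩ : ∃ g : F →+* F, (∀ c, g (σ₁ c) = σ₂ c) ∧
      (∀ z a, v.1.IsRes z a → v.1.IsRes (g z) (ψ a)) ∧ (∀ i : X₁, g (y i) = y (e i)) ∧
      ∀ j, g (u j) = u j := by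
    let _ : Algebra L F := σ₁.toRingHom.toAlgebra
    let _ : Algebra p.ResidueField v.1.ResidueField :=
      (residueEmbedding p v.1 σ₁ h₁.1).toRingHom.toAlgebra
    have hG : GaussCompat (R := p.ResidueField) (K := L) v.1.toValuationSubring
        v.1.toValuationSubring (σ₂ : L →+* F) ψ (fun i : X₁ => y i) (fun i : X₁ => yr i)
        (fun i : X₁ => y (e i)) u u :=
      { compat := fun c a h => by
          obtain ⟨b, rfl, hb⟩ := hres c a h
          rw [hψ]
          exact residueEmbedding_isRes h₂.1 hb
        mem_range := fun c a h => by
          obtain ⟨b, hb, -⟩ := hres c a h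
          exact ⟨b, hb⟩
        indep := hX₁
        isRes_left := fun i => hy i
        isRes_right := fun i => by
          rw [hψy]
          exact hy (e i)
        mem_iff := v.isLevel.unitMonomial_mem_iff_of_lev_eq v.isLevel hum hum hu0 hu0
          (fun j => hTv j.1) (fun j => hTv j.1) hne₂ hne₁
          (fun c j => by
            rw [← hlev]
            rfl)
          (fun c => (hmem₁ c).trans (hmem₂ c).symm)
        eq_zero := fun c m h h' => v.isLevel.eq_zero_of_unitMonomial hum hu0 hne₁ c m
          ((mem_unitGroup_iff_mem_and_inv_mem _ _).2 ⟨h, by rwa [Units.val_inv_eq_inv_val]⟩) }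
    have := hL₁.isAlgebraic_field
    exact hG.exists_extension
  have hsurj : Function.Surjective g' := by
    let _ : Algebra L F := σ₂.toRingHom.toAlgebra
    refine IsTranscendenceBasis.surjective_of_mem_range hL₂ g' (fun c => ⟨σ₁ c, hg1 c⟩) ?_
    rintro (i | j)
    · refine ⟨y (e.symm i), (hg3 _).trans ?_⟩
      rw [e.apply_symm_apply]
      rfl
    · exact ⟨_, hg4 j⟩
  let g₀ : F →ₐ[k] F := { g' with
    commutes' := fun c => by
      have := hg1 (algebraMap k L c)
      rwa [σ₁.commutes, σ₂.commutes] at this }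
  let g := AlgEquiv.ofBijective g₀ ⟨g'.injective, hsurj⟩
  have hg : g ∈ v.decomp := mem_decomp_iff.2 (comap_eq_of_isRes hg2)
  exact ⟨⟨g, hg⟩, AlgHom.ext hg1, hg2⟩

end Realization

/-! ### Cardinality arguments -/

theorem Set.nonempty_equiv_of_finite_compl {β : Type*} {X₁ X₂ : Set β} [Finite (X₁ᶜ : Set β)]
    (e : (X₁ᶜ : Set β) ≃ (X₂ᶜ : Set β)) : Nonempty (X₁ ≃ X₂) := by
  have h : Cardinal.mk (X₁ᶜ : Set β) = Cardinal.mk (X₂ᶜ : Set β) := Cardinal.mk_congr e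
  rw [← Cardinal.eq, ← compl_compl X₁, ← compl_compl X₂]
  cases finite_or_infinite β with
  | inl _ => exact Cardinal.mk_compl_eq_mk_compl_finite_same h
  | inr _ =>
    have h1 : Cardinal.mk (X₁ᶜ : Set β) < Cardinal.mk β :=
      (Cardinal.lt_aleph0_of_finite _).trans_le (Cardinal.aleph0_le_mk β)
    exact Cardinal.mk_compl_eq_mk_compl_infinite h1 (h ▸ h1)

theorem RingHom.exists_comp_eq_of_isTranscendenceBasis {K E F ι : Type*} [Field K] [Field E]
    [Field F] [IsAlgClosed F] {ρ₁ : K →+* E} {ρ₂ : K →+* F} {x : ι → E} {y : ι → F}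
    (hx : letI := ρ₁.toAlgebra
      IsTranscendenceBasis K x)
    (hy : letI := ρ₂.toAlgebra
      AlgebraicIndependent K y) :
    ∃ ψ : E →+* F, (∀ a, ψ (ρ₁ a) = ρ₂ a) ∧ ∀ i, ψ (x i) = y i := by
  let _ : Algebra K E := ρ₁.toAlgebra
  let _ : Algebra K F := ρ₂.toAlgebra
  obtain ⟨ψ, hψ⟩ := hx.exists_algHom hy
  exact ⟨ψ.toRingHom, ψ.commutes, hψ⟩

theorem Cardinal.nonempty_embedding_of_mk_sum {α β : Type*} {n : ℕ∞} {r d s : ℕ}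
    (h1 : Cardinal.mk (β ⊕ Fin r) = (n : Cardinal)) (h2 : Cardinal.mk (α ⊕ Fin s) = d)
    (h : ((r + d : ℕ) : ℕ∞) ≤ n + s) : Nonempty (α ↪ β) := by
  have hαs : Finite (α ⊕ Fin s) := by
    rw [← Cardinal.lt_aleph0_iff_finite, h2]
    exact Cardinal.natCast_lt_aleph0
  have hα : Finite α := Finite.of_injective (Sum.inl : α → α ⊕ Fin s) Sum.inl_injective
  cases finite_or_infinite β with
  | inl hβ =>
    have h3 : Nat.card α + s = d := by
      rw [← Nat.card_fin s, ← Nat.card_sum, Nat.card, h2, Cardinal.toNat_natCast]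
    have h4 : ((Nat.card β + r : ℕ) : ℕ∞) = n := by
      rw [← Cardinal.ofENat_inj, ← h1, Cardinal.ofENat_nat]
      nth_rw 1 [← Nat.card_fin r]
      rw [← Nat.card_sum, Nat.cast_card]
    rw [← h4] at h
    norm_cast at h
    have := Fintype.ofFinite α
    have := Fintype.ofFinite β
    refine Function.Embedding.nonempty_of_card_le ?_
    rw [← Nat.card_eq_fintype_card, ← Nat.card_eq_fintype_card]
    omega
  | inr hβ =>
    rw [← Cardinal.lift_mk_le']
    exact (Cardinal.lift_lt_aleph0.2 (Cardinal.lt_aleph0_of_finite α)).le.trans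
      (Cardinal.aleph0_le_lift.2 (Cardinal.aleph0_le_mk β))

/-! ### Orbits of the decomposition and inertia groups -/

section Orbits

variable {k L F : Type*} [Field k] [Field L] [Field F] [Algebra k L] [Algebra k F] {r : ℕ}
  [IsAlgClosed F] {d : ℕ}

theorem exists_smul_eq_of_mem_embeddingsAt [CharZero k] (hd : Algebra.trdeg k L = d) {v : DiscVal k F r}
    {p : KValuationRing k L} {I : Finset (Fin r)} {σ₁ σ₂ : L →ₐ[k] F}
    (h₁ : σ₁ ∈ embeddingsAt p v I) (h₂ : σ₂ ∈ embeddingsAt p v I) :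
    (∃ g : v.decomp, g • σ₁ = σ₂) ∧
      (residueEmbedding p v.1 σ₁ h₁.1 = residueEmbedding p v.1 σ₂ h₂.1 →
        ∃ g : v.inertia, g • σ₁ = σ₂) := by
  have : CharZero L := charZero_of_injective_algebraMap (algebraMap k L).injective
  obtain ⟨Y, hY, hYT⟩ := v.exists_isTranscendenceBasis
  obtain ⟨T, hT, hTv⟩ := v.exists_levels
  obtain ⟨B, hB⟩ := exists_isTranscendenceBasis k p.ResidueField
  choose b hb using fun i : B => isRes_surjective (A := p.toValuationSubring) i
  have hy : ∀ i : Y, v.1.IsRes ((i : v.1.toValuationSubring) : F)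
      (IsLocalRing.residue v.1.toValuationSubring i) := fun i => isRes_residue _
  have key : ∀ (σ : L →ₐ[k] F) (h : σ ∈ embeddingsAt p v I) (X : Set Y)
      (_ : letI := (residueEmbedding p v.1 σ h.1).toRingHom.toAlgebra
        IsTranscendenceBasis p.ResidueField
          fun i : X => (IsLocalRing.residue v.1.toValuationSubring i : v.1.ResidueField)),
      (letI := σ.toRingHom.toAlgebra;
        IsTranscendenceBasis L (Sum.elim (fun i : X => ((i : v.1.toValuationSubring) : F))
          fun j : {i // i ∉ I} => (T j.1 : F))) ∧
      Finite B ∧ Nonempty (B ≃ (Xᶜ : Set Y)) := by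
    intro σ h X hX
    obtain ⟨t, ht⟩ := (mem_embeddingsAt_iff.1 h).2.exists_lev_eq_jumpLevel
    obtain ⟨-, h1, h2, -, h3, -⟩ := isTranscendenceBasis_of_mem_embeddingsAt hd h hB hb hY hy hX hT
      (hYT T hT) ht
    exact ⟨h1, h2, h3⟩
  obtain ⟨X₁, hX₁⟩ := exists_isTranscendenceBasis_of_residueEmbedding p v.1
    (residueEmbedding p v.1 σ₁ h₁.1) hY
  obtain ⟨hL₁, hBf, ⟨e₁⟩⟩ := key σ₁ h₁ X₁ hX₁
  constructor
  · obtain ⟨X₂, hX₂⟩ := exists_isTranscendenceBasis_of_residueEmbedding p v.1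
      (residueEmbedding p v.1 σ₂ h₂.1) hY
    obtain ⟨hL₂, -, ⟨e₂⟩⟩ := key σ₂ h₂ X₂ hX₂
    have : Finite (X₁ᶜ : Set Y) := Finite.of_equiv _ e₁
    -- Both complements are in bijection with the finite basis B of κ(p), so X₁ and X₂ match even
    -- when Y is infinite.
    obtain ⟨e⟩ := Set.nonempty_equiv_of_finite_compl (e₁.symm.trans e₂)
    obtain ⟨ψ, hψ, hψy⟩ : ∃ ψ : v.1.ResidueField →+* v.1.ResidueField,
        (∀ a, ψ (residueEmbedding p v.1 σ₁ h₁.1 a) = residueEmbedding p v.1 σ₂ h₂.1 a) ∧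
        ∀ i : X₁, ψ (IsLocalRing.residue v.1.toValuationSubring i) =
          IsLocalRing.residue v.1.toValuationSubring (e i) := by
      refine RingHom.exists_comp_eq_of_isTranscendenceBasis hX₁
        (y := fun i : X₁ => IsLocalRing.residue v.1.toValuationSubring (e i)) ?_
      let _ : Algebra p.ResidueField v.1.ResidueField :=
        (residueEmbedding p v.1 σ₂ h₂.1).toRingHom.toAlgebra
      exact hX₂.1.comp e e.injective
    obtain ⟨g, hg, -⟩ := exists_mem_decomp h₁ h₂ hy hT hTv hX₁.1 hL₁ hL₂ e ψ hψ hψy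
    exact ⟨g, hg⟩
  · intro heq
    -- Equal residue embeddings allow the same X on both sides and ψ the identity.
    have hX₂ := hX₁
    rw [heq] at hX₂
    obtain ⟨g, hg, hgr⟩ := exists_mem_decomp h₁ h₂ hy hT hTv hX₁.1 hL₁ (key σ₂ h₂ X₁ hX₂).1
      (Equiv.refl _) (RingHom.id _) (fun a => by rw [heq]; rfl) (fun i => rfl)
    exact ⟨⟨g, mem_inertia_iff.2 hgr⟩, hg⟩

theorem embeddingsAt_eq_orbit [CharZero k] (hd : Algebra.trdeg k L = d) {v : DiscVal k F r}
    {p : KValuationRing k L} {I : Finset (Fin r)} {σ : L →ₐ[k] F} (h : σ ∈ embeddingsAt p v I) :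
    embeddingsAt p v I = MulAction.orbit v.decomp σ := by
  ext τ
  constructor
  · intro hτ
    exact (exists_smul_eq_of_mem_embeddingsAt hd h hτ).1
  · rintro ⟨g, rfl⟩
    exact smul_mem_embeddingsAt h g.2

/-- The additive form removes the truncated subtraction and covers n = ∞. -/
theorem minJumps_le_iff (n : ℕ∞) (r d s : ℕ) :
    minJumps n r d ≤ s ↔ ((r + d : ℕ) : ℕ∞) ≤ n + s := by
  cases n with
  | top => simp [minJumps]
  | coe n =>
    rw [minJumps, ← ENat.natCast_sub, ENat.toNat_natCast]
    norm_cast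
    omega

theorem nonempty_residueEmbedding (hd : Algebra.trdeg k L = d) {n : ℕ∞}
    (hF : Algebra.trdeg k F = (n : Cardinal)) (v : DiscVal k F r) {s : ℕ} (p : DiscVal k L s)
    (hs : minJumps n r d ≤ s) : Nonempty (p.1.ResidueField →ₐ[k] v.1.ResidueField) := by
  obtain ⟨Y, hY, hYT⟩ := v.exists_isTranscendenceBasis
  obtain ⟨T, hT, -⟩ := v.exists_levels
  obtain ⟨Z, hZ, hZt⟩ := p.exists_isTranscendenceBasis
  obtain ⟨t, ht, -⟩ := p.exists_levels
  have h1 := (hYT T hT).cardinalMk_eq_trdeg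
  have h2 := (hZt t ht).cardinalMk_eq_trdeg
  rw [hF] at h1
  rw [hd] at h2
  rw [minJumps_le_iff] at hs
  obtain ⟨e⟩ := Cardinal.nonempty_embedding_of_mk_sum h1 h2 hs
  obtain ⟨ψ, -⟩ := hZ.exists_algHom (hY.1.comp e e.injective)
  exact ⟨ψ⟩

end Orbits

/-! ### Maps out of the residue sum and out of coinvariants -/

section ResidueSum

variable {k L F : Type*} [Field k] [Field L] [Field F] [Algebra k L] [Algebra k F] {r : ℕ}
  {v : DiscVal k F r} {m M : ℕ} {N : Type*} [AddCommMonoid N] [Module ℚ N]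

open Classical in
/-- The linear map on `ResidueSum` with prescribed values on the generators. -/
noncomputable def residueSumLift (c : ∀ (s : Finset.Icc m M) (p : DiscVal k L s) (_ : JumpSet r s),
    (p.1.ResidueField →ₐ[k] v.1.ResidueField) → N) : ResidueSum L v m M →ₗ[ℚ] N :=
  DirectSum.toModule ℚ _ N fun s => DirectSum.toModule ℚ _ N fun p =>
    LinearMap.lsum ℚ _ ℚ fun I => Finsupp.lift N ℚ _ (c s p I)

theorem residueSumLift_residueGen (c : ∀ (s : Finset.Icc m M) (p : DiscVal k L s)
    (_ : JumpSet r s), (p.1.ResidueField →ₐ[k] v.1.ResidueField) → N) (s : Finset.Icc m M)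
    (p : DiscVal k L s) (I : JumpSet r s) (φ : p.1.ResidueField →ₐ[k] v.1.ResidueField) :
    residueSumLift c (residueGen s p I φ) = c s p I φ := by
  classical
  rw [residueSumLift, residueGen, ← DirectSum.lof_eq_of ℚ, DirectSum.toModule_lof,
    ← DirectSum.lof_eq_of ℚ, DirectSum.toModule_lof]
  rw [LinearMap.lsum_piSingle]
  simp

theorem residueSum_hom_ext {f g : ResidueSum L v m M →ₗ[ℚ] N}
    (h : ∀ (s : Finset.Icc m M) (p : DiscVal k L s) (I : JumpSet r s)
      (φ : p.1.ResidueField →ₐ[k] v.1.ResidueField),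
      f (residueGen s p I φ) = g (residueGen s p I φ)) : f = g := by
  classical
  refine DirectSum.linearMap_ext _ fun s => DirectSum.linearMap_ext _ fun p =>
    LinearMap.pi_ext' fun I => Finsupp.lhom_ext' fun φ => LinearMap.ext_ring ?_
  exact h s p I φ

end ResidueSum

theorem Representation.exists_coinvariants_lift {G X N : Type*} [Group G] [MulAction G X]
    [AddCommGroup N] [Module ℚ N] (f : X → N) (hf : ∀ (g : G) x, f (g • x) = f x) :
    ∃ Φ : (Representation.ofMulAction ℚ G X).Coinvariants →ₗ[ℚ] N,
      ∀ x, Φ (Representation.Coinvariants.mk _ (MonoidAlgebra.single x 1)) = f x := by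
  let Φ₀ : MonoidAlgebra ℚ X →ₗ[ℚ] N :=
    (Finsupp.lift N ℚ X f).comp (MonoidAlgebra.coeffLinearEquiv ℚ).toLinearMap
  have hΦ₀ : ∀ x, Φ₀ (MonoidAlgebra.single x 1) = f x := fun x => by simp [Φ₀]
  refine ⟨Representation.Coinvariants.lift _ Φ₀ fun g => ?_, hΦ₀⟩
  refine MonoidAlgebra.lhom_ext' fun x => LinearMap.ext_ring ?_
  change Φ₀ (Representation.ofMulAction ℚ G X g (MonoidAlgebra.single x 1)) =
    Φ₀ (MonoidAlgebra.single x 1)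
  rw [Representation.ofMulAction_single, hΦ₀, hΦ₀, hf]

/-! ### Coinvariants and orbits -/

section Decomposition

variable {k L F : Type*} [Field k] [Field L] [Field F] [Algebra k L] [Algebra k F] {r : ℕ}

/-- The pairs `(I, p)` with `m ≤ |I| ≤ M` and `p ∈ 𝒫^{|I|}_L`. -/
abbrev JumpIndex (k L : Type*) [Field k] [Field L] [Algebra k L] (r m M : ℕ) : Type _ :=
  Σ s : Finset.Icc m M, JumpSet r s × DiscVal k L s

theorem JumpIndex.eq_of_mem {m M : ℕ} {v : DiscVal k F r} {σ : L →ₐ[k] F}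
    {a b : JumpIndex k L r m M} (ha : σ ∈ embeddingsAt a.2.2.1 v a.2.1.1)
    (hb : σ ∈ embeddingsAt b.2.2.1 v b.2.1.1) : a = b := by
  obtain ⟨⟨s, hs⟩, ⟨I, hI⟩, ⟨⟨p, hp⟩, hp'⟩⟩ := a
  obtain ⟨⟨s', hs'⟩, ⟨I', hI'⟩, ⟨⟨p', hq⟩, hq'⟩⟩ := b
  simp only at hI hI'
  have h1 : I = I' := Finset.ext fun i => (ha.2 i).symm.trans (hb.2 i)
  have h2 : p = p' := ha.1.symm.trans hb.1
  subst hI hI' h1 h2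
  rfl

variable {n : ℕ∞} {d : ℕ}

theorem exists_jumpIndex (hF : Algebra.trdeg k F = (n : Cardinal)) (hd : Algebra.trdeg k L = d)
    (v : DiscVal k F r) (σ : L →ₐ[k] F) :
    ∃ a : JumpIndex k L r (minJumps n r d) (min d r), σ ∈ embeddingsAt a.2.2.1 v a.2.1.1 := by
  obtain ⟨I, p, hσ, h1, h2⟩ := exists_mem_embeddingsAt hd v σ
  have h3 : I.card ≤ r := by simpa using I.card_le_univ
  rw [hF, Cardinal.nat_le_ofENat] at h2
  have h4 : minJumps n r d ≤ I.card := by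
    rw [minJumps_le_iff]
    calc ((r + d : ℕ) : ℕ∞) = ((d + (r - I.card) : ℕ) : ℕ∞) + I.card := by norm_cast; omega
      _ ≤ n + I.card := by gcongr
  exact ⟨⟨⟨I.card, Finset.mem_Icc.2 ⟨h4, le_min h1 h3⟩⟩, ⟨I, rfl⟩, p⟩, hσ⟩

variable [IsAlgClosed F] [CharZero k]

theorem exists_residueEmbedding_eq_of_jumpSet (v : DiscVal k F r) {s : ℕ} (I : JumpSet r s)
    (p : DiscVal k L s) (ψ : p.1.ResidueField →ₐ[k] v.1.ResidueField) :
    ∃ (σ : L →ₐ[k] F) (h : σ ∈ embeddingsAt p.1 v I.1), residueEmbedding p.1 v.1 σ h.1 = ψ := by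
  obtain ⟨I, rfl⟩ := I
  exact exists_residueEmbedding_eq v I p ψ

theorem nonempty_embeddingsAt (hF : Algebra.trdeg k F = (n : Cardinal))
    (hd : Algebra.trdeg k L = d) (v : DiscVal k F r) {s : ℕ} (I : JumpSet r s)
    (p : DiscVal k L s) (hs : minJumps n r d ≤ s) : ∃ σ, σ ∈ embeddingsAt p.1 v I.1 := by
  obtain ⟨ψ⟩ := nonempty_residueEmbedding hd hF v p hs
  obtain ⟨σ, hσ, -⟩ := exists_residueEmbedding_eq_of_jumpSet v I p ψ
  exact ⟨σ, hσ⟩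

/-- The residue embedding is invariant under inertia, which gives the map; its inverse sends a
generator to the class of any σ inducing it, and the choice is immaterial by the orbit statement. -/
theorem exists_coinvariants_equiv (hF : Algebra.trdeg k F = (n : Cardinal))
    (hd : Algebra.trdeg k L = d) (v : DiscVal k F r) :
    ∃ e : (Representation.ofMulAction ℚ v.inertia (L →ₐ[k] F)).Coinvariants ≃ₗ[ℚ]
        ResidueSum L v (minJumps n r d) (min d r),
      ∀ (s : Finset.Icc (minJumps n r d) (min d r)) (p : DiscVal k L s) (I : JumpSet r s)
        (σ : L →ₐ[k] F) (hσ : σ ∈ embeddingsAt p.1 v I.1),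
        e (Representation.Coinvariants.mk _ (MonoidAlgebra.single σ 1)) =
          residueGen s p I (residueEmbedding p.1 v.1 σ hσ.1) := by
  choose idx hidx using exists_jumpIndex hF hd v
  let gen : (L →ₐ[k] F) → ResidueSum L v (minJumps n r d) (min d r) := fun σ =>
    residueGen (idx σ).1 (idx σ).2.2 (idx σ).2.1 (residueEmbedding _ _ σ (hidx σ).1)
  have hgen : ∀ (s : Finset.Icc (minJumps n r d) (min d r)) (p : DiscVal k L s) (I : JumpSet r s)
      (σ : L →ₐ[k] F) (hσ : σ ∈ embeddingsAt p.1 v I.1),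
      gen σ = residueGen s p I (residueEmbedding p.1 v.1 σ hσ.1) := by
    intro s p I σ hσ
    -- Generalizing the index lets the equality be substituted in the dependent types.
    have key : ∀ (a : JumpIndex k L r (minJumps n r d) (min d r))
        (ha : σ ∈ embeddingsAt a.2.2.1 v a.2.1.1), a = ⟨s, I, p⟩ →
        residueGen a.1 a.2.2 a.2.1 (residueEmbedding _ _ σ ha.1) =
          residueGen s p I (residueEmbedding p.1 v.1 σ hσ.1) := by
      rintro _ ha rfl
      rfl
    exact key _ (hidx σ) (JumpIndex.eq_of_mem (b := ⟨s, I, p⟩) (hidx σ) hσ)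
  obtain ⟨Φ, hΦ⟩ := Representation.exists_coinvariants_lift (G := v.inertia)
    (N := ResidueSum L v (minJumps n r d) (min d r)) gen (by
      intro g σ
      have h1 : g • σ ∈ embeddingsAt (idx σ).2.2.1 v (idx σ).2.1.1 :=
        smul_mem_embeddingsAt (hidx σ) g.1.2
      rw [hgen _ _ _ _ (hidx σ), hgen _ _ _ _ h1, residueEmbedding_smul (hidx σ) h1 g.2 rfl])
  choose sec hsec hres using fun (s : Finset.Icc (minJumps n r d) (min d r)) (p : DiscVal k L s)
    (I : JumpSet r s) => exists_residueEmbedding_eq_of_jumpSet v I p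
  let Ψ : ResidueSum L v (minJumps n r d) (min d r) →ₗ[ℚ]
      (Representation.ofMulAction ℚ v.inertia (L →ₐ[k] F)).Coinvariants :=
    residueSumLift fun s p I ψ =>
      Representation.Coinvariants.mk _ (MonoidAlgebra.single (sec s p I ψ) 1)
  refine ⟨LinearEquiv.ofLinearMap Φ Ψ (residueSum_hom_ext fun s p I φ => ?_)
    (Representation.Coinvariants.hom_ext (MonoidAlgebra.lhom_ext' fun σ =>
      LinearMap.ext_ring ?_)), fun s p I σ hσ => (hΦ σ).trans (hgen s p I σ hσ)⟩
  · change Φ (Ψ (residueGen s p I φ)) = residueGen s p I φ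
    rw [residueSumLift_residueGen, hΦ, hgen s p I _ (hsec s p I φ), hres]
  · change Ψ (Φ (Representation.Coinvariants.mk _ (MonoidAlgebra.single σ 1))) =
      Representation.Coinvariants.mk _ (MonoidAlgebra.single σ 1)
    rw [hΦ, residueSumLift_residueGen]
    obtain ⟨g, hg⟩ := (exists_smul_eq_of_mem_embeddingsAt hd (hidx σ) (hsec _ _ _ _)).2
      (hres _ _ _ _).symm
    rw [← hg, Representation.Coinvariants.mk_eq_iff, ← Representation.ofMulAction_single]
    exact Representation.Coinvariants.sub_mem_ker _ _

theorem exists_orbit_equiv (hF : Algebra.trdeg k F = (n : Cardinal))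
    (hd : Algebra.trdeg k L = d) (v : DiscVal k F r) :
    ∃ e : MulAction.orbitRel.Quotient v.decomp (L →ₐ[k] F) ≃
        JumpIndex k L r (minJumps n r d) (min d r),
      ∀ (s : Finset.Icc (minJumps n r d) (min d r)) (p : DiscVal k L s) (I : JumpSet r s)
        (σ : L →ₐ[k] F), σ ∈ embeddingsAt p.1 v I.1 →
        e (Quotient.mk _ σ) = ⟨s, I, p⟩ := by
  choose idx hidx using exists_jumpIndex hF hd v
  have h : ∀ a (σ : L →ₐ[k] F), σ ∈ embeddingsAt a.2.2.1 v a.2.1.1 → idx σ = a :=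
    fun a σ hσ => JumpIndex.eq_of_mem (hidx σ) hσ
  let f : MulAction.orbitRel.Quotient v.decomp (L →ₐ[k] F) →
      JumpIndex k L r (minJumps n r d) (min d r) := Quotient.lift idx (by
    rintro _ τ ⟨g, rfl⟩
    exact h _ _ (smul_mem_embeddingsAt (hidx τ) g.2))
  refine ⟨Equiv.ofBijective f ⟨?_, fun a => ?_⟩, fun s p I σ hσ => h ⟨s, I, p⟩ σ hσ⟩
  · rintro ⟨σ⟩ ⟨τ⟩ hστ
    have h1 : idx σ = idx τ := hστ
    have h2 := hidx σ
    rw [h1] at h2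
    exact Quotient.sound (exists_smul_eq_of_mem_embeddingsAt hd (hidx τ) h2).1
  · obtain ⟨σ, hσ⟩ := nonempty_embeddingsAt hF hd v a.2.1 a.2.2 (Finset.mem_Icc.1 a.1.2).1
    exact ⟨Quotient.mk _ σ, h a σ hσ⟩

end Decomposition

theorem proposition3p4 {k F L : Type*} [Field k] [IsAlgClosed k] [CharZero k]
    [Field F] [IsAlgClosed F] [Algebra k F] [Field L] [Algebra k L]
    (n : ℕ∞) (hn : 1 ≤ n) (hF : Algebra.trdeg k F = (n : Cardinal))
    (d : ℕ) (hL : (⊤ : IntermediateField k L).FG) (hd : Algebra.trdeg k L = (d : Cardinal))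
    (r : ℕ) (v : DiscVal k F r) :
    -- each `O_{p,v,I}` is a nonempty orbit of `G_v`
    (∀ (I : Finset (Fin r)) (p : DiscVal k L I.card),
      minJumps n r d ≤ I.card → I.card ≤ min d r →
        ∃ σ : L →ₐ[k] F, embeddingsAt p.1 v I = MulAction.orbit v.decomp σ) ∧
    -- all embeddings form the disjoint union of these sets
    ((⋃ a : (Σ s : Finset.Icc (minJumps n r d) (min d r), JumpSet r s × DiscVal k L s),
        embeddingsAt a.2.2.1 v a.2.1.1) = (Set.univ : Set (L →ₐ[k] F)) ∧
      Pairwise fun a b : (Σ s : Finset.Icc (minJumps n r d) (min d r),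
          JumpSet r s × DiscVal k L s) =>
        Disjoint (embeddingsAt a.2.2.1 v a.2.1.1) (embeddingsAt b.2.2.1 v b.2.1.1)) ∧
    -- the coinvariants of `G_v^†` in `ℚ[{L → F}]`
    (∃ e : (Representation.ofMulAction ℚ v.inertia (L →ₐ[k] F)).Coinvariants ≃ₗ[ℚ]
        ResidueSum L v (minJumps n r d) (min d r),
      ∀ (s : Finset.Icc (minJumps n r d) (min d r)) (p : DiscVal k L s) (I : JumpSet r s)
        (σ : L →ₐ[k] F) (hσ : σ ∈ embeddingsAt p.1 v I.1),
        e (Representation.Coinvariants.mk _ (MonoidAlgebra.single σ 1)) =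
          residueGen s p I (residueEmbedding p.1 v.1 σ hσ.1)) ∧
    -- the orbits of `G_v`
    (∃ e : MulAction.orbitRel.Quotient v.decomp (L →ₐ[k] F) ≃
        (Σ s : Finset.Icc (minJumps n r d) (min d r), JumpSet r s × DiscVal k L s),
      ∀ (s : Finset.Icc (minJumps n r d) (min d r)) (p : DiscVal k L s) (I : JumpSet r s)
        (σ : L →ₐ[k] F), σ ∈ embeddingsAt p.1 v I.1 →
        e (Quotient.mk _ σ) = ⟨s, I, p⟩) := by
  refine ⟨fun I p hm _ => ?_, ⟨Set.eq_univ_of_forall fun σ => ?_, fun a b hab => ?_⟩,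
    exists_coinvariants_equiv hF hd v, exists_orbit_equiv hF hd v⟩
  · obtain ⟨σ, hσ⟩ := nonempty_embeddingsAt hF hd v ⟨I, rfl⟩ p hm
    exact ⟨σ, embeddingsAt_eq_orbit hd hσ⟩
  · obtain ⟨a, ha⟩ := exists_jumpIndex hF hd v σ
    exact Set.mem_iUnion.2 ⟨a, ha⟩
  · exact Set.disjoint_left.2 fun σ ha hb => hab (JumpIndex.eq_of_mem ha hb)
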